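/- **Model.** Let $d\ge 1$ and let $x_0\in[0,1]^d$. One observes $(X_i,Y_i)$, $i=1,\dots,n$, with $Y_i=f(X_i)+\xi_i$, where $X_1,\dots,X_n,\xi_1,\dots,\xi_n$ are independent, each $X_i$ is uniform on $[0,1]^d$, and $\xi_i$ has a Lebesgue density $g_i$ that is symmetric and nonincreasing on the positive half-line; $(g_i)_{i\ge1}$ is a fixed sequence. Write $\mathbb E_f$ for the expectation in this model. **Contrast, noise and kernel.** Let $\rho:\mathbb R\to[0,\infty)$ be a contrast function: $\rho$ is even, convex, differentiable, $\rho(0)=0$, $\rho'$ is $1$-Lipschitz and bounded, $\dot\rho_\infty=\sup|\rho'|$, and there are $L_\rho,\alpha>0$ with $\sup_i\int|\rho''(z+u)-\rho''(z+v)|\,g_i(z)\,dz\le L_\rho|u-v|^\alpha$ for all $u,v\in\mathbb R$. For $c>0$ let $\mathcal G_\rho^{(c)}$ be the set of sequences $(g_i)_i$ as above with $\inf_i\int\rho''(z)g_i(z)\,dz\ge c$. Let $K\ge0$ be a bounded measurable function on $\mathbb R^d$ vanishing outside $[-\frac12,\frac12]^d$, with $\int K=1$ and $K_\infty=\sup K$.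 Assume that $x_0$ is an interior point of $[0,1]^d$ or, more generally, that whenever $K(z)\ne0$ one has $z_j\ge0$ for each $j$ with $x_{0,j}=0$ and $z_j\le0$ for each $j$ with $x_{0,j}=1$. **Estimators.** Let $b\ge1$ be an integer and $M>0$. Let $\mathcal S_b=\{p\in\mathbb N^d:|p|\le b\}$, $N_b=\#\mathcal S_b$, $U(z)=(z^p)_{p\in\mathcal S_b}$, and let $\lambda$ be the smallest eigenvalue of $\int_{[-1/2,1/2]^d}U(x)U(x)^\top K(x)\,dx$. For $h\in(0,1]$ put $V_{x_0}(h)=\prod_j[x_{0,j}-\frac h2,x_{0,j}+\frac h2]\cap[0,1]^d$ and $f_t(x)=\sum_{p\in\mathcal S_b}t_p\big(\frac{x-x_0}h\big)^p\mathbb 1_{V_{x_0}(h)}(x)$. Let $\hat\theta(h)$ be any measurable choice of a minimiser, over $t\in\mathbb R^{N_b}$ with $\|t\|_1\le M$, of $$\frac1{nh^d}\sum_{i=1}^n\rho\big(Y_i-f_t(X_i)\big)K\Big(\frac{X_i-x_0}h\Big),$$ and let $\hat f^h(x_0)=\hat\theta_{0,\dots,0}(h)$ be the $\rho$-LPA estimator.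 **Bandwidth selection.** Let $h_{\min}=(\ln n)^{2/d}n^{-1/d}$, $h_{\max}=n^{-1/(2b+d)}$, $h_k=2^{-k}h_{\max}$, let $\mathbf k_n$ be the largest integer $k$ with $h_k\ge h_{\min}$ (it exists for all large $n$), and write $\hat f^{(k)}=\hat f^{h_k}$. For $r\ge1$ let $$C=\frac{4N_b}{c\lambda}\Big(1+2K_\infty(1\vee\dot\rho_\infty)\sqrt{rd}\Big),\qquad S_n(l)=\Big[\frac{1+l\ln2}{nh_l^d}\Big]^{1/2},$$ $$\hat k=\min\big\{0\le k\le\mathbf k_n:\ |\hat f^{(k)}(x_0)-\hat f^{(l)}(x_0)|\le C\,S_n(l)\ \text{ for all } k<l\le\mathbf k_n\big\},\qquad \hat f^*(x_0)=\hat f^{(\hat k)}(x_0).$$ **Risk.** For $\beta,L>0$ let $\lfloor\beta\rfloor$ be the largest integer strictly smaller than $\beta$, and let $\mathbb H_d(\beta,L,M)$ be the set of $f:[0,1]^d\to\mathbb R$ that have all partial derivatives of order up to $\lfloor\beta\rfloor$ on $[0,1]^d$, with $|\partial^pf(x)-\partial^pf(y)|\le L\|x-y\|_1^{\beta-\lfloor\beta\rfloor}$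 for all $x,y$ and all $|p|=\lfloor\beta\rfloor$, and $\sum_{|p|\le\lfloor\beta\rfloor}\sup_{[0,1]^d}|\partial^pf|\le M$. Let $R_{n,r}[\tilde f,\mathbb H]=\sup_{f\in\mathbb H}\mathbb E_f|\tilde f(x_0)-f(x_0)|^r$ and $$\phi_n(\beta)=\Big(\frac{\varrho_n(\beta)}n\Big)^{\frac\beta{2\beta+d}},\qquad \varrho_n(\beta)=1+\frac{2(b-\beta)}{(2\beta+d)(2b+d)}\ln n .$$ **Theorem.** For every $c>0$, every $(g_i)_i\in\mathcal G_\rho^{(c)}$ and every $r\ge1$, the estimator $\hat f^*$, whose construction involves neither $\beta$ nor $L$, satisfies for all $\beta\in(0,b]$ and all $L>0$ $$\limsup_{n\to\infty}\ \phi_n(\beta)^{-r}\,R_{n,r}\big[\hat f^*(x_0),\mathbb H_d(\beta,L,M)\big]<\infty .$$ That is, $\hat f^*$ is adaptive over $\beta\in(0,b]$, $L>0$ for the family of rates $\{\phi_n(\beta)\}$. -/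

import Mathlib

open MeasureTheory Filter
open scoped ENNReal

noncomputable section

namespace RhoLPA

/-- The unit cube `[0,1]^d`. -/
def cube (d : ℕ) : Set (Fin d → ℝ) := Set.Icc 0 1

/-- The multi-indices `p ∈ ℕ^d` with `|p| = p_1 + ... + p_d ≤ b`. -/
def multiIdx (d b : ℕ) : Finset (Fin d → ℕ) :=
  (Fintype.piFinset fun _ : Fin d => Finset.range (b + 1)).filter fun p => ∑ j, p j ≤ b

theorem mem_multiIdx {d b : ℕ} {p : Fin d → ℕ} : p ∈ multiIdx d b ↔ ∑ j, p j ≤ b := by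
  simp only [multiIdx, Finset.mem_filter, Fintype.mem_piFinset, Finset.mem_range,
    and_iff_right_iff_imp]
  intro h j
  exact Nat.lt_succ_of_le
    ((Finset.single_le_sum (f := p) (fun i _ => Nat.zero_le _) (Finset.mem_univ j)).trans h)

/-- The multi-index `(0,...,0)`. -/
def zeroIdx (d b : ℕ) : multiIdx d b := ⟨0, mem_multiIdx.2 (by simp)⟩

/-- The monomial `z^p`. -/
def monom {d : ℕ} (p : Fin d → ℕ) (z : Fin d → ℝ) : ℝ := ∏ j, z j ^ p j

/-! ### Hölder classes -/

/-- The largest integer strictly smaller than `β`, for `β > 0`. -/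
def strictFloor (β : ℝ) : ℕ := ⌈β⌉₊ - 1

/-- The isotropic Hölder class. A function on `[0,1]^d` is represented by a function on `ℝ^d` of
which only the values on the cube matter. The family `D` consists of the partial derivatives of
`f` on the cube (one-sided on the faces); it is determined by `f` there. -/
def holderClass (d : ℕ) (β L M : ℝ) : Set ((Fin d → ℝ) → ℝ) :=
  {f | ∃ D : (Fin d → ℕ) → (Fin d → ℝ) → ℝ,
    (∀ x ∈ cube d, D 0 x = f x) ∧
    (∀ p : Fin d → ℕ, ∑ j, p j < strictFloor β → ∀ j : Fin d, ∀ x ∈ cube d,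
      HasDerivWithinAt (fun s : ℝ => D p (Function.update x j s)) (D (p + Pi.single j 1) x)
        (Set.Icc 0 1) (x j)) ∧
    (∀ p : Fin d → ℕ, ∑ j, p j = strictFloor β → ∀ x ∈ cube d, ∀ y ∈ cube d,
      |D p x - D p y| ≤ L * (∑ j, |x j - y j|) ^ (β - (strictFloor β : ℝ))) ∧
    ∑ p ∈ multiIdx d (strictFloor β), ⨆ x ∈ cube d, ENNReal.ofReal |D p x|
      ≤ ENNReal.ofReal M}

/-! ### Contrast function, noise densities and kernel -/

/-- `g` is a symmetric probability density, nonincreasing on the positive half-line. -/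
structure IsNoiseDensity (g : ℝ → ℝ) : Prop where
  measurable : Measurable g
  nonneg : ∀ z, 0 ≤ g z
  integral_eq_one : ∫ z, g z = 1
  symm : ∀ z, g (-z) = g z
  anti : AntitoneOn g (Set.Ioi 0)

/-- `ρ` is a contrast function (for the noise densities `g`). -/
structure IsContrast (ρ : ℝ → ℝ) (g : ℕ → ℝ → ℝ) : Prop where
  nonneg : ∀ z, 0 ≤ ρ z
  symm : ∀ z, ρ (-z) = ρ z
  convex : ConvexOn ℝ Set.univ ρ
  zero : ρ 0 = 0
  differentiable : Differentiable ℝ ρ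
  lipschitz : LipschitzWith 1 (deriv ρ)
  bounded : BddAbove (Set.range fun z => |deriv ρ z|)
  ae_differentiable : ∀ᵐ z : ℝ, DifferentiableAt ℝ (deriv ρ) z
  holder : ∃ Lρ > 0, ∃ α > 0, ∀ i, ∀ u v : ℝ,
    ∫ z, |deriv (deriv ρ) (z + u) - deriv (deriv ρ) (z + v)| * g i z ≤ Lρ * |u - v| ^ (α : ℝ)

/-- The class of sequences of noise densities with `inf_i ∫ ρ'' g_i ≥ c`. -/
def noiseClass (ρ : ℝ → ℝ) (c : ℝ) : Set (ℕ → ℝ → ℝ) :=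
  {g | (∀ i, IsNoiseDensity (g i)) ∧ ∀ i, c ≤ ∫ z, deriv (deriv ρ) z * g i z}

/-- The box `[-1/2,1/2]^d`. -/
def kernelBox (d : ℕ) : Set (Fin d → ℝ) := Set.Icc (fun _ => -(1 / 2)) (fun _ => 1 / 2)

/-- `K` is a kernel function. -/
structure IsKernel {d : ℕ} (K : (Fin d → ℝ) → ℝ) : Prop where
  measurable : Measurable K
  nonneg : ∀ z, 0 ≤ K z
  support : ∀ z, K z ≠ 0 → z ∈ kernelBox d
  bounded : BddAbove (Set.range fun z => |K z|)
  integral_eq_one : ∫ z, K z = 1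

/-- The support of the kernel, scaled by small `h` and moved to `x₀`, lies in the unit cube.
No condition when `x₀` is an interior point of the cube. -/
def KernelInward {d : ℕ} (K : (Fin d → ℝ) → ℝ) (x₀ : Fin d → ℝ) : Prop :=
  ∀ z, K z ≠ 0 → ∀ j, (x₀ j = 0 → 0 ≤ z j) ∧ (x₀ j = 1 → z j ≤ 0)

/-- The sup-norm. -/
def supNorm {α : Type*} (f : α → ℝ) : ℝ := ⨆ x, |f x|

/-- The matrix `∫_{[-1/2,1/2]^d} U(x) U(x)ᵀ K(x) dx`. -/
def kernelMatrix {d : ℕ} (b : ℕ) (K : (Fin d → ℝ) → ℝ) :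
    Matrix (multiIdx d b) (multiIdx d b) ℝ :=
  Matrix.of fun p q => ∫ x in kernelBox d, monom p.1 x * monom q.1 x * K x

/-- The smallest eigenvalue `λ` of that matrix. -/
def minEigenvalue {d : ℕ} (b : ℕ) (K : (Fin d → ℝ) → ℝ) : ℝ :=
  sInf (spectrum ℝ (kernelMatrix b K))

/-! ### The local polynomial M-estimator -/

/-- A sample `(X_i, Y_i)`, `i = 1,...,n`. -/
abbrev Sample (d n : ℕ) : Type := Fin n → (Fin d → ℝ) × ℝ

/-- The neighbourhood `V_{x₀}(h)`. -/
def nbhd {d : ℕ} (x₀ : Fin d → ℝ) (h : ℝ) : Set (Fin d → ℝ) :=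
  Set.Icc (fun j => x₀ j - h / 2) (fun j => x₀ j + h / 2) ∩ cube d

/-- The local polynomial `f_t`. -/
def localPoly {d b : ℕ} (x₀ : Fin d → ℝ) (h : ℝ) (t : multiIdx d b → ℝ) : (Fin d → ℝ) → ℝ :=
  (nbhd x₀ h).indicator fun x => ∑ p : multiIdx d b, t p * monom p.1 (fun j => (x j - x₀ j) / h)

/-- The parameter set `Θ(M)`. -/
def paramSet (d b : ℕ) (M : ℝ) : Set (multiIdx d b → ℝ) := {t | ∑ p, |t p| ≤ M}

/-- The local `ρ`-criterion. -/
def criterion {d n b : ℕ} (ρ : ℝ → ℝ) (K : (Fin d → ℝ) → ℝ) (x₀ : Fin d → ℝ) (h : ℝ)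
    (Z : Sample d n) (t : multiIdx d b → ℝ) : ℝ :=
  1 / (n * h ^ d) * ∑ i, ρ ((Z i).2 - localPoly x₀ h t (Z i).1) *
    K (fun j => ((Z i).1 j - x₀ j) / h)

/-- `θ` is a (measurable) minimiser of the local `ρ`-criterion over `Θ(M)`. -/
def IsLPAMinimizer {d n b : ℕ} (ρ : ℝ → ℝ) (K : (Fin d → ℝ) → ℝ) (x₀ : Fin d → ℝ) (M h : ℝ)
    (θ : Sample d n → multiIdx d b → ℝ) : Prop :=
  Measurable θ ∧ ∀ Z, θ Z ∈ paramSet d b M ∧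
    ∀ t ∈ paramSet d b M, criterion ρ K x₀ h Z (θ Z) ≤ criterion ρ K x₀ h Z t

/-! ### The bandwidth selection rule -/

def hMin (d n : ℕ) : ℝ := Real.log n ^ (2 / d : ℝ) * (n : ℝ) ^ (-(1 / d) : ℝ)

def hMax (d b n : ℕ) : ℝ := (n : ℝ) ^ (-(1 / (2 * b + d)) : ℝ)

/-- The dyadic grid `h_k = 2^{-k} h_max`. -/
def bandwidth (d b n k : ℕ) : ℝ := hMax d b n / 2 ^ k

/-- The largest `k` with `h_k ≥ h_min` (it exists for all large `n`). -/
def kLast (d b n : ℕ) : ℕ := sSup {k : ℕ | hMin d n ≤ bandwidth d b n k}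

/-- `S_n(l)`. -/
def stdBound (d b n l : ℕ) : ℝ :=
  Real.sqrt ((1 + l * Real.log 2) / (n * bandwidth d b n l ^ d))

/-- The threshold constant `C`. -/
def thresholdConst {d : ℕ} (b : ℕ) (ρ : ℝ → ℝ) (K : (Fin d → ℝ) → ℝ) (c r : ℝ) : ℝ :=
  4 * (multiIdx d b).card / (c * minEigenvalue b K) *
    (1 + 2 * supNorm K * max 1 (supNorm (deriv ρ)) * Real.sqrt (r * d))

/-- The estimator `f̂^{(k)}(x₀)`, for a given family `θ n h` of minimisers. -/
def lpaEstimator {d b : ℕ} (θ : (n : ℕ) → ℝ → Sample d n → multiIdx d b → ℝ) (n k : ℕ)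
    (Z : Sample d n) : ℝ :=
  θ n (bandwidth d b n k) Z (zeroIdx d b)

/-- The selected index `k̂`. -/
def selectedIndex {d b : ℕ} (C : ℝ) (θ : (n : ℕ) → ℝ → Sample d n → multiIdx d b → ℝ) (n : ℕ)
    (Z : Sample d n) : ℕ :=
  sInf {k : ℕ | k ≤ kLast d b n ∧ ∀ l, k + 1 ≤ l → l ≤ kLast d b n →
    |lpaEstimator θ n k Z - lpaEstimator θ n l Z| ≤ C * stdBound d b n l}

/-- The estimator `f̂*(x₀)` selected by Lepski's rule. -/
def adaptiveEstimator {d b : ℕ} (C : ℝ) (θ : (n : ℕ) → ℝ → Sample d n → multiIdx d b → ℝ)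
    (n : ℕ) (Z : Sample d n) : ℝ :=
  lpaEstimator θ n (selectedIndex C θ n Z) Z

/-! ### The model and the risk -/

/-- The joint law of `(X_i, ξ_i)`, `i = 1,...,n`: everything independent, `X_i` uniform on the
cube and `ξ_i` with density `g_i`. -/
def modelLaw (d : ℕ) (g : ℕ → ℝ → ℝ) (n : ℕ) : Measure (Sample d n) :=
  Measure.pi fun i : Fin n => (volume.restrict (cube d)).prod
    (volume.withDensity fun z : ℝ => ENNReal.ofReal (g i z))

/-- The observations `(X_i, f(X_i) + ξ_i)`. -/
def observe {d n : ℕ} (f : (Fin d → ℝ) → ℝ) (ω : Sample d n) : Sample d n :=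
  fun i => ((ω i).1, f (ω i).1 + (ω i).2)

/-- The maximal risk over a class `F` of an estimator of `f x₀`. -/
def maxRisk {d n : ℕ} (g : ℕ → ℝ → ℝ) (r : ℝ) (x₀ : Fin d → ℝ) (est : Sample d n → ℝ)
    (F : Set ((Fin d → ℝ) → ℝ)) : ℝ≥0∞ :=
  ⨆ f ∈ F, ∫⁻ ω, ENNReal.ofReal (|est (observe f ω) - f x₀| ^ r) ∂(modelLaw d g n)

/-- `ϱ_n(β)`. -/
def adaptPrice (d b n : ℕ) (β : ℝ) : ℝ :=
  1 + 2 * (b - β) / ((2 * β + d) * (2 * b + d)) * Real.log n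

/-- The rate `φ_n(β)`. -/
def rate (d b n : ℕ) (β : ℝ) : ℝ := (adaptPrice d b n β / n) ^ (β / (2 * β + d))

end RhoLPA

end

/-! The estimator minimises a convex criterion, so its error is a contest between the score at a
reference point and the curvature around it. The reference point `t` consists of the rescaled Taylor
coefficients of `f` at `x₀` (`holderClass_expansion`). The approximation error `u` is then at most
`L (d h)^β` wherever the scaled kernel lives. Averaged over the noise, `ρ'` becomes a 1-Lipschitz
function that vanishes at 0 and has slope at least `3c/4` near 0 (`smoothScore_strongly_monotone`).
Hence each score coordinate has mean at most `sup |u| h^d` per observation, and the mean curvature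
in every unit direction is at least `(3/4) c λ h^d`, where `λ > 0` because a nonzero polynomial
vanishes only on a null set.

If the minimiser is farther than `s` from `t`, convexity makes the criterion nonincreasing at radius
`s` in its direction, so the score at `t` must outweigh `s` times the empirical curvature at radius
`s` (`curvature_mul_le_scoreNorm`). Only curvature at fixed radii is needed, and it is too small
with probability of order `exp(-c₁ n h^d)` (`exists_measure_flatSet_le`). A dyadic grid of radii
then bounds the error linearly in the normalised score (`estimator_error_le`). Every bandwidth of
the grid has `n h^d ≥ ln² n`, so bad curvature is rarer than any power of `n`. The estimators are
bounded by `M`, hence this event is negligible.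

Write `k*` for the oracle index. For `l ≥ k*` the bias is at most `S_n(l)`, and `C` is calibrated so
that an error above `C S_n(l) / 2` forces the normalised score over a level passed with probability
at most `2 N_b 2^{-2rdl}` (`measure_le_scoreNorm_le`). The summand `l ln 2` in `S_n(l)²` pays for
this decay. If the rule selects some `k̂ > k*`, then such an error occurs for some `l ≥ k̂ - 1`
(`lepski_alternative`). The loss `S_n(k̂)^r` exceeds `S_n(k*)^r` by a factor of at most `((1 + k̂)
2^{k̂ d})^{r/2}`, which the square root `2^{-rdl}` of the tail beats. The sum over `l` converges and
the risk is of order `S_n(k*)^r`, without a further logarithm (`exists_lepski_risk_le`).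

Finally `k* ln 2` is essentially `ln(h_max / h_{k*})`, and `1 + k* ln 2` is comparable to `ϱ_n(β)`.
This is why balancing bias against `S_n` produces exactly `φ_n(β)` (`exists_oracle_index`). -/

namespace RhoLPA

/-! ### Taylor expansion in Hölder classes -/

/-- The multi-index factorial `p! = p_1! ⋯ p_d!`. -/
noncomputable def multiFactorial {d : ℕ} (p : Fin d → ℕ) : ℝ := ∏ j, ((p j).factorial : ℝ)

theorem one_le_multiFactorial {d : ℕ} (p : Fin d → ℕ) : 1 ≤ multiFactorial p := by
  unfold multiFactorial
  have : ∏ j : Fin d, (1 : ℝ) ≤ ∏ j, ((p j).factorial : ℝ) :=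
    Finset.prod_le_prod (fun _ _ => zero_le_one)
      (fun j _ => by exact_mod_cast Nat.succ_le_of_lt (Nat.factorial_pos (p j)))
  simpa using this

/-- The Taylor polynomial of order `k` at `x` of the partial derivative of order `p`. -/
noncomputable def taylorPoly {d : ℕ} (D : (Fin d → ℕ) → (Fin d → ℝ) → ℝ) (k : ℕ) (p : Fin d → ℕ)
    (x y : Fin d → ℝ) : ℝ :=
  ∑ q ∈ multiIdx d k, D (p + q) x * (monom q (y - x) / multiFactorial q)

theorem hasDerivAt_monom_update {d : ℕ} (q : Fin d → ℕ) (x y : Fin d → ℝ) (j : Fin d) :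
    HasDerivAt (fun s => monom q (Function.update y j s - x))
      ((q j : ℝ) * (y j - x j) ^ (q j - 1) *
        ∏ i ∈ Finset.univ.erase j, (y i - x i) ^ q i) (y j) := by
  have h : (fun s => monom q (Function.update y j s - x)) =
      fun s => (s - x j) ^ q j * ∏ i ∈ Finset.univ.erase j, (y i - x i) ^ q i := by
    funext s
    unfold monom
    rw [← Finset.mul_prod_erase _ _ (Finset.mem_univ j)]
    congr 1
    · simp
    · refine Finset.prod_congr rfl fun i hi => ?_
      rw [Pi.sub_apply, Function.update_of_ne (Finset.ne_of_mem_erase hi)]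
  rw [h]
  have h1 := ((hasDerivAt_id (y j)).sub_const (x j)).pow (q j)
  simpa using h1.mul_const (∏ i ∈ Finset.univ.erase j, (y i - x i) ^ q i)

theorem multiFactorial_add_single {d : ℕ} (q : Fin d → ℕ) (j : Fin d) :
    multiFactorial (q + Pi.single j 1) = ((q j : ℝ) + 1) * multiFactorial q := by
  unfold multiFactorial
  rw [← Finset.mul_prod_erase _ _ (Finset.mem_univ j),
    ← Finset.mul_prod_erase (a := j) (f := fun j => ((q j).factorial : ℝ)) _ (Finset.mem_univ j)]
  have : ∏ i ∈ Finset.univ.erase j, (((q + Pi.single j 1 : Fin d → ℕ) i).factorial : ℝ)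
      = ∏ i ∈ Finset.univ.erase j, ((q i).factorial : ℝ) := by
    refine Finset.prod_congr rfl fun i hi => ?_
    rw [Pi.add_apply, Pi.single_eq_of_ne (Finset.ne_of_mem_erase hi), add_zero]
  rw [this]
  simp [Nat.factorial_succ]
  ring

theorem sum_add_single {d : ℕ} (q : Fin d → ℕ) (j : Fin d) :
    ∑ i, (q + Pi.single j 1 : Fin d → ℕ) i = ∑ i, q i + 1 := by
  simp [Finset.sum_add_distrib]

/-- Multi-indices with `q j = 0` are constant in the `j`-th coordinate. The others are `q' + e_j`,
and the factor `q' j + 1` produced by the derivative cancels against the factorial. Differentiation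
thus lowers the order and shifts the base index, which drives the induction for the remainder. -/
theorem hasDerivAt_taylorPoly_update {d : ℕ} (D : (Fin d → ℕ) → (Fin d → ℝ) → ℝ) (k : ℕ)
    (p : Fin d → ℕ) (x y : Fin d → ℝ) (j : Fin d) :
    HasDerivAt (fun s => taylorPoly D (k + 1) p x (Function.update y j s))
      (taylorPoly D k (p + Pi.single j 1) x y) (y j) := by
  set T : (Fin d → ℕ) → ℝ := fun q => D (p + q) x * (((q j : ℝ) * (y j - x j) ^ (q j - 1) *
        ∏ i ∈ Finset.univ.erase j, (y i - x i) ^ q i) / multiFactorial q) with hT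
  have h1 : HasDerivAt (fun s => taylorPoly D (k + 1) p x (Function.update y j s))
      (∑ q ∈ multiIdx d (k + 1), T q) (y j) := by
    unfold taylorPoly
    exact HasDerivAt.fun_sum fun q _ =>
      ((hasDerivAt_monom_update q x y j).div_const _).const_mul _
  convert h1 using 1
  have hinj : Function.Injective fun q : Fin d → ℕ => q + Pi.single j 1 :=
    add_left_injective (Pi.single j 1)
  have h2 : taylorPoly D k (p + Pi.single j 1) x y =
      ∑ q ∈ (multiIdx d k).map ⟨_, hinj⟩, T q := by
    rw [Finset.sum_map]
    unfold taylorPoly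
    refine Finset.sum_congr rfl fun q _ => ?_
    simp only [Function.Embedding.coeFn_mk, hT]
    rw [multiFactorial_add_single]
    have e1 : p + Pi.single j 1 + q = p + (q + Pi.single j 1) := by abel
    rw [e1]
    congr 1
    have hq : ((q j : ℝ) + 1) ≠ 0 := by positivity
    have hf : multiFactorial q ≠ 0 := by linarith [one_le_multiFactorial q] |> ne_of_gt
    have e2 : ∏ i ∈ Finset.univ.erase j, (y i - x i) ^ (q + Pi.single j 1 : Fin d → ℕ) i
        = ∏ i ∈ Finset.univ.erase j, (y i - x i) ^ q i := by
      refine Finset.prod_congr rfl fun i hi => ?_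
      rw [Pi.add_apply, Pi.single_eq_of_ne (Finset.ne_of_mem_erase hi), add_zero]
    have e3 : monom q (y - x) = (y j - x j) ^ q j *
        ∏ i ∈ Finset.univ.erase j, (y i - x i) ^ q i := by
      unfold monom
      rw [← Finset.mul_prod_erase _ _ (Finset.mem_univ j)]
      rfl
    rw [e2, e3]
    simp only [Pi.add_apply, Pi.single_eq_same, Nat.cast_add, Nat.cast_one, add_tsub_cancel_right]
    field_simp
  rw [h2]
  refine Finset.sum_subset ?_ ?_
  · intro q hq
    obtain ⟨q', hq', rfl⟩ := Finset.mem_map.1 hq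
    rw [mem_multiIdx] at hq' ⊢
    simp only [Function.Embedding.coeFn_mk]
    rw [sum_add_single]
    omega
  · intro q hq hq'
    have : q j = 0 := by
      by_contra h0
      apply hq'
      have hle : Pi.single j 1 ≤ q := by
        intro i
        by_cases hi : i = j
        · subst hi; simp; omega
        · simp [Pi.single_eq_of_ne hi]
      have hqq : q - Pi.single j 1 + Pi.single j 1 = q := tsub_add_cancel_of_le hle
      refine Finset.mem_map.2 ⟨q - Pi.single j 1, ?_, hqq⟩
      rw [mem_multiIdx] at hq ⊢
      rw [← hqq, sum_add_single] at hq
      omega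
    simp [hT, this]

theorem taylorPoly_self {d : ℕ} (D : (Fin d → ℕ) → (Fin d → ℝ) → ℝ) (k : ℕ) (p : Fin d → ℕ)
    (x : Fin d → ℝ) : taylorPoly D k p x x = D p x := by
  unfold taylorPoly
  rw [Finset.sum_eq_single (0 : Fin d → ℕ)]
  · simp [monom, multiFactorial]
  · intro q _ hq
    obtain ⟨j, hj⟩ := Function.ne_iff.1 hq
    have : monom q (x - x) = 0 := Finset.prod_eq_zero (Finset.mem_univ j) (by
      simpa using hj)
    rw [this, zero_div, mul_zero]
  · intro h
    exact absurd (mem_multiIdx.2 (by simp)) h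

theorem taylorPoly_zero {d : ℕ} (D : (Fin d → ℕ) → (Fin d → ℝ) → ℝ) (p : Fin d → ℕ)
    (x y : Fin d → ℝ) : taylorPoly D 0 p x y = D p x := by
  unfold taylorPoly
  have : multiIdx d 0 = {0} := by
    ext q
    rw [mem_multiIdx, Finset.mem_singleton]
    simp [funext_iff]
  rw [this]
  simp [monom, multiFactorial]

/-- A coordinatewise mean value inequality: a bound for the partial derivatives on the box
spanned by `x` and `y` bounds the increment. -/
theorem abs_sub_le_of_partial_bound {d : ℕ} {R : (Fin d → ℝ) → ℝ}
    {R' : Fin d → (Fin d → ℝ) → ℝ} {x y : Fin d → ℝ} (hx : x ∈ cube d) (hy : y ∈ cube d)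
    (hR : ∀ j, ∀ z ∈ cube d, HasDerivWithinAt (fun s => R (Function.update z j s)) (R' j z)
      (Set.Icc 0 1) (z j)) {B : ℝ}
    (hB : ∀ j, ∀ z ∈ cube d, (∀ i, |z i - x i| ≤ |y i - x i|) → |R' j z| ≤ B) :
    |R y - R x| ≤ B * ∑ j, |y j - x j| := by
  -- The coordinates of `x` are replaced by those of `y` one at a time. All intermediate points stay
  -- in the cube and, coordinatewise, no farther from `x` than `y` is.
  have key : ∀ S : Finset (Fin d), |R (S.piecewise y x) - R x| ≤ B * ∑ j ∈ S, |y j - x j| := by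
    intro S
    induction S using Finset.induction_on with
    | empty => simp
    | insert j S hj ih =>
      set z := S.piecewise y x with hz
      have hzc : z ∈ cube d := by
        constructor <;> intro i <;> by_cases hi : i ∈ S <;>
          simp only [hz, hi, Finset.piecewise_eq_of_mem, Finset.piecewise_eq_of_notMem,
            not_false_eq_true]
        exacts [hy.1 i, hx.1 i, hy.2 i, hx.2 i]
      have hzj : z j = x j := by simp [hz, hj]
      have hup : ∀ s ∈ Set.uIcc (x j) (y j), Function.update z j s ∈ cube d ∧
          (∀ i, |Function.update z j s i - x i| ≤ |y i - x i|) := by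
        intro s hs
        have hs01 : s ∈ Set.Icc (0 : ℝ) 1 :=
          Set.uIcc_subset_Icc ⟨hx.1 j, hx.2 j⟩ ⟨hy.1 j, hy.2 j⟩ hs
        refine ⟨⟨fun i => ?_, fun i => ?_⟩, fun i => ?_⟩
        · by_cases hi : i = j
          · subst hi; simpa using hs01.1
          · simpa [hi] using hzc.1 i
        · by_cases hi : i = j
          · subst hi; simpa using hs01.2
          · simpa [hi] using hzc.2 i
        · by_cases hi : i = j
          · subst hi
            rw [Function.update_self]
            exact Set.abs_sub_left_of_mem_uIcc hs
          · by_cases hS : i ∈ S <;> simp [hi, hz, hS]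
      have h1 := Convex.norm_image_sub_le_of_norm_hasDerivWithin_le
        (f := fun s => R (Function.update z j s)) (f' := fun s => R' j (Function.update z j s))
        (s := Set.uIcc (x j) (y j)) (x := x j) (y := y j) (C := B)
        (fun s hs => by
          have := hR j (Function.update z j s) (hup s hs).1
          simp only [Function.update_idem, Function.update_self] at this
          exact this.mono (Set.uIcc_subset_Icc ⟨hx.1 j, hx.2 j⟩ ⟨hy.1 j, hy.2 j⟩))
        (fun s hs => hB j _ (hup s hs).1 (hup s hs).2) (convex_uIcc _ _)
        Set.left_mem_uIcc Set.right_mem_uIcc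
      rw [Finset.piecewise_insert, Finset.sum_insert hj]
      have h2 : Function.update z j (x j) = z := by rw [← hzj, Function.update_eq_self]
      simp only [Real.norm_eq_abs, h2] at h1
      calc |R (Function.update z j (y j)) - R x|
          ≤ |R (Function.update z j (y j)) - R z| + |R z - R x| := abs_sub_le _ _ _
        _ ≤ B * |y j - x j| + B * ∑ j ∈ S, |y j - x j| := add_le_add h1 ih
        _ = _ := by ring
  simpa using key Finset.univ

/-- The Taylor remainder of a function in a Hölder class. -/
theorem abs_sub_taylorPoly_le {d m : ℕ} {β L : ℝ} (hL : 0 ≤ L) (hm : (m : ℝ) < β)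
    {D : (Fin d → ℕ) → (Fin d → ℝ) → ℝ}
    (hD : ∀ p : Fin d → ℕ, ∑ j, p j < m → ∀ j : Fin d, ∀ x ∈ cube d,
      HasDerivWithinAt (fun s : ℝ => D p (Function.update x j s)) (D (p + Pi.single j 1) x)
        (Set.Icc 0 1) (x j))
    (hH : ∀ p : Fin d → ℕ, ∑ j, p j = m → ∀ x ∈ cube d, ∀ y ∈ cube d,
      |D p x - D p y| ≤ L * (∑ j, |x j - y j|) ^ (β - (m : ℝ)))
    {x : Fin d → ℝ} (hx : x ∈ cube d) :
    ∀ (k : ℕ) (p : Fin d → ℕ), ∑ j, p j + k = m → ∀ y ∈ cube d,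
      |D p y - taylorPoly D k p x y| ≤ L * (∑ j, |y j - x j|) ^ (β - (m : ℝ) + k) := by
  intro k
  induction k with
  | zero =>
    intro p hp y hy
    rw [taylorPoly_zero]
    simpa using hH p (by simpa using hp) y hy x hx
  | succ k ih =>
    intro p hp y hy
    set Δ := ∑ j, |y j - x j| with hΔ
    have hΔ0 : 0 ≤ Δ := Finset.sum_nonneg fun _ _ => abs_nonneg _
    -- The partial derivatives of a remainder of order `k + 1` are remainders of order `k` based at
    -- `p + e_j`. The induction hypothesis bounds them on the box between `x` and `y`, and the mean
    -- value inequality contributes one more factor `Δ`.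
    have h1 := abs_sub_le_of_partial_bound (R := fun y => D p y - taylorPoly D (k + 1) p x y)
      (R' := fun j z => D (p + Pi.single j 1) z - taylorPoly D k (p + Pi.single j 1) x z)
      hx hy (fun j z hz => (hD p (by omega) j z hz).sub
        (hasDerivAt_taylorPoly_update D k p x z j).hasDerivWithinAt)
      (B := L * Δ ^ (β - (m : ℝ) + k)) (fun j z hz hzy => by
        refine (ih _ (by rw [sum_add_single]; omega) z hz).trans ?_
        refine mul_le_mul_of_nonneg_left (Real.rpow_le_rpow
          (Finset.sum_nonneg fun _ _ => abs_nonneg _)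
          (Finset.sum_le_sum fun i _ => hzy i) ?_) hL
        have : (0 : ℝ) ≤ k := Nat.cast_nonneg k
        linarith)
    simp only [taylorPoly_self, sub_self, sub_zero] at h1
    refine h1.trans (le_of_eq ?_)
    have hk : (0 : ℝ) ≤ k := Nat.cast_nonneg k
    rw [mul_assoc, ← hΔ, ← Real.rpow_add_one' hΔ0 (by linarith)]
    push_cast
    ring_nf

theorem strictFloor_lt {β : ℝ} (hβ : 0 < β) : (strictFloor β : ℝ) < β := by
  unfold strictFloor
  have h1 : 0 < ⌈β⌉₊ := Nat.ceil_pos.2 hβ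
  have h2 := Nat.ceil_lt_add_one hβ.le
  rw [Nat.cast_sub (by omega)]
  push_cast
  linarith

/-- The expansion at `x₀` of a function in the Hölder class. -/
theorem holderClass_expansion {d b : ℕ} {β L M : ℝ} (hβ : 0 < β) (hβb : β ≤ b) (hL : 0 ≤ L)
    (hM : 0 ≤ M) {f : (Fin d → ℝ) → ℝ} (hf : f ∈ holderClass d β L M) {x₀ : Fin d → ℝ}
    (hx₀ : x₀ ∈ cube d) :
    ContinuousOn f (cube d) ∧ |f x₀| ≤ M ∧ ∀ h ∈ Set.Ioc (0 : ℝ) 1,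
      ∃ t ∈ paramSet d b M, t (zeroIdx d b) = f x₀ ∧ ∀ x ∈ cube d,
        |f x - ∑ p : multiIdx d b, t p * monom p.1 (fun j => (x j - x₀ j) / h)|
          ≤ L * (∑ j, |x j - x₀ j|) ^ β := by
  obtain ⟨D, hD0, hD, hH, hS⟩ := hf
  set m := strictFloor β with hm
  have hmβ : (m : ℝ) < β := strictFloor_lt hβ
  have hmb : m ≤ b := by
    have : (m : ℝ) < b := hmβ.trans_le hβb
    exact_mod_cast this.le
  have htay : ∀ x ∈ cube d, ∀ y ∈ cube d,
      |f y - taylorPoly D m 0 x y| ≤ L * (∑ j, |y j - x j|) ^ β := by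
    intro x hx y hy
    have := abs_sub_taylorPoly_le hL hmβ hD hH hx m 0 (by simp) y hy
    rwa [hD0 y hy, sub_add_cancel] at this
  have hsum : ∑ p ∈ multiIdx d m, |D p x₀| ≤ M := by
    have h1 : ∑ p ∈ multiIdx d m, ENNReal.ofReal |D p x₀| ≤ ENNReal.ofReal M := by
      refine le_trans (Finset.sum_le_sum fun p _ => ?_) hS
      exact le_iSup₂ (f := fun x (_ : x ∈ cube d) => ENNReal.ofReal |D p x|) x₀ hx₀
    rw [← ENNReal.ofReal_sum_of_nonneg (fun _ _ => abs_nonneg _)] at h1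
    exact (ENNReal.ofReal_le_ofReal_iff hM).1 h1
  refine ⟨?_, ?_, ?_⟩
  -- Continuity comes from the Taylor bound itself: `f` differs near `x` from a polynomial by `O(|y
  -- - x|^β)` with `β > 0`.
  · intro x hx
    have hT : Continuous (taylorPoly D m 0 x) := by
      unfold taylorPoly monom
      fun_prop
    have hT' : Tendsto (taylorPoly D m 0 x) (nhdsWithin x (cube d)) (nhds (f x)) := by
      have := (hT.tendsto x).mono_left (nhdsWithin_le_nhds (s := cube d))
      rwa [taylorPoly_self, hD0 x hx] at this
    have hz : Tendsto (fun y => f y - taylorPoly D m 0 x y) (nhdsWithin x (cube d)) (nhds 0) := by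
      have hc : Continuous fun y : Fin d → ℝ => L * (∑ j, |y j - x j|) ^ β :=
        continuous_const.mul (Continuous.rpow_const (by fun_prop) fun _ => Or.inr hβ.le)
      have h0 : Tendsto (fun y : Fin d → ℝ => L * (∑ j, |y j - x j|) ^ β)
          (nhdsWithin x (cube d)) (nhds 0) := by
        have := (hc.tendsto x).mono_left (nhdsWithin_le_nhds (s := cube d))
        simpa [Real.zero_rpow hβ.ne'] using this
      refine squeeze_zero_norm' ?_ h0
      filter_upwards [self_mem_nhdsWithin] with y hy
      exact htay x hx y hy
    have := hz.add hT'
    simp only [sub_add_cancel, zero_add] at this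
    exact this
  · rw [← hD0 x₀ hx₀]
    exact (Finset.single_le_sum (f := fun p => |D p x₀|) (fun _ _ => abs_nonneg _)
      (mem_multiIdx.2 (by simp) : (0 : Fin d → ℕ) ∈ multiIdx d m)).trans hsum
  · rintro h ⟨h0, h1⟩
    -- The factor `h^|p|` undoes the division by `h` in the argument of the monomial. Since `h ≤ 1 ≤
    -- p!`, it does not increase the `ℓ¹` norm, so `t'` stays in `Θ(M)`. Degrees between `m + 1` and
    -- `b` get coefficient zero.
    set t' : (Fin d → ℕ) → ℝ := fun p => if p ∈ multiIdx d m then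
      D p x₀ * h ^ (∑ j, p j) / multiFactorial p else 0 with ht'
    have hsub : multiIdx d m ⊆ multiIdx d b := fun p hp =>
      mem_multiIdx.2 ((mem_multiIdx.1 hp).trans hmb)
    refine ⟨fun p => t' p.1, ?_, ?_, ?_⟩
    · show ∑ p : multiIdx d b, |t' p.1| ≤ M
      rw [Finset.sum_coe_sort (multiIdx d b) (fun p => |t' p|),
        ← Finset.sum_subset hsub (fun p _ hp => by simp [ht', hp])]
      refine (Finset.sum_le_sum fun p hp => ?_).trans hsum
      simp only [ht', if_pos hp]
      rw [abs_div, abs_mul, abs_of_nonneg (pow_nonneg h0.le _),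
        abs_of_nonneg (zero_le_one.trans (one_le_multiFactorial p))]
      refine (div_le_self (by positivity) (one_le_multiFactorial p)).trans ?_
      exact mul_le_of_le_one_right (abs_nonneg _) (pow_le_one₀ h0.le h1)
    · have : (0 : Fin d → ℕ) ∈ multiIdx d m := mem_multiIdx.2 (by simp)
      simp only [zeroIdx, ht', if_pos this]
      simp [multiFactorial, hD0 x₀ hx₀]
    · intro x hx
      have e : ∑ p : multiIdx d b, t' p.1 * monom p.1 (fun j => (x j - x₀ j) / h)
          = taylorPoly D m 0 x₀ x := by
        rw [Finset.sum_coe_sort (multiIdx d b)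
          (fun p => t' p * monom p (fun j => (x j - x₀ j) / h)),
          ← Finset.sum_subset hsub (fun p _ hp => by simp [ht', hp])]
        unfold taylorPoly
        refine Finset.sum_congr rfl fun p hp => ?_
        simp only [ht', if_pos hp, zero_add]
        have e1 : monom p (fun j => (x j - x₀ j) / h) = monom p (x - x₀) / h ^ (∑ j, p j) := by
          unfold monom
          simp only [div_pow, Finset.prod_div_distrib, Finset.prod_pow_eq_pow_sum, Pi.sub_apply]
        rw [e1]
        have := one_le_multiFactorial p
        field_simp
      rw [e]
      exact htay x₀ hx₀ x hx

/-! ### The kernel matrix -/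

/-- The zero set of a nonzero real polynomial is a null set. -/
theorem volume_zeros_mvPolynomial : ∀ {d : ℕ} {P : MvPolynomial (Fin d) ℝ}, P ≠ 0 →
    volume {x : Fin d → ℝ | MvPolynomial.eval x P = 0} = 0
  | 0, P, hP => by
    have : {x : Fin 0 → ℝ | MvPolynomial.eval x P = 0} = ∅ := by
      ext x
      simp only [Set.mem_ofPred_eq, Set.mem_empty_iff_false, iff_false]
      intro h
      apply hP
      rw [MvPolynomial.eq_C_of_isEmpty P] at h ⊢
      rw [MvPolynomial.eval_C] at h
      rw [h, map_zero]
    rw [this, measure_empty]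
  | d + 1, P, hP => by
    have hmeas : MeasurableSet {x : Fin (d + 1) → ℝ | MvPolynomial.eval x P = 0} :=
      (measurableSet_singleton 0).preimage (MvPolynomial.continuous_eval P).measurable
    have hmp := (volume_preserving_piFinSuccAbove (fun _ : Fin (d + 1) => ℝ) 0).symm
    rw [← hmp.measure_preimage hmeas.nullMeasurableSet]
    have hmeas' := hmp.measurable hmeas
    set Q := MvPolynomial.finSuccEquiv ℝ d P with hQ
    have hQ0 : Q ≠ 0 := by
      rw [hQ]
      exact (map_ne_zero_iff _ (MvPolynomial.finSuccEquiv ℝ d).injective).2 hP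
    -- Fubini in the first variable: off the zero set of this coefficient, which is null by
    -- recursion, the slice is a nonzero univariate polynomial and has finitely many roots.
    obtain ⟨i, hi⟩ : ∃ i, Q.coeff i ≠ 0 := by
      by_contra! h
      exact hQ0 (Polynomial.ext fun i => by simp [h i])
    have hae := volume_zeros_mvPolynomial hi
    rw [Measure.volume_eq_prod, ← Measure.prod_swap, Measure.map_apply measurable_swap hmeas',
      Measure.measure_prod_null (measurable_swap hmeas')]
    have hae' : ∀ᵐ s : Fin d → ℝ, MvPolynomial.eval s (Q.coeff i) ≠ 0 := by
      rw [ae_iff]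
      simpa using hae
    filter_upwards [hae'] with s hs
    have hne : Polynomial.map (MvPolynomial.eval s) Q ≠ 0 := by
      intro h
      apply hs
      have := congrArg (fun q => Polynomial.coeff q i) h
      simpa using this
    refine Set.Finite.measure_zero (Set.Finite.subset
      (Polynomial.map (MvPolynomial.eval s) Q).roots.toFinset.finite_toSet ?_) _
    intro y hy
    have hy' : MvPolynomial.eval (Fin.cons y s : Fin (d + 1) → ℝ) P = 0 := by
      have h1 : MvPolynomial.eval ((MeasurableEquiv.piFinSuccAbove (fun _ : Fin (d + 1) => ℝ)
        0).symm (y, s)) P = 0 := hy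
      have h2 : (MeasurableEquiv.piFinSuccAbove (fun _ : Fin (d + 1) => ℝ) 0).symm (y, s)
          = (Fin.cons y s : Fin (d + 1) → ℝ) := by
        simp [MeasurableEquiv.piFinSuccAbove, Fin.insertNthEquiv]
      rwa [h2] at h1
    rw [MvPolynomial.eval_eq_eval_mv_eval', ← hQ] at hy'
    simpa [hne] using hy'

/-- The polynomial with coefficients `w`. -/
noncomputable def polyVal {d b : ℕ} (w : multiIdx d b → ℝ) (z : Fin d → ℝ) : ℝ :=
  ∑ p : multiIdx d b, w p * monom p.1 z

theorem continuous_monom {d : ℕ} (p : Fin d → ℕ) : Continuous (monom p) := by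
  unfold monom
  fun_prop

theorem continuous_polyVal {d b : ℕ} (w : multiIdx d b → ℝ) : Continuous (polyVal w) := by
  unfold polyVal
  exact continuous_finsetSum _ fun p _ => continuous_const.mul (continuous_monom _)

theorem abs_monom_le_one {d : ℕ} (p : Fin d → ℕ) {z : Fin d → ℝ} (hz : z ∈ kernelBox d) :
    |monom p z| ≤ 1 := by
  unfold monom
  rw [Finset.abs_prod]
  refine Finset.prod_le_one (fun _ _ => abs_nonneg _) fun j _ => ?_
  rw [abs_pow]
  refine pow_le_one₀ (abs_nonneg _) (abs_le.2 ⟨?_, ?_⟩)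
  · linarith [hz.1 j]
  · linarith [hz.2 j]

theorem abs_polyVal_le {d b : ℕ} (w : multiIdx d b → ℝ) {z : Fin d → ℝ} (hz : z ∈ kernelBox d) :
    |polyVal w z| ≤ ∑ p, |w p| := by
  refine (Finset.abs_sum_le_sum_abs _ _).trans (Finset.sum_le_sum fun p _ => ?_)
  rw [abs_mul]
  exact mul_le_of_le_one_right (abs_nonneg _) (abs_monom_le_one _ hz)

/-- Distinct multi-indices give distinct monomials, so `w` can be read off as coefficients of the
polynomial and a nonzero `w` gives a nonzero polynomial. -/
theorem polyVal_ne_zero_ae {d b : ℕ} {w : multiIdx d b → ℝ} (hw : w ≠ 0) :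
    ∀ᵐ z : Fin d → ℝ, polyVal w z ≠ 0 := by
  set P : MvPolynomial (Fin d) ℝ := ∑ p : multiIdx d b,
    MvPolynomial.monomial (Finsupp.equivFunOnFinite.symm p.1) (w p) with hP
  have heval : ∀ z, MvPolynomial.eval z P = polyVal w z := by
    intro z
    rw [hP, map_sum]
    refine Finset.sum_congr rfl fun p _ => ?_
    rw [MvPolynomial.eval_monomial, monom, Finsupp.prod_fintype _ _ (by simp)]
    rfl
  have hP0 : P ≠ 0 := by
    obtain ⟨p, hp⟩ := Function.ne_iff.1 hw
    intro h
    apply hp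
    have := congrArg (MvPolynomial.coeff (Finsupp.equivFunOnFinite.symm p.1)) h
    rw [hP, MvPolynomial.coeff_sum, Finset.sum_eq_single p] at this
    · simpa using this
    · intro q _ hq
      rw [MvPolynomial.coeff_monomial, if_neg]
      intro h
      exact hq (Subtype.ext (Finsupp.equivFunOnFinite.symm.injective h))
    · simp
  rw [ae_iff]
  simpa [← heval] using volume_zeros_mvPolynomial hP0

section Kernel

variable {d : ℕ} {K : (Fin d → ℝ) → ℝ}

theorem IsKernel.integrable (hK : IsKernel K) : Integrable K :=
  .of_integral_ne_zero (by rw [hK.integral_eq_one]; exact one_ne_zero)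

theorem IsKernel.le_supNorm (hK : IsKernel K) (z : Fin d → ℝ) : K z ≤ supNorm K :=
  (le_abs_self _).trans (le_ciSup hK.bounded z)

theorem IsKernel.integrable_mul (hK : IsKernel K) {F : (Fin d → ℝ) → ℝ} (hF : Measurable F)
    {A : ℝ} (hA : ∀ z, K z ≠ 0 → |F z| ≤ A) : Integrable fun z => F z * K z := by
  refine (hK.integrable.const_mul A).mono' (hF.mul hK.measurable).aestronglyMeasurable
    (Eventually.of_forall fun z => ?_)
  by_cases h : K z = 0
  · simp [h]
  · rw [Real.norm_eq_abs, abs_mul, abs_of_nonneg (hK.nonneg z)]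
    exact mul_le_mul_of_nonneg_right (hA z h) (hK.nonneg z)

theorem IsKernel.supNorm_nonneg (hK : IsKernel K) : 0 ≤ supNorm K :=
  (hK.nonneg 0).trans (hK.le_supNorm 0)

/-- A box of volume one carries the whole mass of `K`. -/
theorem IsKernel.one_le_supNorm (hK : IsKernel K) : 1 ≤ supNorm K := by
  have h1 : ∫ z in kernelBox d, K z = 1 := by
    rw [setIntegral_eq_integral_of_forall_compl_eq_zero, hK.integral_eq_one]
    intro z hz
    by_contra h
    exact hz (hK.support z h)
  have hvol : volume (kernelBox d) = 1 := by
    unfold kernelBox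
    rw [Real.volume_Icc_pi]
    norm_num
  have h2 := setIntegral_mono (μ := volume) (s := kernelBox d) hK.integrable.integrableOn
    (integrableOn_const (C := supNorm K) (by simp [hvol])) hK.le_supNorm
  rw [h1, setIntegral_const] at h2
  simpa [Measure.real, hvol] using h2

theorem dotProduct_kernelMatrix_mulVec (hK : IsKernel K) (b : ℕ) (w : multiIdx d b → ℝ) :
    w ⬝ᵥ (kernelMatrix b K).mulVec w = ∫ z, polyVal w z ^ 2 * K z := by
  have hInt : ∀ p q : multiIdx d b, Integrable fun z => monom p.1 z * monom q.1 z * K z :=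
    fun p q => hK.integrable_mul
      ((continuous_monom _).mul (continuous_monom _)).measurable (A := 1) fun z hz => by
        rw [abs_mul]
        exact mul_le_one₀ (abs_monom_le_one _ (hK.support z hz)) (abs_nonneg _)
          (abs_monom_le_one _ (hK.support z hz))
  have h1 : ∀ p q : multiIdx d b, kernelMatrix b K p q = ∫ z, monom p.1 z * monom q.1 z * K z := by
    intro p q
    refine setIntegral_eq_integral_of_forall_compl_eq_zero fun z hz => ?_
    have : K z = 0 := by
      by_contra h
      exact hz (hK.support z h)
    simp [this]
  have h2 : ∀ z, polyVal w z ^ 2 * K z =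
      ∑ p : multiIdx d b, ∑ q : multiIdx d b, w p * w q * (monom p.1 z * monom q.1 z * K z) := by
    intro z
    rw [sq, polyVal, Finset.sum_mul_sum, Finset.sum_mul]
    refine Finset.sum_congr rfl fun p _ => ?_
    rw [Finset.sum_mul]
    exact Finset.sum_congr rfl fun q _ => by ring
  simp_rw [h2]
  rw [integral_finsetSum _ fun p _ => integrable_finsetSum _ fun q _ => (hInt p q).const_mul _]
  simp only [dotProduct, Matrix.mulVec]
  refine Finset.sum_congr rfl fun p _ => ?_
  rw [integral_finsetSum _ fun q _ => (hInt p q).const_mul _, Finset.mul_sum]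
  refine Finset.sum_congr rfl fun q _ => ?_
  rw [integral_const_mul, h1]
  ring

theorem kernelMatrix_isHermitian (b : ℕ) (K : (Fin d → ℝ) → ℝ) :
    (kernelMatrix b K).IsHermitian := by
  ext p q
  simp only [kernelMatrix, Matrix.conjTranspose_apply, Matrix.of_apply, star_trivial]
  refine integral_congr_ae (Eventually.of_forall fun z => ?_)
  simp only
  ring

/-- A vanishing quadratic form means that a squared nonzero polynomial times `K` is zero almost
everywhere. The polynomial is almost everywhere nonzero, so `K` would vanish almost everywhere,
against `∫ K = 1`. -/
theorem kernelMatrix_posDef (hK : IsKernel K) (b : ℕ) : (kernelMatrix b K).PosDef := by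
  rw [Matrix.posDef_iff_dotProduct_mulVec]
  refine ⟨kernelMatrix_isHermitian b K, fun w hw => ?_⟩
  rw [star_trivial, dotProduct_kernelMatrix_mulVec hK]
  have hInt : Integrable fun z => polyVal w z ^ 2 * K z :=
    hK.integrable_mul ((continuous_polyVal w).pow 2).measurable (A := (∑ p, |w p|) ^ 2)
      fun z hz => by
        rw [abs_pow]
        exact pow_le_pow_left₀ (abs_nonneg _) (abs_polyVal_le w (hK.support z hz)) 2
  have hnn : ∀ z, 0 ≤ polyVal w z ^ 2 * K z := fun z => mul_nonneg (sq_nonneg _) (hK.nonneg z)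
  refine lt_of_le_of_ne (integral_nonneg hnn) fun h0 => ?_
  have hz := (integral_eq_zero_iff_of_nonneg hnn hInt).1 h0.symm
  have hK0 : K =ᵐ[volume] 0 := by
    filter_upwards [hz, polyVal_ne_zero_ae hw] with z h1 h2
    simpa [h2] using h1
  have := hK.integral_eq_one
  rw [integral_congr_ae hK0] at this
  simp at this

theorem minEigenvalue_pos (hK : IsKernel K) (b : ℕ) : 0 < minEigenvalue b K := by
  have hpos := kernelMatrix_posDef hK b
  have : Nonempty (multiIdx d b) := ⟨zeroIdx d b⟩
  unfold minEigenvalue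
  rw [hpos.isHermitian.spectrum_real_eq_range_eigenvalues]
  obtain ⟨i, hi⟩ := (Set.range_nonempty hpos.isHermitian.eigenvalues).csInf_mem
    (Set.finite_range _)
  rw [← hi]
  exact hpos.eigenvalues_pos i

/-- Subtracting `λ` times the identity shifts the spectrum into the nonnegative half-line, so the
difference is positive semidefinite. -/
theorem minEigenvalue_mul_le (hK : IsKernel K) (b : ℕ) (w : multiIdx d b → ℝ) :
    minEigenvalue b K * ∑ p, w p ^ 2 ≤ ∫ z, polyVal w z ^ 2 * K z := by
  set A := kernelMatrix b K with hA
  have hH : A.IsHermitian := kernelMatrix_isHermitian b K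
  have hps : (A - algebraMap ℝ (Matrix (multiIdx d b) (multiIdx d b) ℝ)
      (minEigenvalue b K)).PosSemidef := by
    rw [Matrix.posSemidef_iff_isHermitian_and_spectrum_nonneg]
    refine ⟨hH.sub ?_, ?_⟩
    · rw [Matrix.algebraMap_eq_diagonal]
      exact Matrix.isHermitian_diagonal _
    · rw [← spectrum.sub_singleton_eq]
      rintro _ ⟨x, hx, y, rfl, rfl⟩
      simp only [Set.mem_ofPred_eq, sub_nonneg]
      refine csInf_le ?_ hx
      rw [hH.spectrum_real_eq_range_eigenvalues]
      exact (Set.finite_range _).bddBelow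
  have h1 := hps.dotProduct_mulVec_nonneg w
  rw [Matrix.sub_mulVec, dotProduct_sub, star_trivial, dotProduct_kernelMatrix_mulVec hK,
    Algebra.algebraMap_eq_smul_one, Matrix.smul_mulVec, Matrix.one_mulVec, dotProduct_smul] at h1
  have h2 : w ⬝ᵥ w = ∑ p, w p ^ 2 := by simp [dotProduct, sq]
  rw [h2, smul_eq_mul] at h1
  linarith

end Kernel

/-- The value 2 matters in the tail of the score: the exponent there carries a factor `N_b`, and
`N_b ≥ 2` yields the squared weight `(2^{-rdl})²`. -/
theorem two_le_card_multiIdx {d b : ℕ} (hd : 0 < d) (hb : 0 < b) : 2 ≤ (multiIdx d b).card := by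
  have h : ({0, Pi.single ⟨0, hd⟩ 1} : Finset (Fin d → ℕ)) ⊆ multiIdx d b := by
    intro p hp
    simp only [Finset.mem_insert, Finset.mem_singleton] at hp
    rw [mem_multiIdx]
    rcases hp with rfl | rfl
    · simp
    · simp only [Finset.sum_pi_single', Finset.mem_univ, if_true]
      exact hb
  refine le_trans ?_ (Finset.card_le_card h)
  rw [Finset.card_pair]
  intro h
  simpa using congrFun h ⟨0, hd⟩

/-! ### An exponential inequality for sums of independent bounded variables -/

/-- Independence factorises the exponential moment. Each factor is handled by `e^y ≤ 1 + y + y²` for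
`|y| ≤ 1`, which `s B ≤ 1` makes available, and then by `1 + y ≤ e^y`. -/
theorem lintegral_exp_mul_sum_le {n : ℕ} {E : Type*} [MeasurableSpace E] {μ : Fin n → Measure E}
    [∀ i, IsProbabilityMeasure (μ i)] {Y : Fin n → E → ℝ} (hY : ∀ i, Measurable (Y i))
    {B m v s : ℝ} (hB : ∀ i e, |Y i e| ≤ B) (hm : ∀ i, ∫ e, Y i e ∂(μ i) ≤ m)
    (hv : ∀ i, ∫ e, Y i e ^ 2 ∂(μ i) ≤ v) (hs : 0 ≤ s) (hsB : s * B ≤ 1) :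
    ∫⁻ ω, ENNReal.ofReal (Real.exp (s * ∑ i, Y i (ω i))) ∂(Measure.pi μ)
      ≤ ENNReal.ofReal (Real.exp (n * (s * m + s ^ 2 * v))) := by
  have hprod : ∀ ω : Fin n → E, Real.exp (s * ∑ i, Y i (ω i)) = ∏ i, Real.exp (s * Y i (ω i)) := by
    intro ω
    rw [Finset.mul_sum, Real.exp_sum]
  have hsY : ∀ i e, |s * Y i e| ≤ 1 := fun i e => by
    rw [abs_mul, abs_of_nonneg hs]
    exact (mul_le_mul_of_nonneg_left (hB i e) hs).trans hsB
  have hmeas : Measurable fun ω : Fin n → E => Real.exp (s * ∑ i, Y i (ω i)) :=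
    Real.measurable_exp.comp (measurable_const.mul
      (Finset.measurable_fun_sum _ fun i _ => (hY i).comp (measurable_pi_apply i)))
  have hInt : Integrable (fun ω : Fin n → E => Real.exp (s * ∑ i, Y i (ω i))) (Measure.pi μ) := by
    refine Integrable.of_bound hmeas.aestronglyMeasurable (Real.exp n)
      (Eventually.of_forall fun ω => ?_)
    rw [Real.norm_eq_abs, Real.abs_exp, Real.exp_le_exp, Finset.mul_sum]
    calc ∑ i, s * Y i (ω i) ≤ ∑ _i : Fin n, (1 : ℝ) :=
          Finset.sum_le_sum fun i _ => (le_abs_self _).trans (hsY i _)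
      _ = n := by simp
  rw [← ofReal_integral_eq_lintegral_ofReal hInt
    (Eventually.of_forall fun _ => (Real.exp_pos _).le)]
  refine ENNReal.ofReal_le_ofReal ?_
  simp_rw [hprod]
  rw [integral_fintype_prod_eq_prod (fun i e => Real.exp (s * Y i e))]
  have hone : ∀ i, ∫ e, Real.exp (s * Y i e) ∂(μ i) ≤ Real.exp (s * m + s ^ 2 * v) := by
    intro i
    have hYi : Integrable (Y i) (μ i) := Integrable.of_bound (hY i).aestronglyMeasurable B
      (Eventually.of_forall fun e => hB i e)
    have hYi2 : Integrable (fun e => Y i e ^ 2) (μ i) :=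
      Integrable.of_bound ((hY i).pow_const 2).aestronglyMeasurable (B ^ 2)
        (Eventually.of_forall fun e => by
          rw [Real.norm_eq_abs, abs_pow]
          exact pow_le_pow_left₀ (abs_nonneg _) (hB i e) 2)
    calc ∫ e, Real.exp (s * Y i e) ∂(μ i)
        ≤ ∫ e, (1 + s * Y i e + s ^ 2 * Y i e ^ 2) ∂(μ i) := by
          refine integral_mono_of_nonneg (Eventually.of_forall fun _ => (Real.exp_pos _).le)
            (((integrable_const 1).add (hYi.const_mul s)).add (hYi2.const_mul (s ^ 2)))
            (Eventually.of_forall fun e => ?_)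
          have h := (abs_le.1 (Real.abs_exp_sub_one_sub_id_le (hsY i e))).2
          simp only
          rw [mul_pow] at h
          linarith
      _ = 1 + s * ∫ e, Y i e ∂(μ i) + s ^ 2 * ∫ e, Y i e ^ 2 ∂(μ i) := by
          rw [integral_add (f := fun e => 1 + s * Y i e)
            ((integrable_const 1).add (hYi.const_mul s)) (hYi2.const_mul (s ^ 2)), integral_add (integrable_const 1) (hYi.const_mul s), integral_const_mul,
            integral_const_mul]
          simp
      _ ≤ 1 + s * m + s ^ 2 * v := by
          have := mul_le_mul_of_nonneg_left (hm i) hs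
          have := mul_le_mul_of_nonneg_left (hv i) (sq_nonneg s)
          linarith
      _ ≤ _ := by
          have := Real.add_one_le_exp (s * m + s ^ 2 * v)
          linarith
  calc ∏ i, ∫ e, Real.exp (s * Y i e) ∂(μ i)
      ≤ ∏ _i : Fin n, Real.exp (s * m + s ^ 2 * v) :=
        Finset.prod_le_prod (fun i _ => integral_nonneg fun _ => (Real.exp_pos _).le)
          fun i _ => hone i
    _ = _ := by simp [← Real.exp_nat_mul]

theorem measure_le_sum_le {n : ℕ} {E : Type*} [MeasurableSpace E] {μ : Fin n → Measure E}
    [∀ i, IsProbabilityMeasure (μ i)] {Y : Fin n → E → ℝ} (hY : ∀ i, Measurable (Y i))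
    {B m v s : ℝ} (hB : ∀ i e, |Y i e| ≤ B) (hm : ∀ i, ∫ e, Y i e ∂(μ i) ≤ m)
    (hv : ∀ i, ∫ e, Y i e ^ 2 ∂(μ i) ≤ v) (hs : 0 ≤ s) (hsB : s * B ≤ 1) (x : ℝ) :
    Measure.pi μ {ω | x ≤ ∑ i, Y i (ω i)}
      ≤ ENNReal.ofReal (Real.exp (n * (s * m + s ^ 2 * v) - s * x)) := by
  have hmeas : Measurable fun ω : Fin n → E => Real.exp (s * ∑ i, Y i (ω i)) :=
    Real.measurable_exp.comp (measurable_const.mul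
      (Finset.measurable_fun_sum _ fun i _ => (hY i).comp (measurable_pi_apply i)))
  have h1 := mul_meas_ge_le_lintegral (μ := Measure.pi μ) hmeas.ennreal_ofReal
    (ENNReal.ofReal (Real.exp (s * x)))
  have h2 : {ω : Fin n → E | x ≤ ∑ i, Y i (ω i)} ⊆ {ω | ENNReal.ofReal (Real.exp (s * x)) ≤
      ENNReal.ofReal (Real.exp (s * ∑ i, Y i (ω i)))} := fun ω hω =>
    ENNReal.ofReal_le_ofReal (Real.exp_le_exp.2 (mul_le_mul_of_nonneg_left hω hs))
  have hpos : 0 < Real.exp (s * x) := Real.exp_pos _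
  rw [Real.exp_sub, ENNReal.ofReal_div_of_pos hpos,
    ENNReal.le_div_iff_mul_le (Or.inl (ENNReal.ofReal_pos.2 hpos).ne')
      (Or.inl ENNReal.ofReal_ne_top), mul_comm]
  exact (mul_le_mul_right (measure_mono h2) _).trans
    (h1.trans (lintegral_exp_mul_sum_le hY hB hm hv hs hsB))

/-! ### The smoothed score -/

section Score

variable {ρ : ℝ → ℝ} {g : ℕ → ℝ → ℝ}

theorem IsNoiseDensity.integrable {g : ℝ → ℝ} (hg : IsNoiseDensity g) : Integrable g :=
  .of_integral_ne_zero (by rw [hg.integral_eq_one]; exact one_ne_zero)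

theorem IsContrast.abs_deriv_le (hρ : IsContrast ρ g) (z : ℝ) : |deriv ρ z| ≤ supNorm (deriv ρ) :=
  le_ciSup hρ.bounded z

theorem IsContrast.abs_deriv_sub_le (hρ : IsContrast ρ g) (y z : ℝ) :
    |deriv ρ y - deriv ρ z| ≤ |y - z| := by
  simpa [Real.dist_eq] using hρ.lipschitz.dist_le_mul y z

theorem IsContrast.deriv_neg (hρ : IsContrast ρ g) (z : ℝ) : deriv ρ (-z) = -deriv ρ z := by
  have h : (fun z => ρ (-z)) = ρ := funext hρ.symm
  have h1 := deriv_comp_neg ρ z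
  rw [h] at h1
  rw [h1, neg_neg]

theorem IsContrast.add_deriv_mul_le (hρ : IsContrast ρ g) (y z : ℝ) :
    ρ y + deriv ρ y * (z - y) ≤ ρ z := by
  rcases lt_trichotomy y z with h | h | h
  · have := hρ.convex.deriv_le_slope (Set.mem_univ y) (Set.mem_univ z) h (hρ.differentiable y)
    rw [slope_def_field, le_div_iff₀ (by linarith)] at this
    linarith
  · subst h; simp
  · have := hρ.convex.slope_le_deriv (Set.mem_univ z) (Set.mem_univ y) h (hρ.differentiable y)
    rw [slope_def_field, div_le_iff₀ (by linarith)] at this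
    linarith

theorem IsContrast.abs_deriv_deriv_le (hρ : IsContrast ρ g) (z : ℝ) : |deriv (deriv ρ) z| ≤ 1 := by
  simpa using norm_deriv_le_of_lipschitz hρ.lipschitz (x₀ := z)

/-- The smoothed score `∫ ρ'(z + u) γ(z) dz`. -/
noncomputable def smoothScore (ρ γ : ℝ → ℝ) (u : ℝ) : ℝ := ∫ z, deriv ρ (z + u) * γ z

theorem IsContrast.integrable_score (hρ : IsContrast ρ g) {γ : ℝ → ℝ} (hγ : IsNoiseDensity γ)
    (u : ℝ) : Integrable fun z => deriv ρ (z + u) * γ z :=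
  hγ.integrable.bdd_mul
    ((measurable_deriv ρ).comp (measurable_id.add_const u)).aestronglyMeasurable
    (Eventually.of_forall fun z => hρ.abs_deriv_le (z + u))

theorem IsContrast.integrable_deriv_score (hρ : IsContrast ρ g) {γ : ℝ → ℝ}
    (hγ : IsNoiseDensity γ) (u : ℝ) : Integrable fun z => deriv (deriv ρ) (z + u) * γ z :=
  hγ.integrable.bdd_mul
    ((measurable_deriv (deriv ρ)).comp (measurable_id.add_const u)).aestronglyMeasurable
    (Eventually.of_forall fun z => hρ.abs_deriv_deriv_le (z + u))

/-- The second derivative of `ρ` exists only almost everywhere, but translations preserve null sets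
and `γ` is an integrable Lipschitz bound for the integrand, because `ρ'` is 1-Lipschitz. -/
theorem IsContrast.hasDerivAt_smoothScore (hρ : IsContrast ρ g) {γ : ℝ → ℝ}
    (hγ : IsNoiseDensity γ) (u : ℝ) :
    HasDerivAt (smoothScore ρ γ) (∫ z, deriv (deriv ρ) (z + u) * γ z) u := by
  refine (hasDerivAt_integral_of_dominated_loc_of_lip (bound := γ) (s := Set.univ)
    (F := fun u z => deriv ρ (z + u) * γ z) univ_mem
    (Eventually.of_forall fun v => (hρ.integrable_score hγ v).aestronglyMeasurable)
    (hρ.integrable_score hγ u) (hρ.integrable_deriv_score hγ u).aestronglyMeasurable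
    (Eventually.of_forall fun z => ?_) hγ.integrable ?_).2
  · refine LipschitzOnWith.of_dist_le_mul fun v _ w _ => ?_
    rw [Real.dist_eq, ← sub_mul, abs_mul, mul_comm, Real.dist_eq]
    have h1 := hρ.abs_deriv_sub_le (z + v) (z + w)
    rw [add_sub_add_left_eq_sub] at h1
    have h2 : ((Real.nnabs (γ z) : NNReal) : ℝ) = |γ z| := rfl
    rw [h2]
    exact mul_le_mul_of_nonneg_left h1 (abs_nonneg _)
  · have h1 : ∀ᵐ z : ℝ, DifferentiableAt ℝ (deriv ρ) (z + u) :=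
      (measurePreserving_add_right volume u).quasiMeasurePreserving.ae hρ.ae_differentiable
    filter_upwards [h1] with z hz
    have h2 : HasDerivAt (fun v => z + v) 1 u := (hasDerivAt_id u).const_add z
    have h3 := (hz.hasDerivAt.comp u h2).mul_const (γ z)
    simpa using h3

theorem IsContrast.smoothScore_zero (hρ : IsContrast ρ g) {γ : ℝ → ℝ} (hγ : IsNoiseDensity γ) :
    smoothScore ρ γ 0 = 0 := by
  have h1 := integral_neg_eq_self (fun z => deriv ρ (z + 0) * γ z) volume
  have h2 : ∫ z, deriv ρ (-z + 0) * γ (-z) = -∫ z, deriv ρ (z + 0) * γ z := by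
    rw [← integral_neg]
    congr 1
    funext z
    rw [add_zero, add_zero, hρ.deriv_neg, hγ.symm]
    ring
  unfold smoothScore
  linarith

/-- The smoothed score inherits the Lipschitz constant of `ρ'` and vanishes at 0 by symmetry.
Through this bound the approximation error enters the mean of the score linearly, with constant 1.
-/
theorem IsContrast.abs_smoothScore_le (hρ : IsContrast ρ g) {γ : ℝ → ℝ} (hγ : IsNoiseDensity γ)
    (u : ℝ) : |smoothScore ρ γ u| ≤ |u| := by
  have h0 := hρ.smoothScore_zero hγ
  have h1 : smoothScore ρ γ u = ∫ z, (deriv ρ (z + u) * γ z - deriv ρ (z + 0) * γ z) := by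
    rw [integral_sub (hρ.integrable_score hγ u) (hρ.integrable_score hγ 0)]
    show _ = smoothScore ρ γ u - smoothScore ρ γ 0
    rw [h0, sub_zero]
  rw [h1]
  calc |∫ z, (deriv ρ (z + u) * γ z - deriv ρ (z + 0) * γ z)| ≤ ∫ z, |u| * γ z := by
        rw [← Real.norm_eq_abs]
        refine norm_integral_le_of_norm_le (hγ.integrable.const_mul |u|)
          (Eventually.of_forall fun z => ?_)
        rw [← sub_mul, Real.norm_eq_abs, abs_mul, abs_of_nonneg (hγ.nonneg z)]
        refine mul_le_mul_of_nonneg_right ?_ (hγ.nonneg z)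
        simpa using hρ.abs_deriv_sub_le (z + u) (z + 0)
    _ = |u| := by rw [integral_const_mul, hγ.integral_eq_one, mul_one]

/-- The smoothed scores are strongly monotone near zero, uniformly in the noise density. -/
theorem smoothScore_strongly_monotone (hρ : IsContrast ρ g) {c : ℝ} (hc : 0 < c)
    (hg : g ∈ noiseClass ρ c) : ∃ η > 0, ∀ i, ∀ u y : ℝ, |u| ≤ η → |y| ≤ η →
      3 / 4 * c * y ^ 2 ≤ (smoothScore ρ (g i) u - smoothScore ρ (g i) (u - y)) * y := by
  obtain ⟨Lρ, hL, α, hα, hH⟩ := hρ.holder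
  -- The radius solves `Lρ η₀^α = c/4`, so the averaged second derivative drops from at least `c` to
  -- no less than `3c/4`.
  set η₀ := (c / (4 * Lρ)) ^ (1 / α) with hη₀
  have hη₀pos : 0 < η₀ := Real.rpow_pos_of_pos (by positivity) _
  have hderiv : ∀ i, ∀ v : ℝ, |v| ≤ η₀ →
      3 / 4 * c ≤ ∫ z, deriv (deriv ρ) (z + v) * g i z := by
    intro i v hv
    have h1 := hH i 0 v
    have h2 : (∫ z, deriv (deriv ρ) (z + 0) * g i z) - ∫ z, deriv (deriv ρ) (z + v) * g i z
        ≤ ∫ z, |deriv (deriv ρ) (z + 0) - deriv (deriv ρ) (z + v)| * g i z := by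
      have i0 := hρ.integrable_deriv_score (hg.1 i) 0
      have iv := hρ.integrable_deriv_score (hg.1 i) v
      rw [← integral_sub i0 iv]
      refine integral_mono (i0.sub iv) ?_ fun z => ?_
      · refine (i0.sub iv).abs.congr (Eventually.of_forall fun z => ?_)
        simp only [Pi.sub_apply]
        rw [← sub_mul, abs_mul, abs_of_nonneg ((hg.1 i).nonneg z)]
      · simp only
        rw [← sub_mul]
        exact mul_le_mul_of_nonneg_right (le_abs_self _) ((hg.1 i).nonneg z)
    have h3 : Lρ * |0 - v| ^ α ≤ c / 4 := by
      have : |0 - v| ^ α ≤ c / (4 * Lρ) := by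
        rw [zero_sub, abs_neg]
        refine (Real.rpow_le_rpow (abs_nonneg _) hv hα.le).trans (le_of_eq ?_)
        rw [hη₀, ← Real.rpow_mul (by positivity), one_div_mul_cancel hα.ne', Real.rpow_one]
      calc Lρ * |0 - v| ^ α ≤ Lρ * (c / (4 * Lρ)) := mul_le_mul_of_nonneg_left this hL.le
        _ = c / 4 := by field_simp
    have h4 := hg.2 i
    simp only [add_zero] at h2 h1
    linarith
  have hslope : ∀ i, ∀ v w : ℝ, |v| ≤ η₀ → |w| ≤ η₀ → v < w →
      3 / 4 * c * (w - v) ≤ smoothScore ρ (g i) w - smoothScore ρ (g i) v := by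
    intro i v w hv hw hvw
    obtain ⟨ξ, hξ, he⟩ := exists_hasDerivAt_eq_slope (smoothScore ρ (g i))
      (fun u => ∫ z, deriv (deriv ρ) (z + u) * g i z) hvw
      (fun u _ => (hρ.hasDerivAt_smoothScore (hg.1 i) u).continuousAt.continuousWithinAt)
      (fun u _ => hρ.hasDerivAt_smoothScore (hg.1 i) u)
    have hξ' := hderiv i ξ (abs_le.2 ⟨by linarith [(abs_le.1 hv).1, hξ.1],
      by linarith [(abs_le.1 hw).2, hξ.2]⟩)
    rw [he, le_div_iff₀ (by linarith)] at hξ'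
    exact hξ'
  -- Halving keeps both `u` and `u - y` within `η₀`.
  refine ⟨η₀ / 2, by positivity, fun i u y hu hy => ?_⟩
  have hu' : |u| ≤ η₀ := by linarith
  have huy : |u - y| ≤ η₀ := (abs_sub _ _).trans (by linarith)
  rcases lt_trichotomy y 0 with h | h | h
  · have := hslope i u (u - y) hu' huy (by linarith)
    nlinarith
  · subst h; simp
  · have := hslope i (u - y) u huy hu' (by linarith)
    nlinarith

end Score

/-! ### Expectations for a single observation -/

section Single

variable {d : ℕ}

/-- The rescaled design point `(x - x₀) / h`. -/
noncomputable def rescale (x₀ : Fin d → ℝ) (h : ℝ) (x : Fin d → ℝ) : Fin d → ℝ :=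
  fun j => (x j - x₀ j) / h

/-- The kernel scaled by `h` and moved to `x₀` is supported in the unit cube. -/
def KernelFits (K : (Fin d → ℝ) → ℝ) (x₀ : Fin d → ℝ) (h : ℝ) : Prop :=
  ∀ x, K (rescale x₀ h x) ≠ 0 → x ∈ cube d

/-- The law of `(X, ξ)` for noise density `γ`. -/
noncomputable def obsLaw (d : ℕ) (γ : ℝ → ℝ) : Measure ((Fin d → ℝ) × ℝ) :=
  (volume.restrict (cube d)).prod (volume.withDensity fun z : ℝ => ENNReal.ofReal (γ z))

theorem modelLaw_eq_pi (d : ℕ) (g : ℕ → ℝ → ℝ) (n : ℕ) :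
    modelLaw d g n = Measure.pi fun i : Fin n => obsLaw d (g i) := rfl

/-- Coordinates of `x₀` on a face are taken care of by the inward condition on `K`. The remaining
ones have positive distance to the faces, which exceeds `h/2` for small `h`. -/
theorem exists_kernelFits {K : (Fin d → ℝ) → ℝ} (hK : IsKernel K) {x₀ : Fin d → ℝ}
    (hx₀ : x₀ ∈ cube d) (hin : KernelInward K x₀) :
    ∃ h₁ > 0, ∀ h, 0 < h → h ≤ h₁ → KernelFits K x₀ h := by
  have hev : ∀ᶠ h in nhdsWithin (0 : ℝ) (Set.Ioi 0), ∀ j, (x₀ j ≠ 0 → h ≤ x₀ j) ∧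
      (x₀ j ≠ 1 → h ≤ 1 - x₀ j) ∧ h ≤ 1 := by
    rw [eventually_all]
    intro j
    have hle : ∀ a : ℝ, 0 < a → ∀ᶠ h in nhdsWithin (0 : ℝ) (Set.Ioi 0), h ≤ a := fun a ha =>
      nhdsWithin_le_nhds (Iic_mem_nhds ha)
    refine Eventually.and ?_ (Eventually.and ?_ (hle 1 one_pos))
    · by_cases h0 : x₀ j = 0
      · simp [h0]
      · filter_upwards [hle (x₀ j) (lt_of_le_of_ne (hx₀.1 j) (Ne.symm h0))] with h hh _ using hh
    · by_cases h0 : x₀ j = 1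
      · simp [h0]
      · filter_upwards [hle (1 - x₀ j) (sub_pos.2 (lt_of_le_of_ne (hx₀.2 j) h0))] with h hh _
          using hh
  obtain ⟨h₁, hh₁, hsub⟩ := mem_nhdsGT_iff_exists_Ioc_subset.1 hev
  refine ⟨h₁, hh₁, fun h h0 hle x hx => ?_⟩
  have hh := hsub ⟨h0, hle⟩
  have hbox := hK.support _ hx
  have hi := hin _ hx
  have hxj : ∀ j, x j = x₀ j + h * rescale x₀ h x j := fun j => by
    unfold rescale
    field_simp
    ring
  refine ⟨fun j => ?_, fun j => ?_⟩
  · show (0 : ℝ) ≤ x j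
    have h1 : -(1 / 2) ≤ rescale x₀ h x j := hbox.1 j
    by_cases hz : x₀ j = 0
    · have := mul_nonneg h0.le ((hi j).1 hz)
      rw [hxj]
      linarith
    · have := (hh j).1 hz
      rw [hxj]
      nlinarith
  · show x j ≤ (1 : ℝ)
    have h1 : rescale x₀ h x j ≤ 1 / 2 := hbox.2 j
    by_cases hz : x₀ j = 1
    · have := mul_nonneg h0.le (neg_nonneg.2 ((hi j).2 hz))
      rw [hxj]
      linarith
    · have := (hh j).2.1 hz
      rw [hxj]
      nlinarith

theorem measurable_rescale (x₀ : Fin d → ℝ) (h : ℝ) : Measurable (rescale x₀ h) := by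
  unfold rescale
  fun_prop

theorem volume_cube (d : ℕ) : volume (cube d) = 1 := by
  unfold cube
  rw [Real.volume_Icc_pi]
  simp

theorem isProbabilityMeasure_noise {γ : ℝ → ℝ} (hγ : IsNoiseDensity γ) :
    IsProbabilityMeasure (volume.withDensity fun z : ℝ => ENNReal.ofReal (γ z)) := by
  refine ⟨?_⟩
  rw [withDensity_apply _ MeasurableSet.univ, Measure.restrict_univ,
    ← ofReal_integral_eq_lintegral_ofReal hγ.integrable (Eventually.of_forall hγ.nonneg),
    hγ.integral_eq_one, ENNReal.ofReal_one]

theorem isProbabilityMeasure_obsLaw (d : ℕ) {γ : ℝ → ℝ} (hγ : IsNoiseDensity γ) :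
    IsProbabilityMeasure (obsLaw d γ) := by
  have := isProbabilityMeasure_noise hγ
  have : IsProbabilityMeasure (volume.restrict (cube d)) := ⟨by simp [volume_cube]⟩
  unfold obsLaw
  infer_instance

theorem integral_obsLaw {γ : ℝ → ℝ} (hγ : IsNoiseDensity γ) {F : (Fin d → ℝ) × ℝ → ℝ}
    (hF : Measurable F) {B : ℝ} (hB : ∀ e, |F e| ≤ B) :
    ∫ e, F e ∂(obsLaw d γ) = ∫ x in cube d, ∫ z, F (x, z) * γ z := by
  have h1 := isProbabilityMeasure_noise hγ
  have h2 := isProbabilityMeasure_obsLaw d hγ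
  have hInt : Integrable F (obsLaw d γ) := Integrable.of_bound hF.aestronglyMeasurable B
    (Eventually.of_forall hB)
  unfold obsLaw at hInt ⊢
  rw [integral_prod _ hInt]
  refine integral_congr_ae (Eventually.of_forall fun x => ?_)
  simp only
  rw [integral_withDensity_eq_integral_toReal_smul hγ.measurable.ennreal_ofReal (by simp)]
  refine integral_congr_ae (Eventually.of_forall fun z => ?_)
  simp only [ENNReal.toReal_ofReal (hγ.nonneg z), smul_eq_mul]
  ring

variable {K : (Fin d → ℝ) → ℝ} {x₀ : Fin d → ℝ} {h : ℝ}

/-- The integrand vanishes off the cube because the scaled kernel fits into it, so the integral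
extends to the whole space and the substitution `z = (x - x₀)/h` applies. -/
theorem setIntegral_rescale (hh : 0 < h) (hfit : KernelFits K x₀ h) {G : (Fin d → ℝ) → ℝ}
    (hG : ∀ z, K z = 0 → G z = 0) :
    ∫ x in cube d, G (rescale x₀ h x) = h ^ d * ∫ z, G z := by
  rw [setIntegral_eq_integral_of_forall_compl_eq_zero]
  · have h1 : ∀ x, G (rescale x₀ h x) = (fun y => G (h⁻¹ • y)) (x - x₀) := fun x => by
      simp only
      congr 1
      funext j
      simp [rescale, div_eq_inv_mul]
    simp_rw [h1]
    rw [integral_sub_right_eq_self (fun y => G (h⁻¹ • y)) x₀, Measure.integral_comp_smul,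
      Module.finrank_fin_fun, smul_eq_mul, inv_pow, inv_inv, abs_of_pos (pow_pos hh d)]
  · intro x hx
    apply hG
    by_contra hne
    exact hx (hfit x hne)

theorem integrableOn_rescale (hK : IsKernel K) {F : (Fin d → ℝ) → ℝ} (hF : Measurable F) {A : ℝ}
    (hA : ∀ x, K (rescale x₀ h x) ≠ 0 → |F x| ≤ A) :
    IntegrableOn (fun x => F x * K (rescale x₀ h x)) (cube d) := by
  refine Measure.integrableOn_of_bounded (M := |A| * supNorm K) (by simp [volume_cube])
    (hF.mul (hK.measurable.comp (measurable_rescale x₀ h))).aestronglyMeasurable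
    (Eventually.of_forall fun x => ?_)
  by_cases hx : K (rescale x₀ h x) = 0
  · rw [hx, mul_zero, norm_zero]
    exact mul_nonneg (abs_nonneg _) hK.supNorm_nonneg
  · rw [Real.norm_eq_abs, abs_mul, abs_of_nonneg (hK.nonneg _)]
    exact mul_le_mul ((hA x hx).trans (le_abs_self A)) (hK.le_supNorm _) (hK.nonneg _)
      (abs_nonneg _)

theorem setIntegral_kernel_rescale (hK : IsKernel K) (hh : 0 < h) (hfit : KernelFits K x₀ h) :
    ∫ x in cube d, K (rescale x₀ h x) = h ^ d := by
  rw [setIntegral_rescale hh hfit fun _ h => h, hK.integral_eq_one, mul_one]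

theorem integral_obsLaw_kernel (hK : IsKernel K) (hh : 0 < h) (hfit : KernelFits K x₀ h)
    {γ : ℝ → ℝ} (hγ : IsNoiseDensity γ) :
    ∫ e, K (rescale x₀ h e.1) ∂(obsLaw d γ) = h ^ d := by
  rw [integral_obsLaw hγ (F := fun e => K (rescale x₀ h e.1))
    (hK.measurable.comp ((measurable_rescale x₀ h).comp measurable_fst)) (B := supNorm K)
    fun e => by
      rw [abs_of_nonneg (hK.nonneg _)]
      exact hK.le_supNorm _]
  simp_rw [integral_const_mul, hγ.integral_eq_one, mul_one]
  exact setIntegral_kernel_rescale hK hh hfit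

theorem integral_obsLaw_le_of_le_kernel (hK : IsKernel K) (hh : 0 < h) (hfit : KernelFits K x₀ h)
    {γ : ℝ → ℝ} (hγ : IsNoiseDensity γ) {F : (Fin d → ℝ) × ℝ → ℝ} {A : ℝ} (hF0 : ∀ e, 0 ≤ F e)
    (hF : ∀ e, F e ≤ A * K (rescale x₀ h e.1)) :
    ∫ e, F e ∂(obsLaw d γ) ≤ A * h ^ d := by
  have := isProbabilityMeasure_obsLaw d hγ
  rw [← integral_obsLaw_kernel hK hh hfit hγ, ← integral_const_mul]
  refine integral_mono_of_nonneg (Eventually.of_forall hF0) (Integrable.const_mul ?_ A)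
    (Eventually.of_forall hF)
  refine Integrable.of_bound (C := supNorm K)
    (hK.measurable.comp ((measurable_rescale x₀ h).comp measurable_fst)).aestronglyMeasurable
    (Eventually.of_forall fun e => ?_)
  rw [Real.norm_eq_abs, abs_of_nonneg (hK.nonneg _)]
  exact hK.le_supNorm _

variable {ρ : ℝ → ℝ} {g : ℕ → ℝ → ℝ} {u : (Fin d → ℝ) → ℝ}

/-- The contribution of one observation to the score in direction `p`, where `u` is the
approximation error. -/
noncomputable def scoreTerm (ρ : ℝ → ℝ) (K : (Fin d → ℝ) → ℝ) (x₀ : Fin d → ℝ) (h : ℝ)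
    (u : (Fin d → ℝ) → ℝ) (p : Fin d → ℕ) (e : (Fin d → ℝ) × ℝ) : ℝ :=
  deriv ρ (e.2 + u e.1) * monom p (rescale x₀ h e.1) * K (rescale x₀ h e.1)

theorem measurable_scoreTerm (hK : IsKernel K) (hu : Measurable u) (p : Fin d → ℕ) :
    Measurable (scoreTerm ρ K x₀ h u p) := by
  have h1 : Measurable fun e : (Fin d → ℝ) × ℝ => rescale x₀ h e.1 :=
    (measurable_rescale x₀ h).comp measurable_fst
  exact (((measurable_deriv ρ).comp (measurable_snd.add (hu.comp measurable_fst))).mul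
    ((continuous_monom p).measurable.comp h1)).mul (hK.measurable.comp h1)

theorem abs_scoreTerm_le_kernel (hK : IsKernel K) (hρ : IsContrast ρ g) (p : Fin d → ℕ)
    (e : (Fin d → ℝ) × ℝ) :
    |scoreTerm ρ K x₀ h u p e| ≤ supNorm (deriv ρ) * K (rescale x₀ h e.1) := by
  unfold scoreTerm
  rw [abs_mul, abs_of_nonneg (hK.nonneg _), abs_mul]
  by_cases hx : K (rescale x₀ h e.1) = 0
  · simp [hx]
  · refine mul_le_mul_of_nonneg_right ?_ (hK.nonneg _)
    exact (mul_le_of_le_one_right (abs_nonneg _) (abs_monom_le_one _ (hK.support _ hx))).trans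
      (hρ.abs_deriv_le _)

theorem supNorm_deriv_nonneg (hρ : IsContrast ρ g) : 0 ≤ supNorm (deriv ρ) :=
  (abs_nonneg _).trans (hρ.abs_deriv_le 0)

theorem abs_scoreTerm_le (hK : IsKernel K) (hρ : IsContrast ρ g) (p : Fin d → ℕ)
    (e : (Fin d → ℝ) × ℝ) :
    |scoreTerm ρ K x₀ h u p e| ≤ supNorm (deriv ρ) * supNorm K :=
  (abs_scoreTerm_le_kernel hK hρ p e).trans
    (mul_le_mul_of_nonneg_left (hK.le_supNorm _) (supNorm_deriv_nonneg hρ))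

theorem integral_scoreTerm_sq_le (hK : IsKernel K) (hρ : IsContrast ρ g) (hh : 0 < h)
    (hfit : KernelFits K x₀ h) {γ : ℝ → ℝ} (hγ : IsNoiseDensity γ) (p : Fin d → ℕ) :
    ∫ e, scoreTerm ρ K x₀ h u p e ^ 2 ∂(obsLaw d γ)
      ≤ supNorm (deriv ρ) ^ 2 * supNorm K * h ^ d := by
  refine integral_obsLaw_le_of_le_kernel hK hh hfit hγ (fun _ => sq_nonneg _) fun e => ?_
  rw [← sq_abs]
  calc |scoreTerm ρ K x₀ h u p e| ^ 2
      ≤ (supNorm (deriv ρ) * K (rescale x₀ h e.1)) ^ 2 :=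
        pow_le_pow_left₀ (abs_nonneg _) (abs_scoreTerm_le_kernel hK hρ p e) 2
    _ = supNorm (deriv ρ) ^ 2 * K (rescale x₀ h e.1) * K (rescale x₀ h e.1) := by ring
    _ ≤ supNorm (deriv ρ) ^ 2 * supNorm K * K (rescale x₀ h e.1) := by
        gcongr
        · exact hK.nonneg _
        · exact hK.le_supNorm _

/-- Integrating out the noise first replaces `ρ'` by the smoothed score, which is at most `|u x| ≤
ε`. The monomials are at most 1 on the support of the kernel, and the kernel has mass `h^d`. -/
theorem abs_integral_scoreTerm_le (hK : IsKernel K) (hρ : IsContrast ρ g) (hh : 0 < h)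
    (hfit : KernelFits K x₀ h) {γ : ℝ → ℝ} (hγ : IsNoiseDensity γ) (hu : Measurable u) {ε : ℝ}
    (hε : ∀ x, K (rescale x₀ h x) ≠ 0 → |u x| ≤ ε) (p : Fin d → ℕ) :
    |∫ e, scoreTerm ρ K x₀ h u p e ∂(obsLaw d γ)| ≤ ε * h ^ d := by
  rw [integral_obsLaw hγ (measurable_scoreTerm hK hu p) (abs_scoreTerm_le hK hρ p)]
  have h1 : ∀ x, ∫ z, scoreTerm ρ K x₀ h u p (x, z) * γ z =
      smoothScore ρ γ (u x) * (monom p (rescale x₀ h x) * K (rescale x₀ h x)) := fun x => by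
    unfold smoothScore
    rw [← integral_mul_const]
    refine integral_congr_ae (Eventually.of_forall fun z => ?_)
    simp only [scoreTerm]
    ring
  simp_rw [h1]
  rw [← setIntegral_kernel_rescale hK hh hfit, ← integral_const_mul, ← Real.norm_eq_abs]
  refine norm_integral_le_of_norm_le
    (integrableOn_rescale hK measurable_const (A := |ε|) fun _ _ => le_rfl)
    (Eventually.of_forall fun x => ?_)
  by_cases hx : K (rescale x₀ h x) = 0
  · simp [hx]
  · rw [Real.norm_eq_abs, abs_mul, abs_mul, abs_of_nonneg (hK.nonneg _), ← mul_assoc]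
    refine mul_le_mul_of_nonneg_right ?_ (hK.nonneg _)
    exact (mul_le_of_le_one_right (abs_nonneg _) (abs_monom_le_one _ (hK.support _ hx))).trans
      ((hρ.abs_smoothScore_le hγ _).trans (hε x hx))

/-- The contribution of one observation to the increment of the score along `s w`, divided
by `s`. -/
noncomputable def curvTerm {b : ℕ} (ρ : ℝ → ℝ) (K : (Fin d → ℝ) → ℝ) (x₀ : Fin d → ℝ) (h : ℝ)
    (u : (Fin d → ℝ) → ℝ) (s : ℝ) (w : multiIdx d b → ℝ) (e : (Fin d → ℝ) × ℝ) : ℝ :=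
  (deriv ρ (e.2 + u e.1) - deriv ρ (e.2 + u e.1 - s * polyVal w (rescale x₀ h e.1))) / s *
    polyVal w (rescale x₀ h e.1) * K (rescale x₀ h e.1)

variable {b : ℕ} {s : ℝ}

theorem measurable_curvTerm (hK : IsKernel K) (hu : Measurable u) (w : multiIdx d b → ℝ) :
    Measurable (curvTerm ρ K x₀ h u s w) := by
  have h1 : Measurable fun e : (Fin d → ℝ) × ℝ => rescale x₀ h e.1 :=
    (measurable_rescale x₀ h).comp measurable_fst
  have h2 : Measurable fun e : (Fin d → ℝ) × ℝ => polyVal w (rescale x₀ h e.1) :=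
    (continuous_polyVal w).measurable.comp h1
  have h3 : Measurable fun e : (Fin d → ℝ) × ℝ => e.2 + u e.1 :=
    measurable_snd.add (hu.comp measurable_fst)
  exact (((((measurable_deriv ρ).comp h3).sub ((measurable_deriv ρ).comp
    (h3.sub (h2.const_mul s)))).div_const s).mul h2).mul (hK.measurable.comp h1)

theorem abs_scoreIncrement_le (hρ : IsContrast ρ g) (hs : 0 < s) (y a : ℝ) :
    |(deriv ρ y - deriv ρ (y - s * a)) / s| ≤ |a| := by
  rw [abs_div, abs_of_pos hs, div_le_iff₀ hs]
  have := hρ.abs_deriv_sub_le y (y - s * a)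
  rw [sub_sub_cancel, abs_mul, abs_of_pos hs] at this
  linarith

theorem abs_curvTerm_le_kernel (hK : IsKernel K) (hρ : IsContrast ρ g) (hs : 0 < s)
    {w : multiIdx d b → ℝ} {A : ℝ} (hw : ∑ p, |w p| ≤ A) (e : (Fin d → ℝ) × ℝ) :
    |curvTerm ρ K x₀ h u s w e| ≤ A ^ 2 * K (rescale x₀ h e.1) := by
  unfold curvTerm
  rw [abs_mul, abs_of_nonneg (hK.nonneg _), abs_mul, sq]
  by_cases hx : K (rescale x₀ h e.1) = 0
  · simp [hx]
  · have ha := (abs_polyVal_le w (hK.support _ hx)).trans hw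
    refine mul_le_mul_of_nonneg_right (mul_le_mul ((abs_scoreIncrement_le hρ hs _ _).trans ha) ha
      (abs_nonneg _) ((abs_nonneg _).trans ha)) (hK.nonneg _)

/-- The division by `s` cancels the factor `s` inside `ρ'`, so the curvature is Lipschitz in the
direction with a constant that does not depend on `s`. A net of directions can therefore be fixed
before the radius. -/
theorem abs_curvTerm_sub_le (hK : IsKernel K) (hρ : IsContrast ρ g) (hs : 0 < s)
    {w w' : multiIdx d b → ℝ} {A δ : ℝ} (hw : ∑ p, |w p| ≤ A) (hw' : ∑ p, |w' p| ≤ A)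
    (hδ : ∑ p, |w p - w' p| ≤ δ) (e : (Fin d → ℝ) × ℝ) :
    |curvTerm ρ K x₀ h u s w e - curvTerm ρ K x₀ h u s w' e|
      ≤ 2 * A * δ * K (rescale x₀ h e.1) := by
  unfold curvTerm
  rw [← sub_mul, abs_mul, abs_of_nonneg (hK.nonneg _)]
  by_cases hx : K (rescale x₀ h e.1) = 0
  · simp [hx]
  refine mul_le_mul_of_nonneg_right ?_ (hK.nonneg _)
  set a := polyVal w (rescale x₀ h e.1)
  set a' := polyVal w' (rescale x₀ h e.1)
  set y := e.2 + u e.1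
  have ha : |a| ≤ A := (abs_polyVal_le w (hK.support _ hx)).trans hw
  have ha' : |a'| ≤ A := (abs_polyVal_le w' (hK.support _ hx)).trans hw'
  have haa : |a - a'| ≤ δ := by
    have h1 : a - a' = polyVal (fun p => w p - w' p) (rescale x₀ h e.1) := by
      simp only [a, a', polyVal, sub_mul, Finset.sum_sub_distrib]
    rw [h1]
    exact (abs_polyVal_le _ (hK.support _ hx)).trans hδ
  have h1 : |(deriv ρ y - deriv ρ (y - s * a)) / s - (deriv ρ y - deriv ρ (y - s * a')) / s|
      ≤ δ := by
    rw [← sub_div, abs_div, abs_of_pos hs, div_le_iff₀ hs]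
    have h2 := hρ.abs_deriv_sub_le (y - s * a') (y - s * a)
    have h3 : y - s * a' - (y - s * a) = s * (a - a') := by ring
    rw [h3, abs_mul, abs_of_pos hs] at h2
    have h4 : deriv ρ y - deriv ρ (y - s * a) - (deriv ρ y - deriv ρ (y - s * a'))
      = deriv ρ (y - s * a') - deriv ρ (y - s * a) := by ring
    rw [h4]
    nlinarith
  have h2 := abs_scoreIncrement_le hρ hs y a
  set v := (deriv ρ y - deriv ρ (y - s * a)) / s
  set v' := (deriv ρ y - deriv ρ (y - s * a')) / s
  calc |v * a - v' * a'| = |v * (a - a') + (v - v') * a'| := by congr 1; ring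
    _ ≤ |v| * |a - a'| + |v - v'| * |a'| := by
        refine (abs_add_le _ _).trans ?_
        rw [abs_mul, abs_mul]
    _ ≤ A * δ + δ * A := add_le_add
        (mul_le_mul (h2.trans ha) haa (abs_nonneg _) ((abs_nonneg _).trans ha))
        (mul_le_mul h1 ha' (abs_nonneg _) ((abs_nonneg _).trans h1))
    _ = 2 * A * δ := by ring

theorem integral_curvTerm_sq_le (hK : IsKernel K) (hρ : IsContrast ρ g) (hh : 0 < h)
    (hfit : KernelFits K x₀ h) {γ : ℝ → ℝ} (hγ : IsNoiseDensity γ) (hs : 0 < s)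
    {w : multiIdx d b → ℝ} {A : ℝ} (hw : ∑ p, |w p| ≤ A) :
    ∫ e, curvTerm ρ K x₀ h u s w e ^ 2 ∂(obsLaw d γ) ≤ A ^ 4 * supNorm K * h ^ d := by
  refine integral_obsLaw_le_of_le_kernel hK hh hfit hγ (fun _ => sq_nonneg _) fun e => ?_
  rw [← sq_abs]
  calc |curvTerm ρ K x₀ h u s w e| ^ 2
      ≤ (A ^ 2 * K (rescale x₀ h e.1)) ^ 2 :=
        pow_le_pow_left₀ (abs_nonneg _) (abs_curvTerm_le_kernel hK hρ hs hw e) 2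
    _ = A ^ 4 * K (rescale x₀ h e.1) * K (rescale x₀ h e.1) := by ring
    _ ≤ A ^ 4 * supNorm K * K (rescale x₀ h e.1) := by
        gcongr
        · exact hK.nonneg _
        · exact hK.le_supNorm _

/-- Integrating out the noise turns the increment of `ρ'` into one of the smoothed score. Strong
monotonicity with `y = s a(x)` bounds the result below by `c₀ a(x)²`. What remains is the quadratic
form of the kernel matrix at a unit vector. -/
theorem le_integral_curvTerm (hK : IsKernel K) (hρ : IsContrast ρ g) (hh : 0 < h)
    (hfit : KernelFits K x₀ h) {γ : ℝ → ℝ} (hγ : IsNoiseDensity γ) (hu : Measurable u)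
    {η c₀ : ℝ} (hc₀ : 0 ≤ c₀) (hη : ∀ u y : ℝ, |u| ≤ η → |y| ≤ η →
      c₀ * y ^ 2 ≤ (smoothScore ρ γ u - smoothScore ρ γ (u - y)) * y)
    (hε : ∀ x, K (rescale x₀ h x) ≠ 0 → |u x| ≤ η) (hs : 0 < s)
    {w : multiIdx d b → ℝ} {A : ℝ} (hw : ∑ p, |w p| ≤ A) (hw2 : ∑ p, w p ^ 2 = 1)
    (hsA : s * A ≤ η) :
    c₀ * minEigenvalue b K * h ^ d ≤ ∫ e, curvTerm ρ K x₀ h u s w e ∂(obsLaw d γ) := by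
  have hbd : ∀ e, |curvTerm ρ K x₀ h u s w e| ≤ A ^ 2 * supNorm K := fun e =>
    (abs_curvTerm_le_kernel hK hρ hs hw e).trans
      (mul_le_mul_of_nonneg_left (hK.le_supNorm _) (sq_nonneg A))
  rw [integral_obsLaw hγ (measurable_curvTerm hK hu w) hbd]
  set a : (Fin d → ℝ) → ℝ := fun x => polyVal w (rescale x₀ h x) with ha
  have h1 : ∀ x, ∫ z, curvTerm ρ K x₀ h u s w (x, z) * γ z =
      (smoothScore ρ γ (u x) - smoothScore ρ γ (u x - s * a x)) / s * a x *
        K (rescale x₀ h x) := fun x => by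
    have h2 : ∀ z, curvTerm ρ K x₀ h u s w (x, z) * γ z =
        (deriv ρ (z + u x) * γ z - deriv ρ (z + (u x - s * a x)) * γ z) *
          (a x / s * K (rescale x₀ h x)) := fun z => by
      simp only [curvTerm, ha, add_sub_assoc]
      ring
    simp_rw [h2]
    rw [integral_mul_const, integral_sub (hρ.integrable_score hγ _) (hρ.integrable_score hγ _)]
    unfold smoothScore
    ring
  have h3 : c₀ * minEigenvalue b K * h ^ d
      ≤ ∫ x in cube d, c₀ * (a x ^ 2 * K (rescale x₀ h x)) := by
    rw [integral_const_mul, setIntegral_rescale (G := fun z => polyVal w z ^ 2 * K z) hh hfit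
      (fun z hz => by simp [hz])]
    have h4 := minEigenvalue_mul_le hK b w
    rw [hw2, mul_one] at h4
    have h5 := pow_pos hh d
    calc c₀ * minEigenvalue b K * h ^ d ≤ c₀ * (∫ z, polyVal w z ^ 2 * K z) * h ^ d := by gcongr
      _ = _ := by ring
  refine h3.trans ?_
  have ham : Measurable a := (continuous_polyVal w).measurable.comp (measurable_rescale x₀ h)
  refine integral_mono_of_nonneg (Eventually.of_forall fun x =>
    mul_nonneg hc₀ (mul_nonneg (sq_nonneg _) (hK.nonneg _))) ?_
    (Eventually.of_forall fun x => ?_)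
  -- Integrability in the design variable alone comes from Fubini applied to the bounded function on
  -- the product space.
  · have hInt : Integrable (curvTerm ρ K x₀ h u s w) (obsLaw d γ) := by
      have := isProbabilityMeasure_obsLaw d hγ
      exact Integrable.of_bound (measurable_curvTerm hK hu w).aestronglyMeasurable _
        (Eventually.of_forall hbd)
    have := isProbabilityMeasure_noise hγ
    have h5 := Integrable.integral_prod_left hInt
    refine h5.congr (Eventually.of_forall fun x => ?_)
    simp only
    rw [integral_withDensity_eq_integral_toReal_smul hγ.measurable.ennreal_ofReal (by simp)]
    refine integral_congr_ae (Eventually.of_forall fun z => ?_)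
    simp only [ENNReal.toReal_ofReal (hγ.nonneg z), smul_eq_mul]
    ring
  · simp only [h1]
    by_cases hx : K (rescale x₀ h x) = 0
    · simp [hx]
    rw [← mul_assoc]
    refine mul_le_mul_of_nonneg_right ?_ (hK.nonneg _)
    have hax : |a x| ≤ A := (abs_polyVal_le w (hK.support _ hx)).trans hw
    have h6 := hη (u x) (s * a x) (hε x hx) (by
      rw [abs_mul, abs_of_pos hs]
      exact (mul_le_mul_of_nonneg_left hax hs.le).trans hsA)
    rw [div_mul_eq_mul_div, le_div_iff₀ hs]
    have h7 : c₀ * (s * a x) ^ 2 = s * (c₀ * a x ^ 2 * s) := by ring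
    have h8 : (smoothScore ρ γ (u x) - smoothScore ρ γ (u x - s * a x)) * (s * a x)
      = s * ((smoothScore ρ γ (u x) - smoothScore ρ γ (u x - s * a x)) * a x) := by ring
    rw [h7, h8] at h6
    exact le_of_mul_le_mul_left h6 hs

end Single

/-! ### Deviations of the score and of the curvature -/

section Deviation

variable {d b n : ℕ} {K : (Fin d → ℝ) → ℝ} {x₀ : Fin d → ℝ} {h : ℝ} {ρ : ℝ → ℝ} {g : ℕ → ℝ → ℝ}
  {u : (Fin d → ℝ) → ℝ}

/-- The sup-norm of the (unnormalised) score vector. -/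
noncomputable def scoreNorm (b : ℕ) (ρ : ℝ → ℝ) (K : (Fin d → ℝ) → ℝ) (x₀ : Fin d → ℝ) (h : ℝ)
    (u : (Fin d → ℝ) → ℝ) (ω : Sample d n) : ℝ :=
  ‖fun p : multiIdx d b => ∑ i, scoreTerm ρ K x₀ h u p.1 (ω i)‖

theorem measurable_sum_scoreTerm (hK : IsKernel K) (hu : Measurable u) (p : Fin d → ℕ) :
    Measurable fun ω : Sample d n => ∑ i, scoreTerm ρ K x₀ h u p (ω i) :=
  Finset.measurable_fun_sum _ fun i _ =>
    (measurable_scoreTerm hK hu p).comp (measurable_pi_apply i)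

theorem measurable_scoreNorm (hK : IsKernel K) (hu : Measurable u) :
    Measurable (scoreNorm (n := n) b ρ K x₀ h u) :=
  (measurable_pi_lambda _ fun p : multiIdx d b => measurable_sum_scoreTerm hK hu p.1).norm

/-- The maximum norm is attained at some coordinate with one of the two signs. Summing over all
coordinates and both signs is the source of the factor `2 N_b` in the later bounds. -/
theorem exp_mul_pi_norm_le {ι : Type*} [Fintype ι] [Nonempty ι] {t : ℝ} (ht : 0 ≤ t) (v : ι → ℝ) :
    Real.exp (t * ‖v‖) ≤ ∑ p, (Real.exp (t * v p) + Real.exp (t * -v p)) := by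
  obtain ⟨p, hp⟩ : ∃ p, ‖v‖ ≤ |v p| := by
    by_contra! hlt
    have h0 : 0 < ‖v‖ := (abs_nonneg _).trans_lt (hlt (Classical.arbitrary ι))
    exact lt_irrefl _ ((pi_norm_lt_iff h0).2 hlt)
  have h1 : Real.exp (t * ‖v‖) ≤ Real.exp (t * v p) + Real.exp (t * -v p) := by
    refine (Real.exp_le_exp.2 (mul_le_mul_of_nonneg_left hp ht)).trans ?_
    rcases abs_choice (v p) with hv | hv <;> rw [hv]
    · linarith [Real.exp_pos (t * -v p)]
    · linarith [Real.exp_pos (t * v p)]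
  exact h1.trans (Finset.single_le_sum
    (f := fun p => Real.exp (t * v p) + Real.exp (t * -v p)) (fun q _ => by positivity)
    (Finset.mem_univ p))

/-- This one moment bound serves twice: with `t` proportional to `S` for the tail at the threshold,
and with `t = 1/(N S)` for a bounded exponential moment of the score relative to `S`. -/
theorem lintegral_exp_scoreNorm_le (hK : IsKernel K) (hρ : IsContrast ρ g)
    (hg : ∀ i, IsNoiseDensity (g i)) (hh : 0 < h) (hfit : KernelFits K x₀ h) (hu : Measurable u)
    {ε : ℝ} (hε : ∀ x, K (rescale x₀ h x) ≠ 0 → |u x| ≤ ε) {t : ℝ} (ht : 0 ≤ t)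
    (ht1 : t * (supNorm (deriv ρ) * supNorm K) ≤ 1) :
    ∫⁻ ω, ENNReal.ofReal (Real.exp (t * scoreNorm b ρ K x₀ h u ω)) ∂(modelLaw d g n)
      ≤ ENNReal.ofReal (2 * (multiIdx d b).card *
        Real.exp (n * h ^ d * (t * ε + t ^ 2 * (supNorm (deriv ρ) ^ 2 * supNorm K)))) := by
  have hne : Nonempty (multiIdx d b) := ⟨zeroIdx d b⟩
  have hpr : ∀ i : Fin n, IsProbabilityMeasure (obsLaw d (g i)) := fun i =>
    isProbabilityMeasure_obsLaw d (hg i)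
  set E := Real.exp (n * h ^ d * (t * ε + t ^ 2 * (supNorm (deriv ρ) ^ 2 * supNorm K))) with hE
  have hEeq : E = Real.exp (n * (t * (ε * h ^ d) +
      t ^ 2 * (supNorm (deriv ρ) ^ 2 * supNorm K * h ^ d))) := by
    rw [hE]
    congr 1
    ring
  have hmean := fun (i : Fin n) (p : Fin d → ℕ) =>
    abs_le.1 (abs_integral_scoreTerm_le hK hρ hh hfit (hg i) hu hε p)
  have hplus : ∀ p : Fin d → ℕ, ∫⁻ ω, ENNReal.ofReal (Real.exp (t *
      ∑ i, scoreTerm ρ K x₀ h u p (ω i))) ∂(modelLaw d g n) ≤ ENNReal.ofReal E := by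
    intro p
    rw [modelLaw_eq_pi, hEeq]
    exact lintegral_exp_mul_sum_le (Y := fun _ => scoreTerm ρ K x₀ h u p)
      (fun _ => measurable_scoreTerm hK hu p) (fun _ e => abs_scoreTerm_le hK hρ p e)
      (fun i => (hmean i p).2) (fun i => integral_scoreTerm_sq_le hK hρ hh hfit (hg i) p) ht ht1
  have hminus : ∀ p : Fin d → ℕ, ∫⁻ ω, ENNReal.ofReal (Real.exp (t *
      -∑ i, scoreTerm ρ K x₀ h u p (ω i))) ∂(modelLaw d g n) ≤ ENNReal.ofReal E := by
    intro p
    rw [modelLaw_eq_pi, hEeq]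
    have := lintegral_exp_mul_sum_le (μ := fun i : Fin n => obsLaw d (g i))
      (Y := fun _ e => -scoreTerm ρ K x₀ h u p e) (B := supNorm (deriv ρ) * supNorm K)
      (m := ε * h ^ d) (v := supNorm (deriv ρ) ^ 2 * supNorm K * h ^ d)
      (fun _ => (measurable_scoreTerm hK hu p).neg)
      (fun _ e => by rw [abs_neg]; exact abs_scoreTerm_le hK hρ p e)
      (fun i => by rw [integral_neg]; linarith [(hmean i p).1])
      (fun i => by simpa only [neg_sq] using integral_scoreTerm_sq_le hK hρ hh hfit (hg i) p)
      ht ht1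
    simpa only [Finset.sum_neg_distrib] using this
  have hm1 : ∀ p : multiIdx d b, Measurable fun ω : Sample d n => ENNReal.ofReal (Real.exp (t *
      ∑ i, scoreTerm ρ K x₀ h u p.1 (ω i))) := fun p =>
    ((measurable_sum_scoreTerm hK hu p.1).const_mul t).exp.ennreal_ofReal
  have hm2 : ∀ p : multiIdx d b, Measurable fun ω : Sample d n => ENNReal.ofReal (Real.exp (t *
      -∑ i, scoreTerm ρ K x₀ h u p.1 (ω i))) := fun p =>
    ((measurable_sum_scoreTerm hK hu p.1).neg.const_mul t).exp.ennreal_ofReal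
  calc ∫⁻ ω, ENNReal.ofReal (Real.exp (t * scoreNorm b ρ K x₀ h u ω)) ∂(modelLaw d g n)
      ≤ ∫⁻ ω, ∑ p : multiIdx d b, (ENNReal.ofReal (Real.exp (t *
          ∑ i, scoreTerm ρ K x₀ h u p.1 (ω i))) + ENNReal.ofReal (Real.exp (t *
          -∑ i, scoreTerm ρ K x₀ h u p.1 (ω i)))) ∂(modelLaw d g n) := by
        refine lintegral_mono fun ω => ?_
        simp only
        simp_rw [← ENNReal.ofReal_add (Real.exp_pos _).le (Real.exp_pos _).le]
        rw [← ENNReal.ofReal_sum_of_nonneg fun p _ => by positivity]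
        exact ENNReal.ofReal_le_ofReal (exp_mul_pi_norm_le ht _)
    _ = ∑ p : multiIdx d b, (∫⁻ ω, ENNReal.ofReal (Real.exp (t *
          ∑ i, scoreTerm ρ K x₀ h u p.1 (ω i))) ∂(modelLaw d g n) +
          ∫⁻ ω, ENNReal.ofReal (Real.exp (t *
          -∑ i, scoreTerm ρ K x₀ h u p.1 (ω i))) ∂(modelLaw d g n)) := by
        refine (lintegral_finsetSum _ fun p _ => (hm1 p).add (hm2 p)).trans ?_
        exact Finset.sum_congr rfl fun p _ => lintegral_add_left (hm1 p) _
    _ ≤ ∑ _p : multiIdx d b, (ENNReal.ofReal E + ENNReal.ofReal E) :=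
        Finset.sum_le_sum fun p _ => add_le_add (hplus p.1) (hminus p.1)
    _ = ENNReal.ofReal (2 * (multiIdx d b).card * E) := by
        rw [← ENNReal.ofReal_add (Real.exp_pos _).le (Real.exp_pos _).le,
          ← ENNReal.ofReal_sum_of_nonneg fun p _ => by positivity]
        congr 1
        rw [Finset.sum_const, Finset.card_univ, Fintype.card_coe, nsmul_eq_mul]
        ring

/-- The unit sphere is compact. A cover by sup-norm balls of radius `δ / (card + 1)` controls the
`ℓ¹` distance by `δ`; the added 1 keeps the radius meaningful for an empty index type. -/
theorem exists_sphere_net (ι : Type*) [Fintype ι] {δ : ℝ} (hδ : 0 < δ) :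
    ∃ T : Finset (ι → ℝ), (∀ w ∈ T, ∑ p, w p ^ 2 = 1) ∧
      ∀ w : ι → ℝ, ∑ p, w p ^ 2 = 1 → ∃ w' ∈ T, ∑ p, |w p - w' p| ≤ δ := by
  have hcomp : IsCompact {w : ι → ℝ | ∑ p, w p ^ 2 = 1} := by
    refine Metric.isCompact_of_isClosed_isBounded
      (isClosed_eq (by fun_prop) continuous_const) ?_
    refine (Metric.isBounded_closedBall (x := (0 : ι → ℝ)) (r := 1)).subset fun w hw => ?_
    rw [mem_closedBall_zero_iff, pi_norm_le_iff_of_nonneg zero_le_one]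
    intro p
    rw [Real.norm_eq_abs, ← sq_le_one_iff_abs_le_one]
    have hw' : ∑ p, w p ^ 2 = 1 := hw
    rw [← hw']
    exact Finset.single_le_sum (f := fun p => w p ^ 2) (fun _ _ => sq_nonneg _) (Finset.mem_univ p)
  set r := δ / (Fintype.card ι + 1) with hr
  have hr0 : 0 < r := by positivity
  obtain ⟨T, hTs, hTf, hTc⟩ := finite_cover_balls_of_compact hcomp hr0
  refine ⟨hTf.toFinset, fun w hw => hTs (hTf.mem_toFinset.1 hw), fun w hw => ?_⟩
  obtain ⟨w', hw', hd⟩ := Set.mem_iUnion₂.1 (hTc hw)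
  refine ⟨w', hTf.mem_toFinset.2 hw', ?_⟩
  have hle : ∀ p, |w p - w' p| ≤ r := fun p => by
    rw [← Real.dist_eq]
    exact (dist_le_pi_dist w w' p).trans (Metric.mem_ball.1 hd).le
  calc ∑ p, |w p - w' p| ≤ ∑ _p : ι, r := Finset.sum_le_sum fun p _ => hle p
    _ = Fintype.card ι * r := by simp
    _ ≤ δ := by
        rw [hr, mul_div_assoc', div_le_iff₀ (by positivity)]
        nlinarith

theorem sum_abs_le_card_of_sum_sq_eq_one {ι : Type*} [Fintype ι] {w : ι → ℝ}
    (hw : ∑ p, w p ^ 2 = 1) : ∑ p, |w p| ≤ Fintype.card ι := by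
  have h1 : ∀ p, |w p| ≤ 1 := fun p => by
    rw [← sq_le_one_iff_abs_le_one, ← hw]
    exact Finset.single_le_sum (f := fun p => w p ^ 2) (fun _ _ => sq_nonneg _) (Finset.mem_univ p)
  calc ∑ p, |w p| ≤ ∑ _p : ι, (1 : ℝ) := Finset.sum_le_sum fun p _ => h1 p
    _ = Fintype.card ι := by simp

/-- The samples for which the empirical curvature at radius `s` is too small. -/
def flatSet (b n : ℕ) (ρ : ℝ → ℝ) (K : (Fin d → ℝ) → ℝ) (x₀ : Fin d → ℝ) (c h : ℝ)
    (u : (Fin d → ℝ) → ℝ) (s : ℝ) : Set (Sample d n) :=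
  {ω | ∃ w : multiIdx d b → ℝ, ∑ p, w p ^ 2 = 1 ∧
    ∑ i, curvTerm ρ K x₀ h u s w (ω i) < c * minEigenvalue b K / 2 * (n * h ^ d)}

/-- The empirical curvature at a fixed radius is bounded below with large probability. -/
theorem exists_measure_flatSet_le (hK : IsKernel K) (b : ℕ) (hρ : IsContrast ρ g) {c : ℝ}
    (hc : 0 < c) (hg : g ∈ noiseClass ρ c) :
    ∃ η > 0, ∃ C₁ > 0, ∃ c₁ > 0, ∀ (n : ℕ) (x₀ : Fin d → ℝ) (h s : ℝ) (u : (Fin d → ℝ) → ℝ),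
      0 < h → KernelFits K x₀ h → Measurable u →
      (∀ x, K (rescale x₀ h x) ≠ 0 → |u x| ≤ η) → 0 < s → s ≤ η →
      modelLaw d g n (flatSet b n ρ K x₀ c h u s)
        ≤ ENNReal.ofReal (C₁ * Real.exp (-(c₁ * (n * h ^ d)))) := by
  obtain ⟨η₀, hη₀, hmono⟩ := smoothScore_strongly_monotone hρ hc hg
  set A : ℝ := ((multiIdx d b).card : ℝ) with hA
  have hA1 : 1 ≤ A := by
    rw [hA]
    exact_mod_cast Finset.card_pos.2 ⟨0, mem_multiIdx.2 (by simp)⟩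
  have hK1 := hK.one_le_supNorm
  set q := c * minEigenvalue b K with hq
  have hq0 : 0 < q := mul_pos hc (minEigenvalue_pos hK b)
  -- The first entry makes `t` times the uniform bound at most 1. The second keeps the quadratic
  -- term below `q/16`, half of the gap `q/8` between the mean level `3/4` and the target level
  -- `5/8`.
  set t := min (1 / (A ^ 2 * supNorm K)) (q / (16 * (A ^ 4 * supNorm K))) with ht
  have ht0 : 0 < t := lt_min (by positivity) (by positivity)
  have htB : t * (A ^ 2 * supNorm K) ≤ 1 := by
    calc t * (A ^ 2 * supNorm K) ≤ 1 / (A ^ 2 * supNorm K) * (A ^ 2 * supNorm K) := by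
          gcongr; exact min_le_left _ _
      _ = 1 := by field_simp
  have htq : t * (A ^ 4 * supNorm K) ≤ q / 16 := by
    calc t * (A ^ 4 * supNorm K) ≤ q / (16 * (A ^ 4 * supNorm K)) * (A ^ 4 * supNorm K) := by
          gcongr; exact min_le_right _ _
      _ = q / 16 := by field_simp
  -- With this mesh, passing to the net costs at most `2 A δ · 2N = q N / 8`, exactly the difference
  -- between the levels `1/2` and `5/8`.
  have hδ : 0 < q / (32 * A) := by positivity
  obtain ⟨T, hT1, hT2⟩ := exists_sphere_net (multiIdx d b) hδ
  -- The two rates belong to the curvature in a fixed direction and to the total kernel mass.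
  set c₁ := min (q * t / 16) (1 / (4 * supNorm K)) with hc₁
  refine ⟨η₀ / A, by positivity, T.card + 1, by positivity, c₁,
    lt_min (by positivity) (by positivity), ?_⟩
  intro n x₀ h s u hh hfit hu hε hs hsη
  have hε' : ∀ x, K (rescale x₀ h x) ≠ 0 → |u x| ≤ η₀ := fun x hx =>
    (hε x hx).trans (div_le_self hη₀.le hA1)
  have hsA : s * A ≤ η₀ := by rwa [← le_div_iff₀ (by positivity)]
  have hpr : ∀ i : Fin n, IsProbabilityMeasure (obsLaw d (g i)) := fun i =>
    isProbabilityMeasure_obsLaw d (hg.1 i)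
  set N : ℝ := n * h ^ d with hN
  have hN0 : 0 ≤ N := by positivity
  have habs : ∀ w : multiIdx d b → ℝ, ∑ p, w p ^ 2 = 1 → ∑ p, |w p| ≤ A := fun w hw => by
    have := sum_abs_le_card_of_sum_sq_eq_one hw
    rwa [Fintype.card_coe] at this
  have hfix : ∀ w : multiIdx d b → ℝ, ∑ p, w p ^ 2 = 1 →
      modelLaw d g n {ω | ∑ i, curvTerm ρ K x₀ h u s w (ω i) ≤ 5 / 8 * q * N}
        ≤ ENNReal.ofReal (Real.exp (-(c₁ * N))) := by
    intro w hw
    have h1 := measure_le_sum_le (μ := fun i : Fin n => obsLaw d (g i))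
      (Y := fun _ e => -curvTerm ρ K x₀ h u s w e) (B := A ^ 2 * supNorm K)
      (m := -(3 / 4 * c * minEigenvalue b K * h ^ d)) (v := A ^ 4 * supNorm K * h ^ d)
      (fun _ => (measurable_curvTerm hK hu w).neg)
      (fun _ e => by
        rw [abs_neg]
        exact (abs_curvTerm_le_kernel hK hρ hs (habs w hw) e).trans
          (mul_le_mul_of_nonneg_left (hK.le_supNorm _) (sq_nonneg A)))
      (fun i => by
        rw [integral_neg]
        exact neg_le_neg (le_integral_curvTerm hK hρ hh hfit (hg.1 i) hu (by positivity)
          (hmono i) hε' hs (habs w hw) hw hsA))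
      (fun i => by
        simpa only [neg_sq] using integral_curvTerm_sq_le hK hρ hh hfit (hg.1 i) hs (habs w hw))
      ht0.le htB (-(5 / 8 * q * N))
    rw [modelLaw_eq_pi]
    refine (measure_mono fun ω hω => ?_).trans (h1.trans (ENNReal.ofReal_le_ofReal
      (Real.exp_le_exp.2 ?_)))
    · simp only [Set.mem_ofPred_eq, Finset.sum_neg_distrib] at hω ⊢
      linarith
    · have e1 : n * (t * -(3 / 4 * c * minEigenvalue b K * h ^ d) +
          t ^ 2 * (A ^ 4 * supNorm K * h ^ d)) - t * -(5 / 8 * q * N)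
          = -(N * t * (q / 8 - t * (A ^ 4 * supNorm K))) := by
        rw [hq, hN]
        ring
      rw [e1, neg_le_neg_iff]
      have e2 : c₁ ≤ t * (q / 16) := (min_le_left _ _).trans (le_of_eq (by ring))
      calc c₁ * N ≤ t * (q / 16) * N := mul_le_mul_of_nonneg_right e2 hN0
        _ = N * t * (q / 16) := by ring
        _ ≤ N * t * (q / 8 - t * (A ^ 4 * supNorm K)) := by
            gcongr
            linarith
  -- The net argument multiplies the mesh by the random kernel mass. Its mean is `N`, so it exceeds
  -- `2N` only with exponentially small probability.
  have hker : modelLaw d g n {ω | 2 * N ≤ ∑ i, K (rescale x₀ h (ω i).1)}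
      ≤ ENNReal.ofReal (Real.exp (-(c₁ * N))) := by
    have h1 := measure_le_sum_le (μ := fun i : Fin n => obsLaw d (g i))
      (Y := fun _ e => K (rescale x₀ h e.1)) (B := supNorm K) (m := h ^ d)
      (v := supNorm K * h ^ d) (s := 1 / (2 * supNorm K))
      (fun _ => hK.measurable.comp ((measurable_rescale x₀ h).comp measurable_fst))
      (fun _ e => by
        rw [abs_of_nonneg (hK.nonneg _)]
        exact hK.le_supNorm _)
      (fun i => (integral_obsLaw_kernel hK hh hfit (hg.1 i)).le)
      (fun i => integral_obsLaw_le_of_le_kernel hK hh hfit (hg.1 i) (fun _ => sq_nonneg _)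
        fun e => by
          rw [sq]
          exact mul_le_mul_of_nonneg_right (hK.le_supNorm _) (hK.nonneg _))
      (by positivity) (by field_simp; norm_num) (2 * N)
    rw [modelLaw_eq_pi]
    refine h1.trans (ENNReal.ofReal_le_ofReal (Real.exp_le_exp.2 ?_))
    have e1 : n * (1 / (2 * supNorm K) * h ^ d + (1 / (2 * supNorm K)) ^ 2 * (supNorm K * h ^ d))
        - 1 / (2 * supNorm K) * (2 * N) = -(1 / (4 * supNorm K) * N) := by
      rw [hN]
      field_simp
      ring
    rw [e1, neg_le_neg_iff]
    exact mul_le_mul_of_nonneg_right (min_le_right _ _) hN0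
  have hsub : flatSet b n ρ K x₀ c h u s ⊆
      (⋃ w ∈ T, {ω | ∑ i, curvTerm ρ K x₀ h u s w (ω i) ≤ 5 / 8 * q * N}) ∪
        {ω | 2 * N ≤ ∑ i, K (rescale x₀ h (ω i).1)} := by
    rintro ω ⟨w, hw, hlt⟩
    by_cases hk : 2 * N ≤ ∑ i, K (rescale x₀ h (ω i).1)
    · exact Or.inr hk
    · left
      obtain ⟨w', hw', hd⟩ := hT2 w hw
      refine Set.mem_iUnion₂.2 ⟨w', hw', ?_⟩
      show ∑ i, curvTerm ρ K x₀ h u s w' (ω i) ≤ 5 / 8 * q * N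
      have h1 : ∑ i, curvTerm ρ K x₀ h u s w' (ω i) - ∑ i, curvTerm ρ K x₀ h u s w (ω i)
          ≤ 2 * A * (q / (32 * A)) * ∑ i, K (rescale x₀ h (ω i).1) := by
        rw [← Finset.sum_sub_distrib, Finset.mul_sum]
        refine Finset.sum_le_sum fun i _ => ?_
        have := abs_curvTerm_sub_le (x₀ := x₀) (h := h) (u := u) hK hρ hs (habs w hw)
          (habs w' (hT1 w' hw')) hd (ω i)
        linarith [(abs_le.1 this).1]
      have h2 : 2 * A * (q / (32 * A)) = q / 16 := by field_simp; norm_num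
      rw [h2] at h1
      have h3 : q / 16 * ∑ i, K (rescale x₀ h (ω i).1) ≤ q / 16 * (2 * N) := by
        gcongr
        exact (not_le.1 hk).le
      have h4 : c * minEigenvalue b K / 2 * (n * h ^ d) = q / 2 * N := rfl
      rw [h4] at hlt
      linarith
  calc modelLaw d g n (flatSet b n ρ K x₀ c h u s)
      ≤ _ := measure_mono hsub
    _ ≤ ∑ _w ∈ T, ENNReal.ofReal (Real.exp (-(c₁ * N))) +
          ENNReal.ofReal (Real.exp (-(c₁ * N))) :=
        (measure_union_le _ _).trans (add_le_add
          ((measure_biUnion_finset_le T _).trans (Finset.sum_le_sum fun w hw => hfix w (hT1 w hw)))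
          hker)
    _ = ENNReal.ofReal ((T.card + 1) * Real.exp (-(c₁ * N))) := by
        rw [Finset.sum_const, nsmul_eq_mul, ENNReal.ofReal_mul (by positivity),
          ENNReal.ofReal_add (by positivity) zero_le_one, ENNReal.ofReal_natCast,
          ENNReal.ofReal_one, add_mul, one_mul]

end Deviation

/-! ### The M-estimator on samples with good curvature -/

section Estimator

variable {d b n : ℕ} {K : (Fin d → ℝ) → ℝ} {x₀ : Fin d → ℝ} {h : ℝ} {ρ : ℝ → ℝ} {g : ℕ → ℝ → ℝ}

/-- The error of the approximation of `f` by the local polynomial with coefficients `t`. -/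
noncomputable def approxError (f : (Fin d → ℝ) → ℝ) (x₀ : Fin d → ℝ) (h : ℝ)
    (t : multiIdx d b → ℝ) (x : Fin d → ℝ) : ℝ :=
  (cube d).indicator f x - polyVal t (rescale x₀ h x)

/-- The function `f` is constrained only on the cube, so its values elsewhere are cut off before
measurability is deduced from continuity. -/
theorem measurable_approxError {f : (Fin d → ℝ) → ℝ} (hf : ContinuousOn f (cube d))
    (t : multiIdx d b → ℝ) : Measurable (approxError f x₀ h t) := by
  classical
  have h1 := hf.measurable_piecewise (g := 0) continuousOn_const measurableSet_Icc
  rw [Set.piecewise_eq_indicator] at h1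
  exact h1.sub ((continuous_polyVal t).measurable.comp (measurable_rescale x₀ h))

theorem mem_nbhd_of_kernel_ne_zero (hK : IsKernel K) (hh : 0 < h) (hfit : KernelFits K x₀ h)
    {x : Fin d → ℝ} (hx : K (rescale x₀ h x) ≠ 0) : x ∈ nbhd x₀ h := by
  have hbox := hK.support _ hx
  refine ⟨⟨fun j => ?_, fun j => ?_⟩, hfit x hx⟩
  · have h1 : -(1 / 2) ≤ (x j - x₀ j) / h := hbox.1 j
    rw [le_div_iff₀ hh] at h1
    linarith
  · have h1 : (x j - x₀ j) / h ≤ 1 / 2 := hbox.2 j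
    rw [div_le_iff₀ hh] at h1
    linarith

theorem polyVal_add_smul (t w : multiIdx d b → ℝ) (s : ℝ) (z : Fin d → ℝ) :
    polyVal (fun p => t p + s * w p) z = polyVal t z + s * polyVal w z := by
  simp only [polyVal, add_mul, Finset.sum_add_distrib, Finset.mul_sum, mul_assoc]

/-- Where the kernel does not vanish, the design point lies in the cube and in the neighbourhood, so
both indicators disappear. The criterion along a line through `t` then depends on the noise only
through `ξ + u(X)`. -/
theorem criterion_observe (hK : IsKernel K) (hh : 0 < h) (hfit : KernelFits K x₀ h)
    (f : (Fin d → ℝ) → ℝ) (ω : Sample d n) (t w : multiIdx d b → ℝ) (s : ℝ) :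
    criterion ρ K x₀ h (observe f ω) (fun p => t p + s * w p) = 1 / (n * h ^ d) *
      ∑ i, ρ ((ω i).2 + approxError f x₀ h t (ω i).1 - s * polyVal w (rescale x₀ h (ω i).1)) *
        K (rescale x₀ h (ω i).1) := by
  unfold criterion
  congr 1
  refine Finset.sum_congr rfl fun i _ => ?_
  show ρ (f (ω i).1 + (ω i).2 - localPoly x₀ h _ (ω i).1) * K (rescale x₀ h (ω i).1) = _
  by_cases hx : K (rescale x₀ h (ω i).1) = 0
  · rw [hx, mul_zero, mul_zero]
  · congr 2
    have h1 : localPoly x₀ h (fun p => t p + s * w p) (ω i).1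
        = polyVal (fun p => t p + s * w p) (rescale x₀ h (ω i).1) :=
      Set.indicator_of_mem (mem_nbhd_of_kernel_ne_zero hK hh hfit hx) _
    rw [h1, polyVal_add_smul, approxError, Set.indicator_of_mem (hfit _ hx)]
    ring

theorem sum_abs_le_sqrt_card {ι : Type*} [Fintype ι] {w : ι → ℝ} (hw : ∑ p, w p ^ 2 = 1) :
    ∑ p, |w p| ≤ Real.sqrt (Fintype.card ι) := by
  refine Real.le_sqrt_of_sq_le ?_
  have := sq_sum_le_card_mul_sum_sq (s := (Finset.univ : Finset ι)) (f := fun p => |w p|)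
  simpa [sq_abs, hw] using this

/-- If the empirical curvature is large at a radius smaller than the distance of the estimator
from `t`, then the score at `t` is large. -/
theorem curvature_mul_le_scoreNorm (hK : IsKernel K) (hρ : IsContrast ρ g) (hn : 0 < n)
    (hh : 0 < h) (hfit : KernelFits K x₀ h) {M c : ℝ} {θ : Sample d n → multiIdx d b → ℝ}
    (hθ : IsLPAMinimizer ρ K x₀ M h θ) (f : (Fin d → ℝ) → ℝ) {t : multiIdx d b → ℝ}
    (ht : t ∈ paramSet d b M) {ω : Sample d n} {s : ℝ} (hs : 0 < s)
    (hsR : s < Real.sqrt (∑ p, (θ (observe f ω) p - t p) ^ 2))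
    (hω : ω ∉ flatSet b n ρ K x₀ c h (approxError f x₀ h t) s) :
    c * minEigenvalue b K / 2 * (n * h ^ d) * s ≤
      Real.sqrt (multiIdx d b).card * scoreNorm b ρ K x₀ h (approxError f x₀ h t) ω := by
  set u := approxError f x₀ h t with hu
  set R := Real.sqrt (∑ p, (θ (observe f ω) p - t p) ^ 2) with hR
  have hR0 : 0 < R := hs.trans hsR
  set w : multiIdx d b → ℝ := fun p => (θ (observe f ω) p - t p) / R with hw
  have hw2 : ∑ p, w p ^ 2 = 1 := by
    simp only [hw, div_pow]
    rw [← Finset.sum_div, hR, Real.sq_sqrt (Finset.sum_nonneg fun _ _ => sq_nonneg _), div_self]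
    intro h0
    rw [hR, h0, Real.sqrt_zero] at hR0
    exact lt_irrefl _ hR0
  have hθw : θ (observe f ω) = fun p => t p + R * w p := by
    funext p
    simp only [hw]
    field_simp
    ring
  obtain ⟨hθm, hθmin⟩ := hθ.2 (observe f ω)
  -- The parameter set is convex, and this point lies on the segment from `t` to the minimiser, at
  -- proportion `s / R`.
  have hmem : (fun p => t p + s * w p) ∈ paramSet d b M := by
    have hsR' : s / R ≤ 1 := (div_le_one hR0).2 hsR.le
    have h0 : 0 ≤ s / R := by positivity
    calc ∑ p, |t p + s * w p|
        = ∑ p, |(1 - s / R) * t p + s / R * θ (observe f ω) p| := by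
          refine Finset.sum_congr rfl fun p _ => ?_
          congr 1
          simp only [hw]
          ring
      _ ≤ ∑ p, ((1 - s / R) * |t p| + s / R * |θ (observe f ω) p|) := by
          refine Finset.sum_le_sum fun p _ => (abs_add_le _ _).trans ?_
          rw [abs_mul, abs_mul, abs_of_nonneg h0, abs_of_nonneg (sub_nonneg.2 hsR')]
      _ = (1 - s / R) * ∑ p, |t p| + s / R * ∑ p, |θ (observe f ω) p| := by
          rw [Finset.sum_add_distrib, Finset.mul_sum, Finset.mul_sum]
      _ ≤ (1 - s / R) * M + s / R * M := add_le_add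
          (mul_le_mul_of_nonneg_left ht (sub_nonneg.2 hsR')) (mul_le_mul_of_nonneg_left hθm h0)
      _ = M := by ring
  have hcrit := hθmin _ hmem
  rw [hθw, criterion_observe hK hh hfit, criterion_observe hK hh hfit] at hcrit
  have hN : (0 : ℝ) < n * h ^ d := by positivity
  have hcrit' := le_of_mul_le_mul_left hcrit (by positivity)
  set y : Fin n → ℝ := fun i => (ω i).2 + u (ω i).1 with hy
  set a : Fin n → ℝ := fun i => polyVal w (rescale x₀ h (ω i).1) with ha
  set k : Fin n → ℝ := fun i => K (rescale x₀ h (ω i).1) with hk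
  have hk0 : ∀ i, 0 ≤ k i := fun i => hK.nonneg _
  change ∑ i, ρ (y i - R * a i) * k i ≤ ∑ i, ρ (y i - s * a i) * k i at hcrit'
  -- The tangent line at radius `s` lies below the criterion at radius `R`, which by minimality is
  -- at most its value at `s`. Hence the slope at `s` in direction `w` is nonpositive; the sign
  -- flips because `ρ'` is evaluated at `y - s a`.
  have hgrad : 0 ≤ ∑ i, deriv ρ (y i - s * a i) * a i * k i := by
    have h1 : 0 ≤ (R - s) * ∑ i, deriv ρ (y i - s * a i) * a i * k i := by
      have h2 : ∑ i, (ρ (y i - s * a i) * k i - (R - s) * (deriv ρ (y i - s * a i) * a i * k i))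
          ≤ ∑ i, ρ (y i - R * a i) * k i := by
        refine Finset.sum_le_sum fun i _ => ?_
        have h3 := mul_le_mul_of_nonneg_right
          (hρ.add_deriv_mul_le (y i - s * a i) (y i - R * a i)) (hk0 i)
        linarith
      rw [Finset.sum_sub_distrib, ← Finset.mul_sum] at h2
      linarith
    exact nonneg_of_mul_nonneg_right h1 (sub_pos.2 hsR)
  have hcurv : c * minEigenvalue b K / 2 * (n * h ^ d) ≤ ∑ i, curvTerm ρ K x₀ h u s w (ω i) := by
    by_contra hlt
    exact hω ⟨w, hw2, not_le.1 hlt⟩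
  have hsum : (∑ i, curvTerm ρ K x₀ h u s w (ω i)) * s
      = ∑ i, deriv ρ (y i) * a i * k i - ∑ i, deriv ρ (y i - s * a i) * a i * k i := by
    rw [← Finset.sum_sub_distrib, Finset.sum_mul]
    refine Finset.sum_congr rfl fun i _ => ?_
    simp only [curvTerm, hy, ha, hk]
    field_simp
  have hscore : ∑ i, deriv ρ (y i) * a i * k i
      = ∑ p, w p * ∑ i, scoreTerm ρ K x₀ h u p.1 (ω i) := by
    simp_rw [Finset.mul_sum]
    rw [Finset.sum_comm]
    refine Finset.sum_congr rfl fun i _ => ?_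
    simp only [ha, polyVal, Finset.mul_sum, Finset.sum_mul, scoreTerm, hy, hk]
    exact Finset.sum_congr rfl fun p _ => by ring
  have hle : ∑ p, w p * ∑ i, scoreTerm ρ K x₀ h u p.1 (ω i)
      ≤ Real.sqrt (multiIdx d b).card * scoreNorm b ρ K x₀ h u ω := by
    calc ∑ p, w p * ∑ i, scoreTerm ρ K x₀ h u p.1 (ω i)
        ≤ ∑ p, |w p| * scoreNorm b ρ K x₀ h u ω := by
          refine Finset.sum_le_sum fun p _ => (le_abs_self _).trans ?_
          rw [abs_mul]
          exact mul_le_mul_of_nonneg_left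
            (norm_le_pi_norm (fun p : multiIdx d b => ∑ i, scoreTerm ρ K x₀ h u p.1 (ω i)) p)
            (abs_nonneg _)
      _ = (∑ p, |w p|) * scoreNorm b ρ K x₀ h u ω := by rw [Finset.sum_mul]
      _ ≤ _ := by
          have := sum_abs_le_sqrt_card hw2
          rw [Fintype.card_coe] at this
          exact mul_le_mul_of_nonneg_right this (norm_nonneg _)
  calc c * minEigenvalue b K / 2 * (n * h ^ d) * s
      ≤ (∑ i, curvTerm ρ K x₀ h u s w (ω i)) * s := mul_le_mul_of_nonneg_right hcurv hs.le
    _ ≤ _ := by rw [hsum, hscore]; linarith [hscore]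

/-- Control of the error of the estimator by the score, on samples with good curvature on a
dyadic grid of radii. -/
theorem estimator_error_le (hK : IsKernel K) (hρ : IsContrast ρ g) (hn : 0 < n)
    (hh : 0 < h) (hfit : KernelFits K x₀ h) {M c : ℝ} (hc : 0 < c) (hM : 0 < M)
    {θ : Sample d n → multiIdx d b → ℝ}
    (hθ : IsLPAMinimizer ρ K x₀ M h θ) (f : (Fin d → ℝ) → ℝ) {t : multiIdx d b → ℝ}
    (ht : t ∈ paramSet d b M) {ω : Sample d n} {τ η : ℝ} (hτ : 0 < τ) (hη : τ ≤ η)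
    (hω : ∀ j : ℕ, 2 ^ j * τ ≤ η →
      ω ∉ flatSet b n ρ K x₀ c h (approxError f x₀ h t) (2 ^ j * τ)) :
    (τ < |θ (observe f ω) (zeroIdx d b) - t (zeroIdx d b)| →
      c * minEigenvalue b K / 2 * τ ≤ Real.sqrt (multiIdx d b).card *
        (scoreNorm b ρ K x₀ h (approxError f x₀ h t) ω / (n * h ^ d))) ∧
    |θ (observe f ω) (zeroIdx d b) - t (zeroIdx d b)| ≤ τ +
      4 * (1 + 2 * M / η) * Real.sqrt (multiIdx d b).card / (c * minEigenvalue b K) *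
        (scoreNorm b ρ K x₀ h (approxError f x₀ h t) ω / (n * h ^ d)) := by
  set R := Real.sqrt (∑ p, (θ (observe f ω) p - t p) ^ 2) with hR
  set Z := |θ (observe f ω) (zeroIdx d b) - t (zeroIdx d b)| with hZ
  set W := scoreNorm b ρ K x₀ h (approxError f x₀ h t) ω with hW
  have hW0 : 0 ≤ W := norm_nonneg _
  have hη0 : 0 < η := hτ.trans_le hη
  have hN : (0 : ℝ) < n * h ^ d := by positivity
  have hl := minEigenvalue_pos hK b
  have hZR : Z ≤ R := by
    rw [hZ, hR]
    refine Real.abs_le_sqrt ?_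
    exact Finset.single_le_sum (f := fun p => (θ (observe f ω) p - t p) ^ 2)
      (fun _ _ => sq_nonneg _) (Finset.mem_univ _)
  have hRM : R ≤ 2 * M := by
    rw [hR]
    refine Real.sqrt_le_iff.2 ⟨by positivity, ?_⟩
    have h1 : ∑ p, |θ (observe f ω) p - t p| ≤ 2 * M := by
      calc ∑ p, |θ (observe f ω) p - t p| ≤ ∑ p, (|θ (observe f ω) p| + |t p|) :=
            Finset.sum_le_sum fun p _ => abs_sub _ _
        _ ≤ M + M := by
            rw [Finset.sum_add_distrib]
            exact add_le_add (hθ.2 (observe f ω)).1 ht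
        _ = 2 * M := by ring
    calc ∑ p, (θ (observe f ω) p - t p) ^ 2 = ∑ p, |θ (observe f ω) p - t p| ^ 2 := by
          simp_rw [sq_abs]
      _ ≤ (∑ p, |θ (observe f ω) p - t p|) ^ 2 :=
          Finset.sum_sq_le_sq_sum_of_nonneg fun _ _ => abs_nonneg _
      _ ≤ (2 * M) ^ 2 := pow_le_pow_left₀ (Finset.sum_nonneg fun _ _ => abs_nonneg _) h1 2
  have hkey : ∀ j : ℕ, 2 ^ j * τ ≤ η → 2 ^ j * τ < R →
      c * minEigenvalue b K / 2 * (2 ^ j * τ) ≤ Real.sqrt (multiIdx d b).card * (W / (n * h ^ d)) := by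
    intro j hj hjR
    have := curvature_mul_le_scoreNorm hK hρ hn hh hfit hθ f ht (by positivity) hjR (hω j hj)
    rw [mul_div_assoc', le_div_iff₀ hN]
    linarith
  refine ⟨fun hτZ => by simpa using hkey 0 (by simpa using hη) (by simpa using hτZ.trans_le hZR), ?_⟩
  by_cases hRτ : R ≤ τ
  · have : 0 ≤ 4 * (1 + 2 * M / η) * Real.sqrt (multiIdx d b).card / (c * minEigenvalue b K) *
        (W / (n * h ^ d)) := by positivity
    linarith
  · push Not at hRτ
    -- Curvature is available only up to radius `η`. Larger distances are truncated, at the price of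
    -- the factor `1 + 2M/η`, since `R ≤ 2M` in any case.
    set m := min R η with hm
    have hτm : τ ≤ m := le_min hRτ.le hη
    obtain ⟨j, hj1, hj2⟩ : ∃ j : ℕ, 2 ^ j * τ ≤ η ∧ 2 ^ j * τ < R ∧ m ≤ 2 * (2 ^ j * τ) := by
      -- For the least such `j`, the radius `2^j τ` is still admissible for the curvature bound (by
      -- minimality, or by `τ < R` and `τ ≤ η` when `j = 0`), and it is within a factor 2 of `m`.
      have hex : ∃ j : ℕ, m ≤ 2 ^ (j + 1) * τ := by
        obtain ⟨j, hj⟩ := pow_unbounded_of_one_lt (m / τ) (one_lt_two (α := ℝ))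
        refine ⟨j, ?_⟩
        rw [div_lt_iff₀ hτ] at hj
        rw [pow_succ]
        have : 0 < 2 ^ j * τ := by positivity
        linarith
      classical
      set j := Nat.find hex with hj
      have hspec := Nat.find_spec hex
      rw [← hj, pow_succ] at hspec
      refine ⟨j, ?_⟩
      have hlt : 2 ^ j * τ ≤ η ∧ 2 ^ j * τ < R := by
        rcases Nat.eq_zero_or_pos j with h0 | h0
        · rw [h0, pow_zero, one_mul]
          exact ⟨hη, hRτ⟩
        · have := Nat.find_min hex (Nat.sub_lt h0 one_pos)
          rw [not_le, ← hj, Nat.sub_add_cancel (show 1 ≤ j from h0)] at this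
          exact ⟨(this.trans_le (min_le_right _ _)).le, this.trans_le (min_le_left _ _)⟩
      exact ⟨hlt.1, hlt.2, by linarith⟩
    have h1 := hkey j hj1 hj2.1
    have h2 : R ≤ m * (1 + 2 * M / η) := by
      rcases le_total R η with hle | hle
      · rw [hm, min_eq_left hle]
        have : 0 ≤ R * (2 * M / η) := mul_nonneg (Real.sqrt_nonneg _) (by positivity)
        linarith
      · rw [hm, min_eq_right hle, mul_add, mul_div_cancel₀ _ hη0.ne']
        linarith
    have h3 : c * minEigenvalue b K * m ≤ 4 * (Real.sqrt (multiIdx d b).card * (W / (n * h ^ d))) := by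
      have := mul_le_mul_of_nonneg_left hj2.2 (mul_pos hc hl).le
      linarith
    have h4 : m ≤ 4 * (Real.sqrt (multiIdx d b).card * (W / (n * h ^ d))) /
        (c * minEigenvalue b K) := by
      rw [le_div_iff₀ (mul_pos hc hl)]
      linarith
    have h5 : 0 ≤ 1 + 2 * M / η := by positivity
    calc Z ≤ m * (1 + 2 * M / η) := hZR.trans h2
      _ ≤ 4 * (Real.sqrt (multiIdx d b).card * (W / (n * h ^ d))) /
        (c * minEigenvalue b K) * (1 + 2 * M / η) := mul_le_mul_of_nonneg_right h4 h5
      _ ≤ _ := by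
        have e : 4 * (Real.sqrt (multiIdx d b).card * (W / (n * h ^ d))) /
          (c * minEigenvalue b K) * (1 + 2 * M / η) = 4 * (1 + 2 * M / η) *
          Real.sqrt (multiIdx d b).card / (c * minEigenvalue b K) * (W / (n * h ^ d)) := by ring
        rw [e]
        linarith

end Estimator

/-! ### Lepski's rule -/

/-- Either the selected index is at most the oracle index, and the selected estimator is close to
the oracle; or some estimator with a smaller bandwidth has a large error. -/
theorem lepski_alternative {e S : ℕ → ℝ} {a C : ℝ} (hC : 0 ≤ C) {kL ks : ℕ} (hks : ks ≤ kL)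
    (hS : MonotoneOn S (Set.Iic kL)) {k : ℕ}
    (hk : k = sInf {k : ℕ | k ≤ kL ∧ ∀ l, k + 1 ≤ l → l ≤ kL → |e k - e l| ≤ C * S l})
    (hS0 : 0 ≤ S ks) :
    |e k - a| ≤ C * S ks + |e ks - a| ∨
      (ks < k ∧ k ≤ kL ∧ ∃ l, k ≤ l + 1 ∧ l ≤ kL ∧ ks ≤ l ∧ C / 2 * S l < |e l - a|) := by
  -- The last index always qualifies, its condition being empty, so the infimum is not the default
  -- value of `sInf`.
  have hne : {k : ℕ | k ≤ kL ∧ ∀ l, k + 1 ≤ l → l ≤ kL → |e k - e l| ≤ C * S l}.Nonempty :=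
    ⟨kL, le_rfl, fun l h1 h2 => by omega⟩
  have hmem := Nat.sInf_mem hne
  rw [← hk] at hmem
  rcases le_or_gt k ks with hle | hlt
  · left
    rcases hle.eq_or_lt with rfl | hlt
    · have := mul_nonneg hC hS0
      linarith
    · have := hmem.2 ks hlt hks
      have := abs_sub_le (e k) (e ks) a
      linarith
  · right
    refine ⟨hlt, hmem.1, ?_⟩
    -- The predecessor `k - 1 ≥ ks` was rejected by a comparison with some `l ≥ k`. A gap above `C S
    -- l` means that one of the two estimators errs by more than half of it.
    have hnot : k - 1 ∉ {k : ℕ | k ≤ kL ∧ ∀ l, k + 1 ≤ l → l ≤ kL → |e k - e l| ≤ C * S l} :=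
      Nat.notMem_of_lt_sInf (by omega)
    have hkL := hmem.1
    have : ∃ l, k ≤ l ∧ l ≤ kL ∧ C * S l < |e (k - 1) - e l| := by
      by_contra! hcon
      exact hnot ⟨by omega, fun l h1 h2 => hcon l (by omega) h2⟩
    obtain ⟨l, hl1, hl2, hl3⟩ := this
    by_cases hb : C / 2 * S l < |e l - a|
    · exact ⟨l, by omega, hl2, by omega, hb⟩
    · refine ⟨k - 1, by omega, by omega, by omega, ?_⟩
      have h1 := abs_sub_le (e (k - 1)) a (e l)
      rw [abs_sub_comm a (e l)] at h1
      have h2 : S (k - 1) ≤ S l := hS (show k - 1 ≤ kL by omega) hl2 (by omega)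
      have h3 := mul_le_mul_of_nonneg_left h2 (show 0 ≤ C / 2 by positivity)
      linarith

theorem exists_one_add_rpow_le_exp (q : ℝ) :
    ∃ A > 0, ∀ y : ℝ, 0 ≤ y → (1 + y) ^ q ≤ A * Real.exp y := by
  set m := ⌈q⌉₊
  refine ⟨m.factorial * Real.exp 1, by positivity, fun y hy => ?_⟩
  calc (1 + y) ^ q ≤ (1 + y) ^ (m : ℝ) :=
        Real.rpow_le_rpow_of_exponent_le (by linarith) (Nat.le_ceil q)
    _ = (1 + y) ^ m := Real.rpow_natCast _ _
    _ ≤ m.factorial * Real.exp (1 + y) := by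
        have := Real.pow_div_factorial_le_exp (1 + y) (by linarith) m
        rw [div_le_iff₀ (by positivity)] at this
        linarith
    _ = _ := by rw [Real.exp_add]; ring

/-- The growth `2^{(l+1) d r/2}` against the decay `2^{-rdl}` leaves `2^{-rdl/2}`, which is at most
`2^{-l/2}` because `r d ≥ 1`. This dominates every polynomial factor. -/
theorem summable_lepski_weights {d : ℕ} (hd : 0 < d) {r : ℝ} (hr : 1 ≤ r) :
    Summable fun l : ℕ => ((l : ℝ) + 2) *
      (((l : ℝ) + 2) * 2 ^ ((l + 1) * d)) ^ (r / 2) * (2 : ℝ) ^ (-(r * d * l)) := by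
  set m := ⌈r / 2⌉₊ with hm
  set z : ℝ := (2 : ℝ) ^ (-(1 / 2) : ℝ) with hz
  have hz0 : 0 < z := by positivity
  have hz1 : z < 1 := Real.rpow_lt_one_of_one_lt_of_neg one_lt_two (by norm_num)
  have hd1 : (1 : ℝ) ≤ d := by exact_mod_cast hd
  have hs0 := summable_pow_mul_geometric_of_norm_lt_one (R := ℝ) (m + 1) (r := z)
    (by rwa [Real.norm_eq_abs, abs_of_pos hz0])
  have hs := ((summable_nat_add_iff 2).2 hs0).mul_left ((2 : ℝ) ^ (r * d / 2) * z⁻¹ ^ 2)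
  refine Summable.of_nonneg_of_le (fun l => by positivity) (fun l => ?_) hs
  have hl0 : (0 : ℝ) ≤ l := Nat.cast_nonneg l
  have h1 : (((l : ℝ) + 2) * 2 ^ ((l + 1) * d)) ^ (r / 2)
      ≤ ((l : ℝ) + 2) ^ m * (2 : ℝ) ^ (((l : ℝ) + 1) * d * (r / 2)) := by
    rw [Real.mul_rpow (by positivity) (by positivity), ← Real.rpow_natCast 2 ((l + 1) * d),
      ← Real.rpow_mul zero_le_two, ← Real.rpow_natCast _ m]
    push_cast
    gcongr
    · linarith
    · exact Nat.le_ceil _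
  have h2 : (2 : ℝ) ^ (((l : ℝ) + 1) * d * (r / 2)) * (2 : ℝ) ^ (-(r * d * l))
      ≤ (2 : ℝ) ^ (r * d / 2) * z ^ l := by
    rw [← Real.rpow_add two_pos, ← Real.rpow_natCast z l, hz, ← Real.rpow_mul zero_le_two,
      ← Real.rpow_add two_pos]
    refine Real.rpow_le_rpow_of_exponent_le one_le_two ?_
    have : (1 : ℝ) ≤ r * d := one_le_mul_of_one_le_of_one_le hr hd1
    nlinarith
  calc ((l : ℝ) + 2) * (((l : ℝ) + 2) * 2 ^ ((l + 1) * d)) ^ (r / 2) * (2 : ℝ) ^ (-(r * d * l))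
      ≤ ((l : ℝ) + 2) * (((l : ℝ) + 2) ^ m * (2 : ℝ) ^ (((l : ℝ) + 1) * d * (r / 2))) *
          (2 : ℝ) ^ (-(r * d * l)) := by gcongr
    _ = ((l : ℝ) + 2) ^ (m + 1) * ((2 : ℝ) ^ (((l : ℝ) + 1) * d * (r / 2)) *
          (2 : ℝ) ^ (-(r * d * l))) := by ring
    _ ≤ ((l : ℝ) + 2) ^ (m + 1) * ((2 : ℝ) ^ (r * d / 2) * z ^ l) := by gcongr
    _ = (2 : ℝ) ^ (r * d / 2) * z⁻¹ ^ 2 * (((l + 2 : ℕ) : ℝ) ^ (m + 1) * z ^ (l + 2)) := by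
        push_cast
        rw [pow_add z l 2, inv_pow]
        field_simp

/-- Integration of the pointwise bounds given by Lepski's rule. -/
theorem exists_lepski_risk_le {d : ℕ} (hd : 0 < d) {r : ℝ} (hr : 1 ≤ r) {D P Q : ℝ} (hD : 0 ≤ D)
    (hP : 0 ≤ P) (hQ : 0 ≤ Q) : ∃ B ≥ 0, ∀ (Ω : Type) [MeasurableSpace Ω] (μ : Measure Ω)
      (kL ks : ℕ) (S x : ℕ → ℝ) (W : ℕ → Ω → ℝ) (Z : Ω → ℝ) (bad : Set Ω) (M : ℝ),
      ks ≤ kL → (∀ k, 0 < S k) →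
      (∀ k, ks ≤ k → S k ≤ S ks * Real.sqrt ((1 + k) * 2 ^ (k * d))) →
      (∀ k, Measurable (W k)) → (∀ k ω, 0 ≤ W k ω) → (∀ ω, 0 ≤ Z ω) → (∀ ω, Z ω ≤ M) →
      (∀ l, ks ≤ l → l ≤ kL →
        μ {ω | x l ≤ W l ω} ≤ ENNReal.ofReal (P * ((2 : ℝ) ^ (-(r * d * l))) ^ 2)) →
      (∀ l, ks ≤ l → l ≤ kL →
        ∫⁻ ω, ENNReal.ofReal (Real.exp (W l ω / S l)) ∂μ ≤ ENNReal.ofReal Q) →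
      (∀ ω ∉ bad, Z ω ≤ D * S ks * (1 + W ks ω / S ks) ∨ ∃ k l, ks < k ∧ k ≤ kL ∧ k ≤ l + 1 ∧
        ks ≤ l ∧ l ≤ kL ∧ x l ≤ W l ω ∧ Z ω ≤ D * S k * (1 + W k ω / S k)) →
      ∫⁻ ω, ENNReal.ofReal (Z ω ^ r) ∂μ
        ≤ ENNReal.ofReal (B * S ks ^ r) + ENNReal.ofReal (M ^ r) * μ bad := by
  obtain ⟨A₁, hA₁, hexp₁⟩ := exists_one_add_rpow_le_exp r
  obtain ⟨A₂, hA₂, hexp₂⟩ := exists_one_add_rpow_le_exp (2 * r)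
  have hr0 : 0 ≤ r := by linarith
  -- This is the square root of the tail weight; half of the exponential decay is given up when a
  -- moment is restricted to the tail event.
  set q : ℕ → ℝ := fun l => (2 : ℝ) ^ (-(r * d * l)) with hq
  have hq0 : ∀ l, 0 < q l := fun l => by positivity
  set σ : ℕ → ℝ := fun l => ((l : ℝ) + 2) *
      (((l : ℝ) + 2) * 2 ^ ((l + 1) * d)) ^ (r / 2) * q l with hσ
  have hσs : Summable σ := summable_lepski_weights hd hr
  have hσ0 : ∀ l, 0 ≤ σ l := fun l => by positivity
  refine ⟨D ^ r * (A₁ * Q) + D ^ r * (A₂ * Q + P) * ∑' l, σ l,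
    add_nonneg (by positivity) (mul_nonneg (by positivity) (tsum_nonneg hσ0)), ?_⟩
  intro Ω _ μ kL ks S x W Z bad M hks hS hSk hWm hW0 hZ0 hZM hPx hQx hpt
  have hM0 : ∀ ω, Z ω ^ r ≤ M ^ r := fun ω => Real.rpow_le_rpow (hZ0 ω) (hZM ω) hr0
  set I : ℕ → Finset ℕ := fun l => (Finset.range (l + 2)).filter fun k =>
    ks < k ∧ k ≤ kL ∧ ks ≤ l with hI
  set E : ℕ → Ω → ℝ≥0∞ := fun k ω => ENNReal.ofReal (Real.exp (W k ω / S k)) with hE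
  have hEm : ∀ k, Measurable (E k) := fun k => ((hWm k).div_const _).exp.ennreal_ofReal
  set a₀ : ℝ := D ^ r * S ks ^ r * A₁ with ha₀
  set a₁ : ℕ → ℕ → ℝ := fun l k => D ^ r * S k ^ r * (q l * A₂) with ha₁
  set a₂ : ℕ → ℕ → ℝ := fun l k => D ^ r * S k ^ r * (q l)⁻¹ with ha₂
  have hSr : ∀ k, 0 ≤ S k ^ r := fun k => Real.rpow_nonneg (hS k).le r
  have ha₀' : 0 ≤ a₀ := mul_nonneg (mul_nonneg (by positivity) (hSr _)) hA₁.le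
  have ha₁' : ∀ l k, 0 ≤ a₁ l k := fun l k =>
    mul_nonneg (mul_nonneg (by positivity) (hSr _)) (mul_nonneg (hq0 l).le hA₂.le)
  have ha₂' : ∀ l k, 0 ≤ a₂ l k := fun l k =>
    mul_nonneg (mul_nonneg (by positivity) (hSr _)) (inv_nonneg.2 (hq0 l).le)
  set G : ℕ → ℕ → Ω → ℝ≥0∞ := fun l k ω => ENNReal.ofReal (a₁ l k) * E k ω +
    {ω | x l ≤ W l ω}.indicator (fun _ => ENNReal.ofReal (a₂ l k)) ω with hG
  have hAm : ∀ l, MeasurableSet {ω | x l ≤ W l ω} := fun l =>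
    measurableSet_le measurable_const (hWm l)
  have hGm : ∀ l k, Measurable (G l k) := fun l k =>
    ((hEm k).const_mul _).add (measurable_const.indicator (hAm l))
  have hexpand : ∀ k ω, Z ω ≤ D * S k * (1 + W k ω / S k) →
      Z ω ^ r ≤ D ^ r * S k ^ r * (1 + W k ω / S k) ^ r := fun k ω hk => by
    have h1 : 0 ≤ 1 + W k ω / S k := add_nonneg zero_le_one (div_nonneg (hW0 k ω) (hS k).le)
    rw [← Real.mul_rpow hD (hS k).le, ← Real.mul_rpow (mul_nonneg hD (hS k).le) h1]
    exact Real.rpow_le_rpow (hZ0 ω) hk hr0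
  have hpoint : ∀ ω, ENNReal.ofReal (Z ω ^ r) ≤ (ENNReal.ofReal a₀ * E ks ω +
      ∑ l ∈ Finset.range (kL + 1), ∑ k ∈ I l, G l k ω) +
        bad.indicator (fun _ => ENNReal.ofReal (M ^ r)) ω := by
    intro ω
    by_cases hb : ω ∈ bad
    · rw [Set.indicator_of_mem hb]
      exact le_add_left (ENNReal.ofReal_le_ofReal (hM0 ω))
    refine le_add_right ?_
    rcases hpt ω hb with h1 | ⟨k, l, hk1, hk2, hkl, hl1, hl2, hx, h1⟩
    · refine le_add_right ?_
      rw [hE, ← ENNReal.ofReal_mul ha₀']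
      refine ENNReal.ofReal_le_ofReal ((hexpand ks ω h1).trans ?_)
      rw [ha₀, mul_assoc _ A₁]
      exact mul_le_mul_of_nonneg_left (hexp₁ _ (div_nonneg (hW0 ks ω) (hS ks).le))
        (mul_nonneg (by positivity) (hSr _))
    · refine le_add_left ?_
      have hkI : k ∈ I l := by
        simp only [hI, Finset.mem_filter, Finset.mem_range]
        omega
      refine le_trans ?_ (Finset.single_le_sum (f := fun l => ∑ k ∈ I l, G l k ω)
        (fun _ _ => zero_le) (Finset.mem_range.2 (Nat.lt_succ_of_le hl2)))
      refine le_trans ?_ (Finset.single_le_sum (f := fun k => G l k ω)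
        (fun _ _ => zero_le) hkI)
      simp only [hG, hE]
      rw [Set.indicator_of_mem (show ω ∈ {ω | x l ≤ W l ω} from hx),
        ← ENNReal.ofReal_mul (ha₁' l k), ← ENNReal.ofReal_add
          (mul_nonneg (ha₁' l k) (Real.exp_pos _).le) (ha₂' l k)]
      refine ENNReal.ofReal_le_ofReal ((hexpand k ω h1).trans ?_)
      set y := W k ω / S k with hy
      have hy0 : 0 ≤ y := div_nonneg (hW0 k ω) (hS k).le
      -- Completing the square replaces the Cauchy–Schwarz inequality. On the tail event the first
      -- summand integrates to order `q l`, and the second to `(q l)⁻¹` times a probability of order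
      -- `(q l)²`.
      have h2 : (1 + y) ^ r ≤ q l * ((1 + y) ^ r) ^ 2 + (q l)⁻¹ := by
        set v := (1 + y) ^ r
        have h3 : 0 ≤ (q l)⁻¹ * (q l * v - 1) ^ 2 :=
          mul_nonneg (inv_nonneg.2 (hq0 l).le) (sq_nonneg _)
        have h4 : (q l)⁻¹ * (q l * v - 1) ^ 2 = q l * v ^ 2 - 2 * v + (q l)⁻¹ := by
          have := (hq0 l).ne'
          field_simp
          ring
        have h5 : 0 ≤ v := by positivity
        linarith
      have h6 : ((1 + y) ^ r) ^ 2 ≤ A₂ * Real.exp y := by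
        have := hexp₂ y hy0
        rwa [mul_comm 2 r, Real.rpow_mul (by positivity), Real.rpow_two] at this
      have h7 : (1 + y) ^ r ≤ q l * A₂ * Real.exp y + (q l)⁻¹ := by
        have := mul_le_mul_of_nonneg_left h6 (hq0 l).le
        linarith
      calc D ^ r * S k ^ r * (1 + y) ^ r
          ≤ D ^ r * S k ^ r * (q l * A₂ * Real.exp y + (q l)⁻¹) :=
            mul_le_mul_of_nonneg_left h7 (mul_nonneg (by positivity) (hSr _))
        _ = _ := by simp only [ha₁, ha₂]; ring
  have hGint : ∀ l ∈ Finset.range (kL + 1), ∀ k ∈ I l, ∫⁻ ω, G l k ω ∂μ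
      ≤ ENNReal.ofReal (S ks ^ r * (D ^ r * (A₂ * Q + P)) *
        ((((l : ℝ) + 2) * 2 ^ ((l + 1) * d)) ^ (r / 2) * q l)) := by
    intro l hl k hk
    simp only [hI, Finset.mem_filter, Finset.mem_range] at hk hl
    obtain ⟨hk0, hk1, hk2, hk3⟩ := hk
    have hSle : S k ^ r ≤ S ks ^ r * (((l : ℝ) + 2) * 2 ^ ((l + 1) * d)) ^ (r / 2) := by
      have h1 : S k ≤ S ks * Real.sqrt (((l : ℝ) + 2) * 2 ^ ((l + 1) * d)) := by
        refine (hSk k hk1.le).trans (mul_le_mul_of_nonneg_left (Real.sqrt_le_sqrt ?_) (hS ks).le)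
        have hkl : (k : ℝ) ≤ l + 1 := by exact_mod_cast Nat.lt_succ_iff.1 hk0
        have h2 : (2 : ℝ) ^ (k * d) ≤ 2 ^ ((l + 1) * d) :=
          pow_le_pow_right₀ one_le_two (Nat.mul_le_mul_right d (Nat.lt_succ_iff.1 hk0))
        exact mul_le_mul (by linarith) h2 (by positivity) (by positivity)
      refine (Real.rpow_le_rpow (hS k).le h1 hr0).trans (le_of_eq ?_)
      rw [Real.mul_rpow (hS ks).le (Real.sqrt_nonneg _), Real.sqrt_eq_rpow,
        ← Real.rpow_mul (by positivity)]
      congr 2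
      ring
    calc ∫⁻ ω, G l k ω ∂μ
        = ENNReal.ofReal (a₁ l k) * ∫⁻ ω, E k ω ∂μ + ENNReal.ofReal (a₂ l k) *
            μ {ω | x l ≤ W l ω} := by
          simp only [hG]
          rw [lintegral_add_left ((hEm k).const_mul _), lintegral_const_mul _ (hEm k),
            lintegral_indicator_const (hAm l)]
      _ ≤ ENNReal.ofReal (a₁ l k) * ENNReal.ofReal Q + ENNReal.ofReal (a₂ l k) *
            ENNReal.ofReal (P * q l ^ 2) := by
          gcongr
          · exact hQx k hk1.le hk2
          · exact hPx l hk3 (Nat.lt_succ_iff.1 hl)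
      _ = ENNReal.ofReal (a₁ l k * Q + a₂ l k * (P * q l ^ 2)) := by
          rw [← ENNReal.ofReal_mul (ha₁' l k), ← ENNReal.ofReal_mul (ha₂' l k),
            ENNReal.ofReal_add (mul_nonneg (ha₁' l k) hQ)
              (mul_nonneg (ha₂' l k) (by positivity))]
      _ = ENNReal.ofReal (S k ^ r * (D ^ r * (A₂ * Q + P)) * q l) := by
          congr 1
          simp only [ha₁, ha₂]
          have := (hq0 l).ne'
          field_simp
      _ ≤ _ := by
          refine ENNReal.ofReal_le_ofReal ?_
          have h3 : 0 ≤ D ^ r * (A₂ * Q + P) * q l := by positivity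
          calc S k ^ r * (D ^ r * (A₂ * Q + P)) * q l = S k ^ r * (D ^ r * (A₂ * Q + P) * q l) := by
                ring
            _ ≤ _ := mul_le_mul_of_nonneg_right hSle h3
            _ = _ := by ring
  have hsum : ∑ l ∈ Finset.range (kL + 1), ∑ k ∈ I l, ∫⁻ ω, G l k ω ∂μ
      ≤ ENNReal.ofReal (S ks ^ r * (D ^ r * (A₂ * Q + P)) * ∑' l, σ l) := by
    have hco : 0 ≤ S ks ^ r * (D ^ r * (A₂ * Q + P)) := mul_nonneg (hSr _) (by positivity)
    calc ∑ l ∈ Finset.range (kL + 1), ∑ k ∈ I l, ∫⁻ ω, G l k ω ∂μ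
        ≤ ∑ l ∈ Finset.range (kL + 1),
            ENNReal.ofReal (S ks ^ r * (D ^ r * (A₂ * Q + P)) * σ l) := by
          refine Finset.sum_le_sum fun l hl => (Finset.sum_le_sum (hGint l hl)).trans ?_
          rw [Finset.sum_const, nsmul_eq_mul, ← ENNReal.ofReal_natCast,
            ← ENNReal.ofReal_mul (Nat.cast_nonneg _)]
          refine ENNReal.ofReal_le_ofReal ?_
          have hcard : ((I l).card : ℝ) ≤ l + 2 := by
            have : (I l).card ≤ l + 2 := (Finset.card_filter_le _ _).trans (by simp)
            exact_mod_cast this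
          calc ((I l).card : ℝ) * (S ks ^ r * (D ^ r * (A₂ * Q + P)) *
                ((((l : ℝ) + 2) * 2 ^ ((l + 1) * d)) ^ (r / 2) * q l))
              ≤ ((l : ℝ) + 2) * (S ks ^ r * (D ^ r * (A₂ * Q + P)) *
                ((((l : ℝ) + 2) * 2 ^ ((l + 1) * d)) ^ (r / 2) * q l)) :=
                mul_le_mul_of_nonneg_right hcard (mul_nonneg hco (by positivity))
            _ = _ := by simp only [hσ]; ring
      _ = ENNReal.ofReal (∑ l ∈ Finset.range (kL + 1),
            S ks ^ r * (D ^ r * (A₂ * Q + P)) * σ l) :=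
          (ENNReal.ofReal_sum_of_nonneg fun l _ => mul_nonneg hco (hσ0 l)).symm
      _ ≤ _ := by
          refine ENNReal.ofReal_le_ofReal ?_
          rw [← Finset.mul_sum]
          exact mul_le_mul_of_nonneg_left (hσs.sum_le_tsum _ fun l _ => hσ0 l) hco
  have hmain : Measurable fun ω => ENNReal.ofReal a₀ * E ks ω +
      ∑ l ∈ Finset.range (kL + 1), ∑ k ∈ I l, G l k ω :=
    ((hEm ks).const_mul _).add (Finset.measurable_fun_sum _ fun l _ =>
      Finset.measurable_fun_sum _ fun k _ => hGm l k)
  calc ∫⁻ ω, ENNReal.ofReal (Z ω ^ r) ∂μ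
      ≤ ∫⁻ ω, ((ENNReal.ofReal a₀ * E ks ω +
          ∑ l ∈ Finset.range (kL + 1), ∑ k ∈ I l, G l k ω) +
          bad.indicator (fun _ => ENNReal.ofReal (M ^ r)) ω) ∂μ := lintegral_mono hpoint
    _ ≤ (ENNReal.ofReal a₀ * ∫⁻ ω, E ks ω ∂μ +
          ∑ l ∈ Finset.range (kL + 1), ∑ k ∈ I l, ∫⁻ ω, G l k ω ∂μ) +
          ENNReal.ofReal (M ^ r) * μ bad := by
        rw [lintegral_add_left hmain, lintegral_add_left ((hEm ks).const_mul _),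
          lintegral_const_mul _ (hEm ks), lintegral_finsetSum _ fun l _ =>
            Finset.measurable_fun_sum _ fun k _ => hGm l k]
        -- Only an inequality is available for the last term, as `bad` is not assumed measurable.
        refine add_le_add (le_of_eq ?_) (lintegral_indicator_const_le _ _)
        congr 1
        exact Finset.sum_congr rfl fun l _ => lintegral_finsetSum _ fun k _ => hGm l k
    _ ≤ (ENNReal.ofReal a₀ * ENNReal.ofReal Q +
          ENNReal.ofReal (S ks ^ r * (D ^ r * (A₂ * Q + P)) * ∑' l, σ l)) +
          ENNReal.ofReal (M ^ r) * μ bad := by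
        gcongr
        exact hQx ks le_rfl hks
    _ = _ := by
        congr 1
        rw [← ENNReal.ofReal_mul ha₀', ← ENNReal.ofReal_add (mul_nonneg ha₀' hQ)
          (mul_nonneg (mul_nonneg (hSr _) (by positivity)) (tsum_nonneg hσ0))]
        congr 1
        rw [ha₀]
        ring

/-! ### Bandwidths and rates -/

section Rates

variable {d b n : ℕ}

theorem hMax_pos (d b : ℕ) (hn : 0 < n) : 0 < hMax d b n :=
  Real.rpow_pos_of_pos (by exact_mod_cast hn) _

theorem hMax_le_one (d b : ℕ) (hn : 0 < n) : hMax d b n ≤ 1 :=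
  Real.rpow_le_one_of_one_le_of_nonpos (by exact_mod_cast hn) (by
    rw [neg_nonpos]; positivity)

theorem bandwidth_pos (d b : ℕ) (hn : 0 < n) (k : ℕ) : 0 < bandwidth d b n k :=
  div_pos (hMax_pos d b hn) (by positivity)

theorem bandwidth_anti (d b n : ℕ) : Antitone (bandwidth d b n) := by
  intro k l hkl
  unfold bandwidth
  have h0 : 0 ≤ hMax d b n := Real.rpow_nonneg (Nat.cast_nonneg n) _
  exact div_le_div_of_nonneg_left h0 (by positivity) (pow_le_pow_right₀ one_le_two hkl)

theorem bandwidth_le_hMax (d b n k : ℕ) : bandwidth d b n k ≤ hMax d b n := by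
  have := bandwidth_anti d b n (Nat.zero_le k)
  simpa [bandwidth] using this

theorem bandwidth_le_one (d b : ℕ) (hn : 0 < n) (k : ℕ) : bandwidth d b n k ≤ 1 :=
  (bandwidth_le_hMax d b n k).trans (hMax_le_one d b hn)

theorem one_le_one_add_mul_log (k : ℕ) : 1 ≤ 1 + (k : ℝ) * Real.log 2 := by
  have := mul_nonneg (Nat.cast_nonneg (α := ℝ) k) (Real.log_nonneg one_le_two)
  linarith

theorem stdBound_pos (d b : ℕ) (hn : 0 < n) (k : ℕ) : 0 < stdBound d b n k := by
  have h1 := bandwidth_pos d b hn k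
  have h2 := one_le_one_add_mul_log k
  exact Real.sqrt_pos.2 (div_pos (by linarith) (by positivity))

theorem stdBound_sq (d b : ℕ) (hn : 0 < n) (k : ℕ) :
    stdBound d b n k ^ 2 = (1 + k * Real.log 2) / (n * bandwidth d b n k ^ d) := by
  have h1 := bandwidth_pos d b hn k
  have h2 := one_le_one_add_mul_log k
  exact Real.sq_sqrt (div_nonneg (by linarith) (by positivity))

theorem stdBound_mono (d b : ℕ) (hn : 0 < n) : Monotone (stdBound d b n) := by
  intro k l hkl
  refine Real.sqrt_le_sqrt ?_
  have h1 := bandwidth_pos d b hn l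
  have h2 := bandwidth_anti d b n hkl
  have h3 := one_le_one_add_mul_log k
  have h4 : (k : ℝ) ≤ l := by exact_mod_cast hkl
  have h5 := Real.log_nonneg (one_le_two (α := ℝ))
  gcongr

/-- Every `S_n(ks)²` is at least `1/(n h_max^d)`, so the growth of `S_n(k)` may be measured from the
top of the grid. This is crude but independent of `ks`, and the decay of the tail weights absorbs
it. -/
theorem stdBound_le_mul (d b : ℕ) (hn : 0 < n) (ks k : ℕ) :
    stdBound d b n k ≤ stdBound d b n ks * Real.sqrt ((1 + k) * 2 ^ (k * d)) := by
  have hm := hMax_pos d b hn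
  have h0 : 1 / (n * hMax d b n ^ d) ≤ stdBound d b n ks ^ 2 := by
    rw [stdBound_sq d b hn]
    have h1 := bandwidth_pos d b hn ks
    have h2 := bandwidth_le_hMax d b n ks
    have h3 := one_le_one_add_mul_log ks
    gcongr
  refine Real.sqrt_le_iff.2 ⟨mul_nonneg (stdBound_pos d b hn ks).le (Real.sqrt_nonneg _), ?_⟩
  rw [mul_pow, Real.sq_sqrt (by positivity)]
  have hlog : Real.log 2 ≤ 1 := by linarith [Real.log_two_lt_d9]
  have hk0 : (0 : ℝ) ≤ k := Nat.cast_nonneg k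
  calc (1 + k * Real.log 2) / (n * bandwidth d b n k ^ d)
      = 1 / (n * hMax d b n ^ d) * ((1 + k * Real.log 2) * 2 ^ (k * d)) := by
        unfold bandwidth
        rw [div_pow, ← pow_mul]
        have : (0 : ℝ) < n := by exact_mod_cast hn
        field_simp
    _ ≤ stdBound d b n ks ^ 2 * ((1 + k) * 2 ^ (k * d)) := by
        have : 1 + (k : ℝ) * Real.log 2 ≤ 1 + k := by nlinarith
        have h3 := one_le_one_add_mul_log k
        gcongr

theorem one_div_le_stdBound (d b : ℕ) (hn : 0 < n) (k : ℕ) : 1 / (n : ℝ) ≤ stdBound d b n k := by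
  have hn1 : (1 : ℝ) ≤ n := by exact_mod_cast hn
  refine Real.le_sqrt_of_sq_le ?_
  have h1 := bandwidth_pos d b hn k
  have h2 := pow_le_one₀ h1.le (bandwidth_le_one d b hn k) (n := d)
  have h3 := one_le_one_add_mul_log k
  rw [div_pow, one_pow]
  have h4 : (n : ℝ) * bandwidth d b n k ^ d ≤ n ^ 2 := by nlinarith
  gcongr

theorem hMin_pow (hd : 0 < d) (hn : 1 ≤ n) : hMin d n ^ d = Real.log n ^ 2 / n := by
  have hl : 0 ≤ Real.log n := Real.log_natCast_nonneg n
  have hn0 : (0 : ℝ) < n := by exact_mod_cast hn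
  have hd0 : (d : ℝ) ≠ 0 := by positivity
  unfold hMin
  rw [mul_pow, ← Real.rpow_natCast, ← Real.rpow_natCast, ← Real.rpow_mul hl,
    ← Real.rpow_mul hn0.le, div_mul_cancel₀ _ hd0, neg_mul, one_div_mul_cancel hd0,
    Real.rpow_neg_one, Real.rpow_two, div_eq_mul_inv]

theorem one_div_le_hMin (hd : 0 < d) (hn : 1 ≤ n) (hlog : 1 ≤ Real.log n) :
    1 / (n : ℝ) ≤ hMin d n := by
  have hn1 : (1 : ℝ) ≤ n := by exact_mod_cast hn
  have hd1 : (1 : ℝ) ≤ d := by exact_mod_cast hd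
  have h1 : (1 : ℝ) ≤ Real.log n ^ (2 / d : ℝ) := Real.one_le_rpow hlog (by positivity)
  have h2 : (n : ℝ) ^ (-1 : ℝ) ≤ (n : ℝ) ^ (-(1 / d) : ℝ) := by
    refine Real.rpow_le_rpow_of_exponent_le hn1 (neg_le_neg ?_)
    rw [div_le_one (by linarith)]
    exact hd1
  rw [Real.rpow_neg_one] at h2
  rw [one_div]
  exact h2.trans (le_mul_of_one_le_left (by positivity) h1)

theorem bddAbove_hMin_le (hd : 0 < d) (hn : 1 ≤ n) (hlog : 1 ≤ Real.log n) (b : ℕ) :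
    ∀ k ∈ {k : ℕ | hMin d n ≤ bandwidth d b n k}, (2 : ℝ) ^ k ≤ n := by
  intro k hk
  have h1 := (one_div_le_hMin hd hn hlog).trans hk
  have hn0 : (0 : ℝ) < n := by exact_mod_cast hn
  have h2 : 1 / (n : ℝ) ≤ 1 / 2 ^ k := h1.trans (by
    unfold bandwidth
    gcongr
    exact hMax_le_one d b hn)
  exact (one_div_le_one_div hn0 (by positivity)).1 h2

/-- The index `ks` makes the defining set nonempty and `2^k ≤ n` bounds it. Without both, `sSup`
would return the default 0; with them the supremum is a member, and the lower bound on bandwidths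
holds along the whole grid. -/
theorem kLast_facts (hd : 0 < d) (hn : 1 ≤ n) (hlog : 1 ≤ Real.log n) {ks : ℕ}
    (hks : hMin d n ≤ bandwidth d b n ks) :
    ks ≤ kLast d b n ∧ (2 : ℝ) ^ kLast d b n ≤ n ∧
      ∀ l ≤ kLast d b n, Real.log n ^ 2 ≤ n * bandwidth d b n l ^ d := by
  have hbdd := bddAbove_hMin_le hd hn hlog b
  have hn0 : (0 : ℝ) < n := by exact_mod_cast hn
  have hB : BddAbove {k : ℕ | hMin d n ≤ bandwidth d b n k} := ⟨n, fun k hk => by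
    have h1 := hbdd k hk
    have h2 : k < 2 ^ k := Nat.lt_two_pow_self
    have h3 : 2 ^ k ≤ n := by exact_mod_cast h1
    omega⟩
  have hmem : kLast d b n ∈ {k : ℕ | hMin d n ≤ bandwidth d b n k} := Nat.sSup_mem ⟨ks, hks⟩ hB
  refine ⟨le_csSup hB hks, hbdd _ hmem, fun l hl => ?_⟩
  have h1 : hMin d n ≤ bandwidth d b n l := le_trans hmem (bandwidth_anti d b n hl)
  have h0 : 0 ≤ hMin d n := (by positivity : (0 : ℝ) ≤ 1 / n).trans (one_div_le_hMin hd hn hlog)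
  have h2 := pow_le_pow_left₀ h0 h1 d
  rw [hMin_pow hd hn, div_le_iff₀ hn0] at h2
  linarith

/-- The numerator is at most `2 ln n` and `n h^d ≥ ln² n`. So all deviations tend to zero uniformly
over the grid, which brings the radii and exponential parameters used later into their admissible
ranges. -/
theorem kLast_stdBound_sq_le (hn : 1 ≤ n) (hlog : 1 ≤ Real.log n)
    (h2 : (2 : ℝ) ^ kLast d b n ≤ n)
    (hN : ∀ l ≤ kLast d b n, Real.log n ^ 2 ≤ n * bandwidth d b n l ^ d) :
    ∀ l ≤ kLast d b n, stdBound d b n l ^ 2 ≤ 2 / Real.log n := by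
  intro l hl
  rw [stdBound_sq d b hn]
  have h3 : (l : ℝ) * Real.log 2 ≤ Real.log n := by
    rw [← Real.log_pow]
    exact Real.log_le_log (by positivity) ((pow_le_pow_right₀ one_le_two hl).trans h2)
  have hl0 : 0 < Real.log n := by linarith
  calc (1 + l * Real.log 2) / (n * bandwidth d b n l ^ d)
      ≤ (2 * Real.log n) / Real.log n ^ 2 := by
        have := hN l hl
        have := one_le_one_add_mul_log l
        gcongr
        linarith
    _ = 2 / Real.log n := by field_simp

/-- The index balancing bias and standard deviation. -/
theorem exists_oracle_index (hd : 0 < d) (hb : 0 < b) {β B : ℝ} (hβ : 0 < β) (hβb : β ≤ b)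
    (hB : 0 ≤ B) : ∃ A > 0, ∀ᶠ n : ℕ in atTop, ∃ ks, hMin d n ≤ bandwidth d b n ks ∧
      (∀ l, ks ≤ l → B * bandwidth d b n l ^ β ≤ stdBound d b n l) ∧
      stdBound d b n ks ≤ A * rate d b n β := by
  have hd1 : (1 : ℝ) ≤ d := by exact_mod_cast hd
  have hb1 : (1 : ℝ) ≤ b := by exact_mod_cast hb
  set e : ℝ := 2 * β + d with he
  have he1 : 1 < e := by linarith
  have he0 : 0 < e := by linarith
  have hinv : 0 < 1 - 1 / e := by
    rw [sub_pos, div_lt_one he0]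
    exact he1
  -- The constant ensures `B² a^e ≤ 1 - 1/e`, the factor by which `ks ln 2` may fall short of `y`.
  set a : ℝ := min 1 (((1 - 1 / e) / (B ^ 2 + 1)) ^ (1 / e)) with ha
  have ha0 : 0 < a := lt_min one_pos (Real.rpow_pos_of_pos (by positivity) _)
  have ha1 : a ≤ 1 := min_le_left _ _
  have hae : B ^ 2 * a ^ e ≤ 1 - 1 / e := by
    have h1 : a ^ e ≤ (1 - 1 / e) / (B ^ 2 + 1) := by
      refine (Real.rpow_le_rpow ha0.le (min_le_right _ _) he0.le).trans (le_of_eq ?_)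
      rw [← Real.rpow_mul (by positivity), one_div_mul_cancel he0.ne', Real.rpow_one]
    calc B ^ 2 * a ^ e ≤ B ^ 2 * ((1 - 1 / e) / (B ^ 2 + 1)) := by gcongr
      _ = (1 - 1 / e) * (B ^ 2 / (B ^ 2 + 1)) := by ring
      _ ≤ (1 - 1 / e) * 1 := by
          gcongr
          rw [div_le_one (by positivity)]
          linarith
      _ = _ := mul_one _
  have hloga : 0 ≤ Real.log (2 / a) := Real.log_nonneg (by
    rw [le_div_iff₀ ha0]
    linarith)
  refine ⟨Real.sqrt ((1 + Real.log (2 / a)) * (2 / a) ^ d), Real.sqrt_pos.2 (by positivity), ?_⟩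
  -- Since `1/d > 1/e`, a power of `n` separates `h_min` from the oracle bandwidth and absorbs the
  -- logarithm in `h_min`.
  have hev : ∀ᶠ n : ℕ in atTop, Real.log n ^ (2 / d : ℝ)
      ≤ a / 2 * (n : ℝ) ^ (1 / d - 1 / e : ℝ) := by
    have hpos : (0 : ℝ) < 1 / d - 1 / e := by
      rw [sub_pos]
      exact one_div_lt_one_div_of_lt (by linarith) (by linarith)
    have h1 := (isLittleO_log_rpow_rpow_atTop (2 / d : ℝ) hpos).comp_tendsto
      tendsto_natCast_atTop_atTop
    have h2 := h1.bound (show 0 < a / 2 by positivity)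
    filter_upwards [h2] with n hn
    simp only [Function.comp, Real.norm_eq_abs] at hn
    rw [abs_of_nonneg (Real.rpow_nonneg (Nat.cast_nonneg n) _)] at hn
    exact (le_abs_self _).trans hn
  filter_upwards [hev, eventually_ge_atTop 1] with n hlogn hn
  have hn1 : (1 : ℝ) ≤ n := by exact_mod_cast hn
  have hn0 : (0 : ℝ) < n := by linarith
  have hln : 0 ≤ Real.log n := Real.log_natCast_nonneg n
  set y : ℝ := 2 * (b - β) / (e * (2 * b + d)) * Real.log n with hy
  have hy0 : 0 ≤ y := mul_nonneg (div_nonneg (by linarith) (by positivity)) hln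
  have hϱ : adaptPrice d b n β = 1 + y := rfl
  set h₀ : ℝ := ((1 + y) / n) ^ (1 / e) with hh₀
  have hq0 : 0 < (1 + y) / n := by positivity
  have hh₀0 : 0 < h₀ := Real.rpow_pos_of_pos hq0 _
  have hmax0 := hMax_pos d b hn
  have hlogy : Real.log (1 + y) ≤ y := by
    have := Real.log_le_sub_one_of_pos (show 0 < 1 + y by linarith)
    linarith
  have hlogy0 : 0 ≤ Real.log (1 + y) := Real.log_nonneg (by linarith)
  -- By partial fractions, `y = (1/e - 1/(2b+d)) ln n` is exactly the logarithm of `n^{-1/(2b+d)} /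
  -- n^{-1/e}`. The factor `1 + y` inside `h₀` only subtracts `ln(1+y)/e`, so the log-ratio lies
  -- between `(1 - 1/e) y` and `y`.
  have hratio : Real.log (hMax d b n) - Real.log h₀ = y - Real.log (1 + y) / e := by
    rw [hh₀, Real.log_rpow hq0, Real.log_div (by linarith) hn0.ne', hMax, Real.log_rpow hn0, hy, he]
    field_simp
    ring
  have hrl : y * (1 - 1 / e) ≤ Real.log (hMax d b n) - Real.log h₀ := by
    rw [hratio]
    have : Real.log (1 + y) / e ≤ y / e := by gcongr
    have e2 : y * (1 - 1 / e) = y - y / e := by ring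
    linarith
  have hru : Real.log (hMax d b n) - Real.log h₀ ≤ y := by
    rw [hratio]
    have : 0 ≤ Real.log (1 + y) / e := by positivity
    linarith
  have hle : h₀ ≤ hMax d b n := by
    rw [← Real.log_le_log_iff hh₀0 hmax0]
    have : 0 ≤ y * (1 - 1 / e) := by positivity
    linarith
  -- The oracle index is the first one with bandwidth below `a h₀`. That bandwidth is also at least
  -- `a h₀ / 2`: by minimality, or, when the index is 0, because `a h₀ ≤ h₀ ≤ h_max`.
  have hex : ∃ k : ℕ, bandwidth d b n k ≤ a * h₀ := by
    obtain ⟨k, hk⟩ := pow_unbounded_of_one_lt (hMax d b n / (a * h₀)) (one_lt_two (α := ℝ))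
    refine ⟨k, ?_⟩
    unfold bandwidth
    rw [div_lt_iff₀ (by positivity)] at hk
    rw [div_le_iff₀ (by positivity)]
    linarith
  classical
  set ks := Nat.find hex with hks
  have hup : bandwidth d b n ks ≤ a * h₀ := Nat.find_spec hex
  have hlow : a * h₀ / 2 ≤ bandwidth d b n ks := by
    rcases Nat.eq_zero_or_pos ks with h0 | h0
    · rw [h0, bandwidth, pow_zero, div_one]
      have : a * h₀ ≤ 1 * h₀ := by gcongr
      have : 0 < a * h₀ := by positivity
      linarith
    · have h1 := Nat.find_min hex (Nat.sub_lt h0 one_pos)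
      rw [not_le, ← hks] at h1
      have h2 : bandwidth d b n (ks - 1) = 2 * bandwidth d b n ks := by
        unfold bandwidth
        obtain ⟨m, hm⟩ := Nat.exists_eq_succ_of_ne_zero h0.ne'
        rw [hm, Nat.succ_eq_add_one, Nat.add_sub_cancel, pow_succ]
        field_simp
      rw [h2] at h1
      linarith
  have hbw := bandwidth_pos d b hn ks
  have hklog : (ks : ℝ) * Real.log 2 = Real.log (hMax d b n) - Real.log (bandwidth d b n ks) := by
    unfold bandwidth
    rw [Real.log_div hmax0.ne' (by positivity), Real.log_pow]
    ring
  have hklow : y * (1 - 1 / e) ≤ ks * Real.log 2 := by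
    rw [hklog]
    have : Real.log (bandwidth d b n ks) ≤ Real.log h₀ :=
      Real.log_le_log hbw (hup.trans (mul_le_of_le_one_left hh₀0.le ha1))
    linarith
  have hkup : ks * Real.log 2 ≤ y + Real.log (2 / a) := by
    rw [hklog]
    have h1 := Real.log_le_log (by positivity) hlow
    have h2 : a * h₀ / 2 = h₀ / (2 / a) := by field_simp
    rw [h2, Real.log_div hh₀0.ne' (by positivity)] at h1
    linarith
  have hh₀e : h₀ ^ e = (1 + y) / n := by
    rw [hh₀, ← Real.rpow_mul hq0.le, one_div_mul_cancel he0.ne', Real.rpow_one]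
  refine ⟨ks, ?_, ?_, ?_⟩
  · refine le_trans ?_ hlow
    have h1 : (n : ℝ) ^ (-(1 / e)) ≤ h₀ := by
      rw [hh₀, Real.rpow_neg hn0.le, ← Real.inv_rpow hn0.le]
      refine Real.rpow_le_rpow (by positivity) ?_ (by positivity)
      rw [inv_eq_one_div]
      gcongr
      linarith
    calc hMin d n ≤ a / 2 * (n : ℝ) ^ (1 / d - 1 / e : ℝ) * (n : ℝ) ^ (-(1 / d) : ℝ) := by
          unfold hMin
          gcongr
      _ = a / 2 * (n : ℝ) ^ (-(1 / e)) := by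
          rw [mul_assoc, ← Real.rpow_add hn0]
          congr 2
          ring
      _ ≤ a / 2 * h₀ := by gcongr
      _ = a * h₀ / 2 := by ring
  -- The bias decreases and `S_n` increases with the index, so the comparison is needed only at
  -- `ks`, where squaring reduces it to `B² a^e (1 + y) ≤ 1 + ks ln 2`.
  · intro l hl
    have hbl := bandwidth_pos d b hn l
    calc B * bandwidth d b n l ^ β ≤ B * bandwidth d b n ks ^ β := by
          gcongr
          exact bandwidth_anti d b n hl
      _ ≤ stdBound d b n ks := by
          refine Real.le_sqrt_of_sq_le ?_
          rw [le_div_iff₀ (by positivity)]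
          have h1 : (bandwidth d b n ks ^ β) ^ 2 * bandwidth d b n ks ^ d
              = bandwidth d b n ks ^ e := by
            rw [← Real.rpow_natCast _ d, ← Real.rpow_natCast _ 2, ← Real.rpow_mul hbw.le,
              ← Real.rpow_add hbw, he]
            congr 1
            push_cast
            ring
          have h2 : bandwidth d b n ks ^ e ≤ a ^ e * ((1 + y) / n) := by
            rw [← hh₀e, ← Real.mul_rpow ha0.le hh₀0.le]
            exact Real.rpow_le_rpow hbw.le hup he0.le
          calc (B * bandwidth d b n ks ^ β) ^ 2 * (n * bandwidth d b n ks ^ d)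
              = B ^ 2 * n * ((bandwidth d b n ks ^ β) ^ 2 * bandwidth d b n ks ^ d) := by ring
            _ ≤ B ^ 2 * n * (a ^ e * ((1 + y) / n)) := by
                rw [h1]
                gcongr
            _ = B ^ 2 * a ^ e * (1 + y) := by field_simp
            _ ≤ (1 - 1 / e) * (1 + y) := by gcongr
            _ ≤ 1 + ks * Real.log 2 := by
                have : 0 < 1 / e := by positivity
                linarith
      _ ≤ stdBound d b n l := stdBound_mono d b hn hl
  · have hrate0 : 0 ≤ rate d b n β := Real.rpow_nonneg (by rw [hϱ]; exact hq0.le) _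
    refine Real.sqrt_le_iff.2 ⟨mul_nonneg (Real.sqrt_nonneg _) hrate0, ?_⟩
    rw [mul_pow, Real.sq_sqrt (by positivity)]
    have hr2 : rate d b n β ^ 2 * (n * h₀ ^ d) = 1 + y := by
      have h1 : rate d b n β ^ 2 * h₀ ^ d = (1 + y) / n := by
        have h2 : rate d b n β = ((1 + y) / n) ^ (β / e) := rfl
        rw [h2, hh₀, ← Real.rpow_natCast _ d, ← Real.rpow_natCast _ 2, ← Real.rpow_mul hq0.le,
          ← Real.rpow_mul hq0.le, ← Real.rpow_add hq0]
        have h3 : β / e * ((2 : ℕ) : ℝ) + 1 / e * d = 1 := by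
          push_cast
          field_simp
          linarith
        rw [h3, Real.rpow_one]
      calc rate d b n β ^ 2 * (n * h₀ ^ d) = n * (rate d b n β ^ 2 * h₀ ^ d) := by ring
        _ = 1 + y := by rw [h1]; field_simp
    rw [div_le_iff₀ (by positivity)]
    calc 1 + ks * Real.log 2 ≤ (1 + Real.log (2 / a)) * (1 + y) := by
          have := mul_nonneg hloga hy0
          linarith
      _ = (1 + Real.log (2 / a)) * (2 / a) ^ d * rate d b n β ^ 2 * (n * (a * h₀ / 2) ^ d) := by
          rw [← hr2]
          have h1 : (2 / a) ^ d * (a * h₀ / 2) ^ d = h₀ ^ d := by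
            rw [← mul_pow]
            congr 1
            field_simp
          calc _ = (1 + Real.log (2 / a)) * rate d b n β ^ 2 * n * h₀ ^ d := by ring
            _ = _ := by rw [← h1]; ring
      _ ≤ _ := by gcongr

/-- A crude lower bound on the rate, sufficient to absorb the contribution of bad curvature, which
is smaller than any power of `n`. -/
theorem one_div_le_rate (hd : 0 < d) {β : ℝ} (hβ : 0 < β) (hβb : β ≤ b) (hn : 1 ≤ n) :
    1 / (n : ℝ) ≤ rate d b n β := by
  have hn1 : (1 : ℝ) ≤ n := by exact_mod_cast hn
  have hn0 : (0 : ℝ) < n := by linarith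
  have hd1 : (1 : ℝ) ≤ d := by exact_mod_cast hd
  have h1 : 1 ≤ adaptPrice d b n β := by
    have : 0 ≤ 2 * (b - β) / ((2 * β + d) * (2 * b + d)) * Real.log n :=
      mul_nonneg (div_nonneg (by linarith) (by positivity)) (Real.log_natCast_nonneg n)
    unfold adaptPrice
    linarith
  have h2 : 1 / (n : ℝ) ≤ 1 := by
    rw [div_le_one hn0]
    exact hn1
  unfold rate
  calc 1 / (n : ℝ) = (1 / (n : ℝ)) ^ (1 : ℝ) := (Real.rpow_one _).symm
    _ ≤ (1 / (n : ℝ)) ^ (β / (2 * β + d)) := by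
        refine Real.rpow_le_rpow_of_exponent_ge (by positivity) h2 ?_
        rw [div_le_one (by positivity)]
        linarith
    _ ≤ _ := by gcongr

/-- Exponentials of `-ln² n` are smaller than every power of `n`. -/
theorem eventually_exp_log_sq_le {c₁ : ℝ} (hc₁ : 0 < c₁) (A q : ℝ) (hA : 0 ≤ A) :
    ∀ᶠ n : ℕ in atTop, A * Real.exp (-(c₁ * Real.log n ^ 2)) ≤ (1 / (n : ℝ)) ^ q := by
  have hlog : Tendsto (fun n : ℕ => Real.log n) atTop atTop :=
    Real.tendsto_log_atTop.comp tendsto_natCast_atTop_atTop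
  filter_upwards [hlog.eventually_ge_atTop (max 1 ((A + |q|) / c₁)), eventually_ge_atTop 1]
    with n hn hn1
  have hn0 : (0 : ℝ) < n := by exact_mod_cast hn1
  have h1 : 1 ≤ Real.log n := (le_max_left _ _).trans hn
  have h2 : A + |q| ≤ c₁ * Real.log n := by
    have := (le_max_right _ _).trans hn
    rw [div_le_iff₀ hc₁] at this
    linarith
  have h3 : (1 / (n : ℝ)) ^ q = Real.exp (-(q * Real.log n)) := by
    rw [Real.rpow_def_of_pos (by positivity), one_div, Real.log_inv]
    congr 1
    ring
  rw [h3]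
  calc A * Real.exp (-(c₁ * Real.log n ^ 2))
      ≤ Real.exp A * Real.exp (-(c₁ * Real.log n ^ 2)) := by
        gcongr
        linarith [Real.add_one_le_exp A]
    _ = Real.exp (A + -(c₁ * Real.log n ^ 2)) := (Real.exp_add _ _).symm
    _ ≤ _ := by
        refine Real.exp_le_exp.2 ?_
        have h4 : (A + |q|) * Real.log n ≤ c₁ * Real.log n * Real.log n := by gcongr
        have h5 : A ≤ A * Real.log n := le_mul_of_one_le_right hA h1
        have h6 : q * Real.log n ≤ |q| * Real.log n := by
          gcongr
          exact le_abs_self q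
        nlinarith

end Rates

/-! ### Tail and exponential moment of the score at the scale of the threshold -/

section Tail

variable {d b n : ℕ} {K : (Fin d → ℝ) → ℝ} {x₀ : Fin d → ℝ} {h : ℝ} {ρ : ℝ → ℝ} {g : ℕ → ℝ → ℝ}
  {u : (Fin d → ℝ) → ℝ}

/-- The Chernoff bound at the level dictated by the threshold. One unit of `S` in the level covers
the bias, and the part with `√(rd)` produces the decay in `l` through `N S² = 1 + l ln 2`. -/
theorem measure_le_scoreNorm_le (hd : 0 < d) (hb : 0 < b) (hK : IsKernel K) (hρ : IsContrast ρ g)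
    (hg : ∀ i, IsNoiseDensity (g i)) (hn : 0 < n) (hh : 0 < h) (hfit : KernelFits K x₀ h)
    (hu : Measurable u) {S r : ℝ} (hr : 0 ≤ r) (hS : 0 < S)
    (hε : ∀ x, K (rescale x₀ h x) ≠ 0 → |u x| ≤ S)
    (hsmall : Real.sqrt (multiIdx d b).card * Real.sqrt (r * d) * S * supNorm K ≤ 1) {l : ℕ}
    (hNS : n * h ^ d * S ^ 2 = 1 + l * Real.log 2) :
    modelLaw d g n {ω | Real.sqrt (multiIdx d b).card *
        (1 + 2 * supNorm K * max 1 (supNorm (deriv ρ)) * Real.sqrt (r * d)) * S ≤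
        scoreNorm b ρ K x₀ h u ω / (n * h ^ d)}
      ≤ ENNReal.ofReal (2 * (multiIdx d b).card * ((2 : ℝ) ^ (-(r * d * l))) ^ 2) := by
  set w := Real.sqrt (multiIdx d b).card with hw
  set R := max 1 (supNorm (deriv ρ)) with hR
  set k := supNorm K with hk
  set σ := Real.sqrt (r * d) with hσ
  have hR1 : 1 ≤ R := le_max_left _ _
  have hRρ : supNorm (deriv ρ) ≤ R := le_max_right _ _
  have hρ0 : 0 ≤ supNorm (deriv ρ) := supNorm_deriv_nonneg hρ
  have hk1 : 1 ≤ k := hK.one_le_supNorm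
  have hσ0 : 0 ≤ σ := Real.sqrt_nonneg _
  have hσ2 : σ ^ 2 = r * d := Real.sq_sqrt (by positivity)
  have hw2 : w ^ 2 = (multiIdx d b).card := Real.sq_sqrt (by positivity)
  have hw2' : 2 ≤ w ^ 2 := by
    rw [hw2]
    exact_mod_cast two_le_card_multiIdx hd hb
  have hw0 : 0 ≤ w := Real.sqrt_nonneg _
  have hw1 : 1 ≤ w := by nlinarith
  set N : ℝ := n * h ^ d with hN
  have hN0 : 0 < N := by positivity
  -- With this choice the quadratic term of the exponent is at most `k (w σ S)²`, while the linear
  -- gain `t (x - S)` is at least twice that.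
  set t := w * σ * S / R with ht
  have ht0 : 0 ≤ t := by positivity
  have htR : t * R = w * σ * S := by rw [ht]; field_simp
  have htR' : t * supNorm (deriv ρ) ≤ w * σ * S := by
    rw [← htR]
    gcongr
  set x := w * (1 + 2 * k * R * σ) * S with hx
  have hmgf := lintegral_exp_scoreNorm_le (n := n) (b := b) hK hρ hg hh hfit hu hε ht0 (by
    calc t * (supNorm (deriv ρ) * supNorm K) = t * supNorm (deriv ρ) * k := by rw [hk]; ring
      _ ≤ w * σ * S * k := by gcongr
      _ ≤ 1 := hsmall)
  have hmeas : Measurable fun ω : Sample d n => Real.exp (t * scoreNorm b ρ K x₀ h u ω) :=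
    ((measurable_scoreNorm hK hu).const_mul t).exp
  have hmark := mul_meas_ge_le_lintegral (μ := modelLaw d g n) hmeas.ennreal_ofReal
    (ENNReal.ofReal (Real.exp (t * (N * x))))
  have hsub : {ω : Sample d n | x ≤ scoreNorm b ρ K x₀ h u ω / N} ⊆
      {ω | ENNReal.ofReal (Real.exp (t * (N * x))) ≤
        ENNReal.ofReal (Real.exp (t * scoreNorm b ρ K x₀ h u ω))} := by
    intro ω hω
    have h1 : x * N ≤ scoreNorm b ρ K x₀ h u ω := (le_div_iff₀ hN0).1 hω
    refine ENNReal.ofReal_le_ofReal (Real.exp_le_exp.2 (mul_le_mul_of_nonneg_left ?_ ht0))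
    linarith
  have hpos : 0 < Real.exp (t * (N * x)) := Real.exp_pos _
  have h1 := (mul_le_mul_right (measure_mono hsub) _).trans (hmark.trans hmgf)
  rw [mul_comm, ← ENNReal.le_div_iff_mul_le (Or.inl (ENNReal.ofReal_pos.2 hpos).ne')
      (Or.inl ENNReal.ofReal_ne_top), ← ENNReal.ofReal_div_of_pos hpos, mul_div_assoc,
      ← Real.exp_sub] at h1
  refine h1.trans (ENNReal.ofReal_le_ofReal ?_)
  refine mul_le_mul_of_nonneg_left ?_ (by positivity)
  have hq : ((2 : ℝ) ^ (-(r * d * l))) ^ 2 = Real.exp (-(2 * σ ^ 2 * (l * Real.log 2))) := by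
    rw [Real.rpow_def_of_pos two_pos, ← Real.exp_nat_mul, hσ2]
    congr 1
    push_cast
    ring
  rw [hq]
  refine Real.exp_le_exp.2 ?_
  have h2 : t ^ 2 * (supNorm (deriv ρ) ^ 2 * k) ≤ (w * σ * S) ^ 2 * k := by
    have := pow_le_pow_left₀ (by positivity) htR' 2
    calc t ^ 2 * (supNorm (deriv ρ) ^ 2 * k) = (t * supNorm (deriv ρ)) ^ 2 * k := by ring
      _ ≤ _ := by gcongr
  have h3 : 2 * k * (w * σ * S) ^ 2 ≤ t * (x - S) := by
    have h4 : x - S = (w - 1) * S + R * (2 * k * w * σ * S) := by rw [hx]; ring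
    have h5 : 0 ≤ t * ((w - 1) * S) := mul_nonneg ht0 (mul_nonneg (by linarith) hS.le)
    calc 2 * k * (w * σ * S) ^ 2 = (t * R) * (2 * k * w * σ * S) := by rw [htR]; ring
      _ ≤ t * ((w - 1) * S) + (t * R) * (2 * k * w * σ * S) := by linarith
      _ = _ := by rw [h4]; ring
  have h6 : N * (t * S + t ^ 2 * (supNorm (deriv ρ) ^ 2 * k)) - t * (N * x)
      ≤ -(N * (k * (w * σ * S) ^ 2)) := by
    have : t * S + t ^ 2 * (supNorm (deriv ρ) ^ 2 * k) - t * x ≤ -(k * (w * σ * S) ^ 2) := by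
      linarith
    have := mul_le_mul_of_nonneg_left this hN0.le
    linarith
  refine h6.trans (neg_le_neg ?_)
  have hl0 : 0 ≤ (l : ℝ) * Real.log 2 :=
    mul_nonneg (Nat.cast_nonneg _) (Real.log_nonneg one_le_two)
  -- Here `w² = N_b ≥ 2` supplies the factor 2, and `k ≥ 1` is discarded.
  calc 2 * σ ^ 2 * (l * Real.log 2) ≤ w ^ 2 * σ ^ 2 * (1 + l * Real.log 2) := by
        gcongr
        linarith
    _ = 1 * (w ^ 2 * σ ^ 2 * (N * S ^ 2)) := by rw [hNS, one_mul]
    _ ≤ k * (w ^ 2 * σ ^ 2 * (N * S ^ 2)) := by gcongr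
    _ = N * (k * (w * σ * S) ^ 2) := by ring

/-- With `t = 1/(N S)` the bias costs at most `N t S = 1`, and the variance term is bounded because
`N ≤ (N S)²`. The same inequality reduces the boundedness condition of the moment estimate to
`hlarge`. -/
theorem lintegral_exp_scoreNorm_div_le (hK : IsKernel K) (hρ : IsContrast ρ g)
    (hg : ∀ i, IsNoiseDensity (g i)) (hn : 0 < n) (hh : 0 < h) (hfit : KernelFits K x₀ h)
    (hu : Measurable u) {S : ℝ} (hS : 0 < S)
    (hε : ∀ x, K (rescale x₀ h x) ≠ 0 → |u x| ≤ S) (hNS : 1 ≤ n * h ^ d * S ^ 2)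
    (hlarge : (supNorm (deriv ρ) * supNorm K) ^ 2 ≤ n * h ^ d) :
    ∫⁻ ω, ENNReal.ofReal (Real.exp (scoreNorm b ρ K x₀ h u ω / (n * h ^ d) / S))
        ∂(modelLaw d g n)
      ≤ ENNReal.ofReal (2 * (multiIdx d b).card *
        Real.exp (1 + supNorm (deriv ρ) ^ 2 * supNorm K)) := by
  set N : ℝ := n * h ^ d with hN
  have hN0 : 0 < N := by positivity
  set t := 1 / (N * S) with ht
  have ht0 : 0 ≤ t := by positivity
  have hρ0 : 0 ≤ supNorm (deriv ρ) := supNorm_deriv_nonneg hρ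
  have hK0 := hK.supNorm_nonneg
  have h1 := lintegral_exp_scoreNorm_le (n := n) (b := b) hK hρ hg hh hfit hu hε ht0 (by
    rw [ht, one_div_mul_eq_div, div_le_one (by positivity)]
    refine le_of_sq_le_sq ?_ (by positivity)
    calc (supNorm (deriv ρ) * supNorm K) ^ 2 ≤ N * 1 := by linarith
      _ ≤ N * (N * S ^ 2) := by gcongr
      _ = (N * S) ^ 2 := by ring)
  have h2 : ∀ ω : Sample d n, scoreNorm b ρ K x₀ h u ω / N / S
      = t * scoreNorm b ρ K x₀ h u ω := fun ω => by
    rw [ht]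
    field_simp
  simp_rw [h2]
  refine h1.trans (ENNReal.ofReal_le_ofReal ?_)
  refine mul_le_mul_of_nonneg_left (Real.exp_le_exp.2 ?_) (by positivity)
  have h3 : N * (t * S) = 1 := by rw [ht]; field_simp
  have h4 : N * t ^ 2 ≤ 1 := by
    rw [ht, div_pow, one_pow, mul_one_div, div_le_one (by positivity)]
    calc N = N * 1 := (mul_one N).symm
      _ ≤ N * (N * S ^ 2) := by gcongr
      _ = (N * S) ^ 2 := by ring
  calc N * (t * S + t ^ 2 * (supNorm (deriv ρ) ^ 2 * supNorm K))
      = N * (t * S) + N * t ^ 2 * (supNorm (deriv ρ) ^ 2 * supNorm K) := by ring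
    _ ≤ 1 + 1 * (supNorm (deriv ρ) ^ 2 * supNorm K) := by
        rw [h3]
        gcongr
    _ = _ := by ring

end Tail

/-! ### Assembly of the risk bound -/

/-- Bandwidth indices and dyadic radii both number fewer than `n`, so a union bound costs only `n²`.
-/
theorem measure_dyadic_union_le {Ω : Type*} [MeasurableSpace Ω] {μ : Measure Ω}
    {F : ℕ → ℕ → Set Ω} {p : ℕ → ℕ → Prop} {n : ℕ} {ε : ℝ} (hε : 0 ≤ ε)
    (hp : ∀ l j, p l j → l < n ∧ j < n) (hF : ∀ l j, p l j → μ (F l j) ≤ ENNReal.ofReal ε) :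
    μ {ω | ∃ l j, p l j ∧ ω ∈ F l j} ≤ ENNReal.ofReal (n ^ 2 * ε) := by
  classical
  set I := ((Finset.range n) ×ˢ (Finset.range n)).filter fun lj : ℕ × ℕ => p lj.1 lj.2 with hI
  have hsub : {ω | ∃ l j, p l j ∧ ω ∈ F l j} ⊆ ⋃ lj ∈ I, F lj.1 lj.2 := by
    rintro ω ⟨l, j, hlj, hω⟩
    refine Set.mem_iUnion₂.2 ⟨(l, j), ?_, hω⟩
    simp only [hI, Finset.mem_filter, Finset.mem_product, Finset.mem_range]
    exact ⟨hp l j hlj, hlj⟩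
  have hcard : (I.card : ℝ) ≤ n ^ 2 := by
    have : I.card ≤ n * n := (Finset.card_filter_le _ _).trans (by simp)
    rw [sq]
    exact_mod_cast this
  calc μ {ω | ∃ l j, p l j ∧ ω ∈ F l j} ≤ ∑ lj ∈ I, μ (F lj.1 lj.2) :=
        (measure_mono hsub).trans (measure_biUnion_finset_le _ _)
    _ ≤ ∑ _lj ∈ I, ENNReal.ofReal ε :=
        Finset.sum_le_sum fun lj hlj => hF _ _ (Finset.mem_filter.1 hlj).2
    _ = ENNReal.ofReal (I.card * ε) := by
        rw [Finset.sum_const, nsmul_eq_mul, ENNReal.ofReal_mul (Nat.cast_nonneg _),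
          ENNReal.ofReal_natCast]
    _ ≤ _ := ENNReal.ofReal_le_ofReal (by gcongr)

set_option maxHeartbeats 1000000 in
/-- The risk bound behind the main theorem. -/
theorem exists_maxRisk_le {d b : ℕ} (hd : 0 < d) (hb : 0 < b) {M : ℝ} (hM : 0 < M) {c : ℝ}
    (hc : 0 < c) {x₀ : Fin d → ℝ} (hx₀ : x₀ ∈ cube d) {K : (Fin d → ℝ) → ℝ} (hK : IsKernel K)
    (hKx₀ : KernelInward K x₀) {ρ : ℝ → ℝ} {g : ℕ → ℝ → ℝ} (hρ : IsContrast ρ g)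
    (hg : g ∈ noiseClass ρ c) {θ : (n : ℕ) → ℝ → Sample d n → multiIdx d b → ℝ}
    (hθ : ∀ (n : ℕ) (h : ℝ), 0 < h → h ≤ 1 → IsLPAMinimizer ρ K x₀ M h (θ n h))
    {r : ℝ} (hr : 1 ≤ r) {β : ℝ} (hβ : 0 < β) (hβb : β ≤ b) {L : ℝ} (hL : 0 < L) :
    ∃ A ≥ 0, ∀ᶠ n : ℕ in atTop, maxRisk g r x₀
      (adaptiveEstimator (n := n) (thresholdConst b ρ K c r) θ) (holderClass d β L M)
        ≤ ENNReal.ofReal (A * rate d b n β ^ r) := by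
  have hr0 : 0 ≤ r := by linarith
  have hlam := minEigenvalue_pos hK b
  have hK1 := hK.one_le_supNorm
  have hρ0 : 0 ≤ supNorm (deriv ρ) := supNorm_deriv_nonneg hρ
  obtain ⟨η, hη, C₁, hC₁, c₁, hc₁, hflat⟩ := exists_measure_flatSet_le hK b hρ hc hg
  obtain ⟨h₁, hh₁, hfits⟩ := exists_kernelFits hK hx₀ hKx₀
  obtain ⟨A₀, hA₀, horacle⟩ := exists_oracle_index (B := L * d ^ β) hd hb hβ hβb (by positivity)
  set Nb : ℝ := ((multiIdx d b).card : ℝ) with hNb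
  have hNb2 : 2 ≤ Nb := by
    rw [hNb]
    exact_mod_cast two_le_card_multiIdx hd hb
  set Γ : ℝ := 1 + 2 * supNorm K * max 1 (supNorm (deriv ρ)) * Real.sqrt (r * d) with hΓ
  have hΓ1 : 1 ≤ Γ := by
    have : 0 ≤ 2 * supNorm K * max 1 (supNorm (deriv ρ)) * Real.sqrt (r * d) := by positivity
    linarith
  set C := thresholdConst b ρ K c r with hC
  have hCeq : C = 4 * Nb / (c * minEigenvalue b K) * Γ := rfl
  have hC0 : 0 < C := by
    rw [hCeq]
    positivity
  set C' : ℝ := 4 * (1 + 2 * M / η) * Real.sqrt Nb / (c * minEigenvalue b K) with hC'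
  have hC'0 : 0 ≤ C' := by positivity
  obtain ⟨B, hB0, hlepski⟩ := exists_lepski_risk_le hd hr (D := 2 * C + C') (P := 2 * Nb)
    (Q := 2 * Nb * Real.exp (1 + supNorm (deriv ρ) ^ 2 * supNorm K))
    (by positivity) (by positivity) (by positivity)
  refine ⟨B * A₀ ^ r + 1, by positivity, ?_⟩
  -- the scale below which all standard deviations have to lie
  set s₀ : ℝ := min (min η (2 * η / C))
    (1 / (Real.sqrt Nb * Real.sqrt (r * d) * supNorm K + 1)) with hs₀
  have hs₀0 : 0 < s₀ := lt_min (lt_min hη (by positivity)) (by positivity)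
  have hlogtop : Tendsto (fun n : ℕ => Real.log n) atTop atTop :=
    Real.tendsto_log_atTop.comp tendsto_natCast_atTop_atTop
  have hmaxev : ∀ᶠ n : ℕ in atTop, hMax d b n ≤ h₁ := by
    have h1 : Tendsto (fun n : ℕ => hMax d b n) atTop (nhds 0) :=
      (tendsto_rpow_neg_atTop (by positivity)).comp tendsto_natCast_atTop_atTop
    exact (h1.eventually_lt_const hh₁).mono fun _ h => h.le
  have hpowev : ∀ᶠ n : ℕ in atTop, 2 * η / C * n < 2 ^ n := by
    have h1 : Tendsto (fun n : ℕ => (n : ℝ) ^ 1 / (2 : ℝ) ^ n) atTop (nhds 0) :=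
      tendsto_pow_const_div_const_pow_of_one_lt 1 one_lt_two
    filter_upwards [h1.eventually_lt_const (show 0 < C / (2 * η) by positivity)] with n hn
    rw [pow_one, div_lt_iff₀ (by positivity)] at hn
    calc 2 * η / C * n < 2 * η / C * (C / (2 * η) * 2 ^ n) := by gcongr
      _ = 2 ^ n := by field_simp
  -- The exponent `r + 2` leaves room for the `n²` sets of the union bound on top of the lower bound
  -- `n^{-r}` for the rate to the power `r`.
  filter_upwards [horacle, hmaxev, hpowev, eventually_ge_atTop 1,
    hlogtop.eventually_ge_atTop (max 1 (max (2 / s₀ ^ 2) (supNorm (deriv ρ) * supNorm K))),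
    eventually_exp_log_sq_le hc₁ ((2 * M) ^ r * C₁) (r + 2) (by positivity)]
    with n ⟨ks, hks1, hks2, hks3⟩ hmaxn hpown hn hlogn hexpn
  have hn0 : (0 : ℝ) < n := by exact_mod_cast hn
  have hlog1 : 1 ≤ Real.log n := (le_max_left _ _).trans hlogn
  have hlog2 : 2 / s₀ ^ 2 ≤ Real.log n :=
    ((le_max_left _ _).trans (le_max_right _ _)).trans hlogn
  have hlog3 : supNorm (deriv ρ) * supNorm K ≤ Real.log n :=
    ((le_max_right _ _).trans (le_max_right _ _)).trans hlogn
  obtain ⟨hksL, hkLn, hNlog⟩ := kLast_facts hd hn hlog1 hks1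
  set kL := kLast d b n with hkL
  have hkLn' : kL < n := by
    have h1 : 2 ^ kL ≤ n := by exact_mod_cast hkLn
    exact lt_of_lt_of_le Nat.lt_two_pow_self h1
  set hh : ℕ → ℝ := bandwidth d b n with hhdef
  set S : ℕ → ℝ := stdBound d b n with hSdef
  have hh0 : ∀ k, 0 < hh k := bandwidth_pos d b hn
  have hh1 : ∀ k, hh k ≤ 1 := bandwidth_le_one d b hn
  have hfit : ∀ k, KernelFits K x₀ (hh k) := fun k =>
    hfits _ (hh0 k) ((bandwidth_le_hMax d b n k).trans hmaxn)
  have hS0 : ∀ k, 0 < S k := stdBound_pos d b hn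
  have hNS : ∀ l, n * hh l ^ d * S l ^ 2 = 1 + l * Real.log 2 := fun l => by
    have h1 := hh0 l
    rw [hSdef, stdBound_sq d b hn, mul_div_cancel₀ _ (by positivity)]
  have hSs : ∀ l ≤ kL, S l ≤ s₀ := fun l hl => by
    refine le_of_sq_le_sq ((kLast_stdBound_sq_le hn hlog1 hkLn hNlog l hl).trans ?_) hs₀0.le
    rw [div_le_iff₀ (by linarith)]
    rw [div_le_iff₀ (by positivity)] at hlog2
    linarith
  have hSη : ∀ l ≤ kL, S l ≤ η := fun l hl =>
    (hSs l hl).trans ((min_le_left _ _).trans (min_le_left _ _))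
  have hτη : ∀ l ≤ kL, C / 2 * S l ≤ η := fun l hl => by
    have := (hSs l hl).trans ((min_le_left _ _).trans (min_le_right _ _))
    rw [le_div_iff₀ hC0] at this
    linarith
  have hτ0 : ∀ l, 0 < C / 2 * S l := fun l => mul_pos (by positivity) (hS0 l)
  have hSsmall : ∀ l ≤ kL, Real.sqrt Nb * Real.sqrt (r * d) * S l * supNorm K ≤ 1 := by
    intro l hl
    have h1 := (hSs l hl).trans (min_le_right _ _)
    have h2 : 0 ≤ Real.sqrt Nb * Real.sqrt (r * d) * supNorm K := by positivity
    rw [le_div_iff₀ (by positivity)] at h1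
    have := (hS0 l).le
    nlinarith
  have hrate := one_div_le_rate hd hβ hβb hn
  have hrate0 : 0 ≤ rate d b n β := le_trans (by positivity) hrate
  -- The function enters only here: all constants and the range of `n` were fixed before, which
  -- makes the bound uniform over the class.
  refine iSup₂_le fun f hf => ?_
  obtain ⟨hfc, hfM, hft⟩ := holderClass_expansion (b := b) hβ hβb hL.le hM.le hf hx₀
  choose t htM ht0 htapp using fun k => hft (hh k) ⟨hh0 k, hh1 k⟩
  set u : ℕ → (Fin d → ℝ) → ℝ := fun k => approxError f x₀ (hh k) (t k) with hu
  have hum : ∀ k, Measurable (u k) := fun k => measurable_approxError hfc (t k)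
  have hub : ∀ k, ks ≤ k → ∀ x, K (rescale x₀ (hh k) x) ≠ 0 → |u k x| ≤ S k := by
    intro k hk x hx
    have hxc := hfit k x hx
    have hbox := hK.support _ hx
    refine le_trans ?_ (hks2 k hk)
    simp only [hu, approxError, Set.indicator_of_mem hxc]
    refine (htapp k x hxc).trans ?_
    have h1 : ∑ j, |x j - x₀ j| ≤ d * hh k := by
      calc ∑ j, |x j - x₀ j| ≤ ∑ _j : Fin d, hh k := Finset.sum_le_sum fun j _ => by
            have h2 : |(x j - x₀ j) / hh k| ≤ 1 / 2 := abs_le.2 ⟨hbox.1 j, hbox.2 j⟩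
            rw [abs_div, abs_of_pos (hh0 k), div_le_iff₀ (hh0 k)] at h2
            linarith [hh0 k]
        _ = d * hh k := by simp
    rw [mul_assoc, ← Real.mul_rpow (Nat.cast_nonneg d) (hh0 k).le]
    exact mul_le_mul_of_nonneg_left (Real.rpow_le_rpow
      (Finset.sum_nonneg fun _ _ => abs_nonneg _) h1 hβ.le) hL.le
  set W : ℕ → Sample d n → ℝ := fun k ω => scoreNorm b ρ K x₀ (hh k) (u k) ω / (n * hh k ^ d)
    with hW
  set bad : Set (Sample d n) := {ω | ∃ l j : ℕ, (ks ≤ l ∧ l ≤ kL ∧ 2 ^ j * (C / 2 * S l) ≤ η) ∧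
    ω ∈ flatSet b n ρ K x₀ c (hh l) (u l) (2 ^ j * (C / 2 * S l))} with hbad
  have hbadm : modelLaw d g n bad ≤
      ENNReal.ofReal (n ^ 2 * (C₁ * Real.exp (-(c₁ * Real.log n ^ 2)))) := by
    refine measure_dyadic_union_le (by positivity) ?_ ?_
    · rintro l j ⟨hl1, hl2, hj⟩
      refine ⟨lt_of_le_of_lt hl2 hkLn', ?_⟩
      by_contra hjn
      push Not at hjn
      -- A radius with `j ≥ n` would exceed `η`, since `S_n(l) ≥ 1/n` and `2^n` outgrows `(2η/C) n`.
      have h1 := one_div_le_stdBound d b hn l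
      have h2 : (2 : ℝ) ^ n ≤ 2 ^ j := pow_le_pow_right₀ one_le_two hjn
      have h3 : (2 : ℝ) ^ n * (C / 2 * (1 / n)) ≤ η := le_trans (by gcongr) hj
      have h4 : (2 : ℝ) ^ n ≤ 2 * η / C * n := by
        calc (2 : ℝ) ^ n = 2 ^ n * (C / 2 * (1 / n)) * (2 / C * n) := by field_simp
          _ ≤ η * (2 / C * n) := by gcongr
          _ = 2 * η / C * n := by ring
      linarith
    · rintro l j ⟨hl1, hl2, hj⟩
      refine (hflat n x₀ (hh l) _ (u l) (hh0 l) (hfit l) (hum l)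
        (fun x hx => (hub l hl1 x hx).trans (hSη l hl2))
        (mul_pos (by positivity) (hτ0 l)) hj).trans (ENNReal.ofReal_le_ofReal ?_)
      have := hNlog l hl2
      gcongr
  -- This is the calibration of `C`: the curvature bound at radius `C S_n(l)/2` equals `N_b Γ
  -- S_n(l)`. Dividing by the `√N_b` in front of the score leaves the level of the tail bound.
  have hxeq : ∀ l, c * minEigenvalue b K / 2 * (C / 2 * S l) = Nb * Γ * S l := fun l => by
    rw [hCeq]
    field_simp
    norm_num
  have hsq : Real.sqrt Nb * Real.sqrt Nb = Nb := Real.mul_self_sqrt (by positivity)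
  have hsq0 : 0 < Real.sqrt Nb := Real.sqrt_pos.2 (by positivity)
  have herr : ∀ ω ∉ bad, ∀ l, ks ≤ l → l ≤ kL →
      (C / 2 * S l < |lpaEstimator θ n l (observe f ω) - f x₀| →
        Real.sqrt Nb * Γ * S l ≤ W l ω) ∧
      |lpaEstimator θ n l (observe f ω) - f x₀| ≤ C / 2 * S l + C' * W l ω := by
    intro ω hω l hl1 hl2
    have h1 := estimator_error_le (c := c) hK hρ hn (hh0 l) (hfit l) hc hM
      (hθ n (hh l) (hh0 l) (hh1 l)) f (htM l) (ω := ω) (hτ0 l) (hτη l hl2)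
      (fun j hj hmem => hω ⟨l, j, ⟨hl1, hl2, hj⟩, hmem⟩)
    rw [ht0 l, hxeq l] at h1
    refine ⟨fun hlt => ?_, h1.2⟩
    have h2 := h1.1 hlt
    rw [← hsq, mul_assoc (Real.sqrt Nb), mul_assoc (Real.sqrt Nb)] at h2
    exact le_of_mul_le_mul_left h2 hsq0
  have hW0 : ∀ k ω, 0 ≤ W k ω := fun k ω => by
    have := hh0 k
    exact div_nonneg (norm_nonneg _) (by positivity)
  -- The coefficient `3/2 C` is the threshold `C` plus the radius `C/2` in the error bound at the
  -- oracle index. Without selection past the oracle this is the whole loss; past it, only `C/2`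
  -- occurs.
  have hDle : ∀ (a S w : ℝ), 0 < S → 0 ≤ w → a ≤ 3 / 2 * C * S + C' * w →
      a ≤ (2 * C + C') * S * (1 + w / S) := by
    intro a S w hS hw ha
    have h1 : (2 * C + C') * S * (1 + w / S) = (2 * C + C') * (S + w) := by field_simp
    rw [h1]
    have := mul_nonneg hC0.le hS.le
    have := mul_nonneg hC0.le hw
    have := mul_nonneg hC'0 hS.le
    linarith
  have hrisk := hlepski (Sample d n) (modelLaw d g n) kL ks S (fun l => Real.sqrt Nb * Γ * S l) W
    (fun ω => |adaptiveEstimator C θ n (observe f ω) - f x₀|) bad (2 * M) hksL hS0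
    (fun k _ => stdBound_le_mul d b hn ks k)
    (fun k => (measurable_scoreNorm hK (hum k)).div_const _) hW0 (fun ω => abs_nonneg _)
    (fun ω => by
      set k := selectedIndex C θ n (observe f ω)
      have h1 := ((hθ n (hh k) (hh0 k) (hh1 k)).2 (observe f ω)).1
      have h2 : |θ n (hh k) (observe f ω) (zeroIdx d b)| ≤ M :=
        (Finset.single_le_sum (f := fun p => |θ n (hh k) (observe f ω) p|)
          (fun _ _ => abs_nonneg _) (Finset.mem_univ (zeroIdx d b))).trans h1
      refine (abs_sub _ _).trans ?_
      have h3 : |adaptiveEstimator C θ n (observe f ω)| ≤ M := h2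
      linarith)
    (fun l hl1 hl2 => measure_le_scoreNorm_le hd hb hK hρ hg.1 hn (hh0 l) (hfit l) (hum l) hr0
      (hS0 l) (hub l hl1) (hSsmall l hl2) (hNS l))
    (fun l hl1 hl2 => lintegral_exp_scoreNorm_div_le hK hρ hg.1 hn (hh0 l) (hfit l) (hum l)
      (hS0 l) (hub l hl1) (by rw [hNS l]; exact one_le_one_add_mul_log l)
      ((pow_le_pow_left₀ (by positivity) hlog3 2).trans (hNlog l hl2)))
    (fun ω hω => by
      rcases lepski_alternative (e := fun k => lpaEstimator θ n k (observe f ω)) (a := f x₀)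
        hC0.le hksL (fun k _ l _ hkl => stdBound_mono d b hn hkl)
        (k := selectedIndex C θ n (observe f ω)) rfl (hS0 ks).le with h1 | ⟨h1, h2, l, h3, h4, h5, h6⟩
      · left
        refine hDle _ _ _ (hS0 ks) (hW0 ks ω) ?_
        have h2 := (herr ω hω ks le_rfl hksL).2
        have h3 : |adaptiveEstimator C θ n (observe f ω) - f x₀|
          ≤ C * S ks + |lpaEstimator θ n ks (observe f ω) - f x₀| := h1
        linarith
      · right
        refine ⟨selectedIndex C θ n (observe f ω), l, h1, h2, h3, h5, h4,
          (herr ω hω l h5 h4).1 h6, ?_⟩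
        refine hDle _ _ _ (hS0 _) (hW0 _ ω) ?_
        have h7 : |adaptiveEstimator C θ n (observe f ω) - f x₀| ≤ _ :=
          (herr ω hω _ h1.le h2).2
        have h8 := mul_nonneg hC0.le (hS0 (selectedIndex C θ n (observe f ω))).le
        linarith)
  refine hrisk.trans ?_
  have hfirst : B * S ks ^ r ≤ B * A₀ ^ r * rate d b n β ^ r := by
    rw [mul_assoc, ← Real.mul_rpow hA₀.le hrate0]
    exact mul_le_mul_of_nonneg_left (Real.rpow_le_rpow (hS0 ks).le hks3 hr0) hB0
  have hsecond : (2 * M) ^ r * (n ^ 2 * (C₁ * Real.exp (-(c₁ * Real.log n ^ 2))))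
      ≤ rate d b n β ^ r := by
    calc (2 * M) ^ r * (n ^ 2 * (C₁ * Real.exp (-(c₁ * Real.log n ^ 2))))
        = n ^ 2 * ((2 * M) ^ r * C₁ * Real.exp (-(c₁ * Real.log n ^ 2))) := by ring
      _ ≤ n ^ 2 * (1 / (n : ℝ)) ^ (r + 2) := by gcongr
      _ = (1 / (n : ℝ)) ^ r := by
          rw [Real.rpow_add (by positivity), Real.rpow_two]
          field_simp
      _ ≤ rate d b n β ^ r := Real.rpow_le_rpow (by positivity) hrate hr0
  calc ENNReal.ofReal (B * S ks ^ r) + ENNReal.ofReal ((2 * M) ^ r) * modelLaw d g n bad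
      ≤ ENNReal.ofReal (B * A₀ ^ r * rate d b n β ^ r) + ENNReal.ofReal (rate d b n β ^ r) := by
        refine add_le_add (ENNReal.ofReal_le_ofReal hfirst) ?_
        refine (mul_le_mul_right hbadm _).trans ?_
        rw [← ENNReal.ofReal_mul (by positivity)]
        exact ENNReal.ofReal_le_ofReal hsecond
    _ = _ := by
        rw [← ENNReal.ofReal_add (by positivity) (by positivity)]
        congr 1
        ring

end RhoLPA

theorem theorem2 (d b : ℕ) (hd : 0 < d) (hb : 0 < b) (M : ℝ) (hM : 0 < M) (c : ℝ) (hc : 0 < c)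
    (x₀ : Fin d → ℝ) (hx₀ : x₀ ∈ RhoLPA.cube d)
    (K : (Fin d → ℝ) → ℝ) (hK : RhoLPA.IsKernel K) (hKx₀ : RhoLPA.KernelInward K x₀)
    (ρ : ℝ → ℝ) (g : ℕ → ℝ → ℝ) (hρ : RhoLPA.IsContrast ρ g) (hg : g ∈ RhoLPA.noiseClass ρ c)
    (θ : (n : ℕ) → ℝ → RhoLPA.Sample d n → RhoLPA.multiIdx d b → ℝ)
    (hθ : ∀ (n : ℕ) (h : ℝ), 0 < h → h ≤ 1 → RhoLPA.IsLPAMinimizer ρ K x₀ M h (θ n h))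
    (r : ℝ) (hr : 1 ≤ r) :
    ∀ β ∈ Set.Ioc (0 : ℝ) b, ∀ L > (0 : ℝ),
      limsup (fun n : ℕ =>
        (ENNReal.ofReal (RhoLPA.rate d b n β ^ r))⁻¹ *
          RhoLPA.maxRisk g r x₀
            (RhoLPA.adaptiveEstimator (n := n) (RhoLPA.thresholdConst b ρ K c r) θ)
            (RhoLPA.holderClass d β L M)) atTop < ⊤ := by
  rintro β ⟨hβ, hβb⟩ L hL
  obtain ⟨A, hA, hev⟩ := RhoLPA.exists_maxRisk_le hd hb hM hc hx₀ hK hKx₀ hρ hg hθ hr hβ hβb hL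
  refine lt_of_le_of_lt (limsup_le_of_le (a := ENNReal.ofReal A) (by isBoundedDefault) ?_)
    ENNReal.ofReal_lt_top
  filter_upwards [hev, eventually_ge_atTop 1] with n hn hn1
  have hn0 : (0 : ℝ) < n := by exact_mod_cast hn1
  have hrate : 0 < RhoLPA.rate d b n β :=
    lt_of_lt_of_le (by positivity) (RhoLPA.one_div_le_rate hd hβ hβb hn1)
  have hpos : 0 < RhoLPA.rate d b n β ^ r := Real.rpow_pos_of_pos hrate r
  refine (mul_le_mul_right hn _).trans ?_
  rw [ENNReal.ofReal_mul hA, mul_comm (ENNReal.ofReal A), ← mul_assoc,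
    ENNReal.inv_mul_cancel (ENNReal.ofReal_pos.2 hpos).ne' ENNReal.ofReal_ne_top, one_mul]
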